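/- Conventions. For a connected graph $G$ of bounded degree, a Jacobi matrix on $G$ is the operator $(H\psi)(v)=\sum_{u\sim v}a_{u,v}\psi(u)+b(v)\psi(v)$ on $\ell^2(V(G);\mathbb C)$ with bounded real coefficients, $a_{u,v}=a_{v,u}>0$ for $u\sim v$; the adjacency operator $A_G$ is the case $a\equiv 1$, $b\equiv 0$. The essential spectrum $\sigma_{\mathrm{ess}}(A)$ of a bounded self-adjoint operator $A$ is its spectrum $\sigma(A)$ without the isolated eigenvalues of finite multiplicity. A path to infinity in $G$ is a sequence of vertices $(v_n)_{n\ge0}$ with $v_{n+1}\sim v_n$ and $\mathrm{dist}(v_n,v_0)\to\infty$ monotonically. A coherent sequence at a vertex $v$ is a sequence of bijections $\eta_r:B_r(v)\to\{1,\dots,|B_r(v)|\}$, $r\ge1$, with $\eta_s=\eta_r$ on $B_r(v)$ for $r<s$; $M^{(v)}_{\eta_r,r}$ denotes the matrix of the restriction of $H$ to $\ell^2(B_r(v))$ in the enumeration $\eta_r$. A Jacobi matrix $H'$ on a connected graph $G'$ of bounded degree is an $\mathcal R$-limit of $H$ if there are a path to infinity $(v_n)$ in $G$, a vertex $v_0'$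 of $G'$, a strictly increasing sequence of indices $(n_j)$, coherent sequences $\eta^{(j)}$ at $v_{n_j}$ and a coherent sequence $\eta'$ at $v_0'$ such that, for every $r\ge1$, $|B_r(v_{n_j})|=|B_r(v_0')|$ for all large $j$ and $M^{(v_{n_j})}_{\eta^{(j)}_r,r}\to M^{(v_0')}_{\eta'_r,r}$ as $j\to\infty$. Theorem. There exist an integer $d>2$, finite connected $d$-regular graphs $G_i$ ($i\in\mathbb N$) with marked vertices $u_i^{(1)},u_i^{(2)}\in G_i$ such that $|V(G_i)|\to\infty$, $\mathrm{girth}(G_i)\to\infty$ and $\mathrm{dist}_{G_i}(u_i^{(1)},u_i^{(2)})\to\infty$, and a strictly increasing sequence $k_i\in\mathbb N$ with $k_{i+1}-k_i\to\infty$, such that the graph $G$ obtained from the half-line $\mathbb N$ by replacing, for each $i$, the edge $\{k_i,k_i+1\}$ by the graph $G_i$ together with the two edges $\{k_i,u_i^{(1)}\}$ and $\{u_i^{(2)},k_i+1\}$ is connected, has bounded degree, and has the following properties. (a) The point $d$ lies in the essential spectrum of $A_G$ but not in the closure of the union of the spectra of all $\mathcal R$-limits of $A_G$: $$d\in\sigma_{\mathrm{ess}}(A_G)\setminus\overline{\bigcup_{L\text{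 is an }\mathcal R\text{-limit of }A_G}\sigma(L)};$$ in particular this difference is non-empty. (b) Every $\mathcal R$-limit of $A_G$ is the adjacency operator of a graph isomorphic to the line $\mathbb Z$, to the $d$-regular tree, or to the tree $\widetilde T$ formed by joining the end point of a half-line by an edge to a vertex of the $d$-regular tree; and each of these three occurs as an $\mathcal R$-limit of $A_G$. -/

import Mathlib

open Filter Topology
open scoped ENNReal

noncomputable section

/-! ### Jacobi operators on graphs -/

/-- A graph has bounded degree if the vertex degrees are bounded by a natural number. -/
def BoundedDegree {V : Type*} (G : SimpleGraph V) : Prop :=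
  ∃ D : ℕ, ∀ v, (G.neighborSet v).encard ≤ D

theorem BoundedDegree.finite {V : Type*} {G : SimpleGraph V} (hG : BoundedDegree G) (v : V) :
    (G.neighborSet v).Finite := by
  obtain ⟨D, hD⟩ := hG
  exact Set.finite_of_encard_le_coe (hD v)

/-- The finite set of neighbours of a vertex. -/
def BoundedDegree.nbrs {V : Type*} {G : SimpleGraph V} (hG : BoundedDegree G) (v : V) : Finset V :=
  (hG.finite v).toFinset

theorem BoundedDegree.mem_nbrs {V : Type*} {G : SimpleGraph V} (hG : BoundedDegree G) (v u : V) :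
    u ∈ hG.nbrs v ↔ G.Adj v u := by
  simp [BoundedDegree.nbrs]

theorem BoundedDegree.exists_card_le {V : Type*} {G : SimpleGraph V} (hG : BoundedDegree G) :
    ∃ D : ℕ, ∀ v, (hG.nbrs v).card ≤ D := by
  obtain ⟨D, hD⟩ := id hG
  refine ⟨D, fun v => ?_⟩
  have h := hD v
  rw [← (hG.finite v).coe_toFinset, Set.encard_coe_eq_coe_finsetCard] at h
  exact_mod_cast h

/-- The coefficients of a bounded Jacobi matrix on the graph `G`: symmetric positive weights `a` on
the edges (extended by `0` to pairs of non-adjacent vertices) and a real potential `b` on the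
vertices, both bounded. -/
structure JacobiMatrix {V : Type*} (G : SimpleGraph V) where
  a : V → V → ℝ
  b : V → ℝ
  a_symm : ∀ u v, a u v = a v u
  a_pos : ∀ u v, G.Adj u v → 0 < a u v
  a_eq_zero : ∀ u v, ¬ G.Adj u v → a u v = 0
  a_bdd : ∃ C, ∀ u v, a u v ≤ C
  b_bdd : ∃ C, ∀ v, |b v| ≤ C

/-- The complex Hilbert space `ℓ²(V)`. -/
abbrev EllTwo (V : Type*) : Type _ := lp (fun _ : V => ℂ) 2

namespace JacobiMatrix

variable {V : Type*} {G : SimpleGraph V}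

/-- The matrix element `⟨δ_u, H δ_w⟩`. -/
def entry (H : JacobiMatrix G) (u w : V) : ℝ :=
  open Classical in H.a u w + if u = w then H.b u else 0

/-- `(Hψ)(v) = ∑_{u ∼ v} a_{u,v} ψ(u) + b(v) ψ(v)`. -/
def act (H : JacobiMatrix G) (hG : BoundedDegree G) (ψ : V → ℂ) (v : V) : ℂ :=
  ∑ u ∈ hG.nbrs v, (H.a u v : ℂ) * ψ u + (H.b v : ℂ) * ψ v

theorem exists_sum_act_le (H : JacobiMatrix G) (hG : BoundedDegree G) :
    ∃ K : ℝ, 0 ≤ K ∧ ∀ (ψ : EllTwo V) (s : Finset V),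
      ∑ v ∈ s, ‖H.act hG ψ v‖ ^ 2 ≤ K ^ 2 * ‖ψ‖ ^ 2 := by
  classical
  obtain ⟨D, hD⟩ := hG.exists_card_le
  obtain ⟨A, hA⟩ := H.a_bdd
  obtain ⟨B, hB⟩ := H.b_bdd
  set C : ℝ := max 0 (max A B) with hC
  have hC0 : 0 ≤ C := le_max_left _ _
  have ha : ∀ u v, ‖(H.a u v : ℂ)‖ ≤ C := by
    intro u v
    have h0 : 0 ≤ H.a u v := by
      by_cases h : G.Adj u v
      · exact (H.a_pos u v h).le
      · exact (H.a_eq_zero u v h).ge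
    rw [Complex.norm_real, Real.norm_of_nonneg h0]
    exact (hA u v).trans ((le_max_left _ _).trans (le_max_right _ _))
  have hb : ∀ v, ‖(H.b v : ℂ)‖ ≤ C := by
    intro v
    rw [Complex.norm_real, Real.norm_eq_abs]
    exact (hB v).trans ((le_max_right _ _).trans (le_max_right _ _))
  have hsum : ∀ (ψ : EllTwo V) (t : Finset V), ∑ v ∈ t, ‖ψ v‖ ^ 2 ≤ ‖ψ‖ ^ 2 := by
    intro ψ t
    have h := lp.sum_rpow_le_norm_rpow (p := 2) (by norm_num) ψ t
    simpa using h
  refine ⟨C * (D + 1), by positivity, fun ψ s => ?_⟩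
  have hpt : ∀ v, ‖H.act hG ψ v‖ ^ 2 ≤
      C ^ 2 * (D + 1) * (∑ u ∈ hG.nbrs v, ‖ψ u‖ ^ 2 + ‖ψ v‖ ^ 2) := by
    intro v
    have hv : v ∉ hG.nbrs v := by simp [hG.mem_nbrs]
    have h1 : ‖H.act hG ψ v‖ ≤ C * ∑ u ∈ insert v (hG.nbrs v), ‖ψ u‖ := by
      rw [Finset.sum_insert hv, mul_add, add_comm, Finset.mul_sum]
      refine (norm_add_le _ _).trans (add_le_add ((norm_sum_le _ _).trans ?_) ?_)
      · refine Finset.sum_le_sum fun u _ => ?_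
        rw [norm_mul]
        exact mul_le_mul_of_nonneg_right (ha u v) (norm_nonneg _)
      · rw [norm_mul]
        exact mul_le_mul_of_nonneg_right (hb v) (norm_nonneg _)
    have h2 : (∑ u ∈ insert v (hG.nbrs v), ‖ψ u‖) ^ 2 ≤
        (D + 1) * ∑ u ∈ insert v (hG.nbrs v), ‖ψ u‖ ^ 2 := by
      refine sq_sum_le_card_mul_sum_sq.trans ?_
      refine mul_le_mul_of_nonneg_right ?_ (Finset.sum_nonneg fun _ _ => by positivity)
      rw [Finset.card_insert_of_notMem hv]
      exact_mod_cast Nat.succ_le_succ (hD v)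
    calc ‖H.act hG ψ v‖ ^ 2 ≤ (C * ∑ u ∈ insert v (hG.nbrs v), ‖ψ u‖) ^ 2 := by gcongr
      _ = C ^ 2 * (∑ u ∈ insert v (hG.nbrs v), ‖ψ u‖) ^ 2 := by ring
      _ ≤ C ^ 2 * ((D + 1) * ∑ u ∈ insert v (hG.nbrs v), ‖ψ u‖ ^ 2) := by gcongr
      _ = _ := by rw [Finset.sum_insert hv]; ring
  have hswap : ∑ v ∈ s, ∑ u ∈ hG.nbrs v, ‖ψ u‖ ^ 2 ≤ D * ‖ψ‖ ^ 2 := by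
    have h1 : ∑ v ∈ s, ∑ u ∈ hG.nbrs v, ‖ψ u‖ ^ 2 =
        ∑ u ∈ s.biUnion hG.nbrs, ∑ v ∈ s.filter (fun v => G.Adj v u), ‖ψ u‖ ^ 2 := by
      refine Finset.sum_comm' fun v u => ?_
      simp only [hG.mem_nbrs, Finset.mem_biUnion, Finset.mem_filter]
      constructor
      · rintro ⟨hv, hu⟩
        exact ⟨⟨hv, hu⟩, v, hv, hu⟩
      · rintro ⟨h, -⟩
        exact h
    rw [h1]
    calc _ ≤ ∑ u ∈ s.biUnion hG.nbrs, (D : ℝ) * ‖ψ u‖ ^ 2 := by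
          refine Finset.sum_le_sum fun u _ => ?_
          rw [Finset.sum_const, nsmul_eq_mul]
          refine mul_le_mul_of_nonneg_right ?_ (by positivity)
          have : (s.filter (fun v => G.Adj v u)).card ≤ D := by
            refine (Finset.card_le_card fun v hv => ?_).trans (hD u)
            rw [hG.mem_nbrs]
            exact (Finset.mem_filter.1 hv).2.symm
          exact_mod_cast this
      _ = D * ∑ u ∈ s.biUnion hG.nbrs, ‖ψ u‖ ^ 2 := by rw [Finset.mul_sum]
      _ ≤ _ := by gcongr; exact hsum ψ _
  calc ∑ v ∈ s, ‖H.act hG ψ v‖ ^ 2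
      ≤ ∑ v ∈ s, C ^ 2 * (D + 1) * (∑ u ∈ hG.nbrs v, ‖ψ u‖ ^ 2 + ‖ψ v‖ ^ 2) :=
        Finset.sum_le_sum fun v _ => hpt v
    _ = C ^ 2 * (D + 1) * (∑ v ∈ s, ∑ u ∈ hG.nbrs v, ‖ψ u‖ ^ 2 + ∑ v ∈ s, ‖ψ v‖ ^ 2) := by
        rw [← Finset.mul_sum, Finset.sum_add_distrib]
    _ ≤ C ^ 2 * (D + 1) * (D * ‖ψ‖ ^ 2 + ‖ψ‖ ^ 2) := by
        gcongr
        exact hsum ψ s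
    _ = _ := by ring

theorem memℓp_act (H : JacobiMatrix G) (hG : BoundedDegree G) (ψ : EllTwo V) :
    Memℓp (E := fun _ : V => ℂ) (H.act hG ψ) 2 := by
  obtain ⟨K, -, hK⟩ := H.exists_sum_act_le hG
  refine memℓp_gen' (C := K ^ 2 * ‖ψ‖ ^ 2) fun s => ?_
  simpa using hK ψ s

/-- The Jacobi operator on `ℓ²(V)` as a linear map. -/
def linOp (H : JacobiMatrix G) (hG : BoundedDegree G) : EllTwo V →ₗ[ℂ] EllTwo V where
  toFun ψ := ⟨H.act hG ψ, H.memℓp_act hG ψ⟩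
  map_add' ψ φ := by
    ext v
    simp only [act, lp.coeFn_add, Pi.add_apply, mul_add, Finset.sum_add_distrib]
    ring
  map_smul' c ψ := by
    ext v
    simp only [act, lp.coeFn_smul, Pi.smul_apply, smul_eq_mul, RingHom.id_apply, mul_add,
      Finset.mul_sum]
    congr 1
    · exact Finset.sum_congr rfl fun _ _ => by ring
    · ring

theorem exists_linOp_bound (H : JacobiMatrix G) (hG : BoundedDegree G) :
    ∃ K : ℝ, ∀ ψ, ‖H.linOp hG ψ‖ ≤ K * ‖ψ‖ := by
  obtain ⟨K, hK0, hK⟩ := H.exists_sum_act_le hG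
  refine ⟨K, fun ψ => ?_⟩
  refine lp.norm_le_of_forall_sum_le (by norm_num) (by positivity) fun s => ?_
  have h := hK ψ s
  rw [← mul_pow] at h
  simpa [linOp] using h

/-- The bounded Jacobi operator on `ℓ²(V)`. -/
def op (H : JacobiMatrix G) (hG : BoundedDegree G) : EllTwo V →L[ℂ] EllTwo V :=
  (H.linOp hG).mkContinuousOfExistsBound (H.exists_linOp_bound hG)

theorem op_apply (H : JacobiMatrix G) (hG : BoundedDegree G) (ψ : EllTwo V) (v : V) :
    H.op hG ψ v = ∑ u ∈ hG.nbrs v, (H.a u v : ℂ) * ψ u + (H.b v : ℂ) * ψ v := rfl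

/-- `H` is the adjacency matrix of its graph: `a ≡ 1` and `b ≡ 0`. -/
def IsAdjacency (H : JacobiMatrix G) : Prop :=
  (∀ u v, G.Adj u v → H.a u v = 1) ∧ ∀ v, H.b v = 0

end JacobiMatrix

/-- The adjacency matrix of a graph: the Jacobi matrix with `a ≡ 1` and `b ≡ 0`. -/
def adjacencyMatrix {V : Type*} (G : SimpleGraph V) : JacobiMatrix G where
  a u v := open Classical in if G.Adj u v then 1 else 0
  b _ := 0
  a_symm u v := by by_cases h : G.Adj u v <;> have h2 := h <;> rw [G.adj_comm] at h2 <;> simp [h, h2]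
  a_pos u v h := by simp [h]
  a_eq_zero u v h := by simp [h]
  a_bdd := ⟨1, fun u v => by split_ifs <;> norm_num⟩
  b_bdd := ⟨0, fun _ => by simp⟩

/-! ### Essential spectrum -/

/-- The discrete spectrum: isolated points of the spectrum that are eigenvalues of finite
multiplicity. -/
def discreteSpectrum {E : Type*} [NormedAddCommGroup E] [InnerProductSpace ℂ E]
    (T : E →L[ℂ] E) : Set ℂ :=
  {z | z ∈ spectrum ℂ T ∧ (∃ ε > 0, ∀ w ∈ spectrum ℂ T, dist w z < ε → w = z) ∧
    Module.End.HasEigenvalue (T : E →ₗ[ℂ] E) z ∧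
    FiniteDimensional ℂ (Module.End.eigenspace (T : E →ₗ[ℂ] E) z)}

/-- The essential spectrum of a bounded self-adjoint operator. -/
def essentialSpectrum {E : Type*} [NormedAddCommGroup E] [InnerProductSpace ℂ E]
    (T : E →L[ℂ] E) : Set ℂ :=
  spectrum ℂ T \ discreteSpectrum T

/-! ### `R`-limits -/

/-- The ball of radius `r` about `v` in a connected graph. -/
def graphBall {V : Type*} (G : SimpleGraph V) (v : V) (r : ℕ) : Set V :=
  {u | G.dist u v ≤ r}

/-- The number of vertices in the ball. -/
def ballCard {V : Type*} (G : SimpleGraph V) (v : V) (r : ℕ) : ℕ :=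
  (graphBall G v r).ncard

/-- A coherent sequence of enumerations of the balls about `v`, with radii `r = 1, 2, …`
(the enumeration of the one-point ball of radius `0` plays no role). -/
structure CoherentEnum {V : Type*} (G : SimpleGraph V) (v : V) where
  enum : ∀ r, graphBall G v r ≃ Fin (ballCard G v r)
  coherent : ∀ r s, 1 ≤ r → r < s → ∀ (u : V) (hr : u ∈ graphBall G v r)
    (hs : u ∈ graphBall G v s), (enum s ⟨u, hs⟩ : ℕ) = enum r ⟨u, hr⟩

/-- The matrix of the restriction of `H` to the ball of radius `r` about `v`, written in the
enumeration `η`. -/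
def CoherentEnum.matrix {V : Type*} {G : SimpleGraph V} {v : V} (η : CoherentEnum G v)
    (H : JacobiMatrix G) (r : ℕ) : Matrix (Fin (ballCard G v r)) (Fin (ballCard G v r)) ℝ :=
  Matrix.of fun i l => H.entry ((η.enum r).symm i) ((η.enum r).symm l)

/-- A path to infinity: successive vertices are adjacent and the distance from the initial vertex
tends monotonically to infinity. -/
structure IsPathToInfinity {V : Type*} (G : SimpleGraph V) (v : ℕ → V) : Prop where
  adj : ∀ n, G.Adj (v (n + 1)) (v n)
  monotone : Monotone fun n => G.dist (v n) (v 0)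
  tendsto : Tendsto (fun n => G.dist (v n) (v 0)) atTop atTop

/-- `(H', G', v₀')` is an `R`-limit of `H` along the path `v`. -/
def IsRLimitAlong {V V' : Type*} {G : SimpleGraph V} {G' : SimpleGraph V'}
    (H : JacobiMatrix G) (v : ℕ → V) (H' : JacobiMatrix G') (v₀' : V') : Prop :=
  ∃ n : ℕ → ℕ, StrictMono n ∧
    ∃ (η : ∀ j, CoherentEnum G (v (n j))) (η' : CoherentEnum G' v₀'),
      ∀ r, 1 ≤ r →
        (∀ᶠ j in atTop, ballCard G (v (n j)) r = ballCard G' v₀' r) ∧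
        Tendsto
          (fun j => if h : ballCard G (v (n j)) r = ballCard G' v₀' r then
            Matrix.reindex (finCongr h) (finCongr h) ((η j).matrix H r) else 0)
          atTop (𝓝 (η'.matrix H' r))

/-- The Jacobi matrix `H'` on the connected graph `G'` of bounded degree is an `R`-limit of `H`
(along some path to infinity, for some choice of the base vertex of `G'`). -/
def IsRLimit {V V' : Type*} {G : SimpleGraph V} {G' : SimpleGraph V'}
    (H : JacobiMatrix G) (H' : JacobiMatrix G') : Prop :=
  G'.Connected ∧ BoundedDegree G' ∧
    ∃ v : ℕ → V, IsPathToInfinity G v ∧ ∃ v₀' : V', IsRLimitAlong H v H' v₀'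

/-- The union of the spectra of all `R`-limits of `H`. A connected graph of bounded degree is
countable, so that vertex sets in `Type` give all of them up to isomorphism. -/
def rLimitSpectra {V : Type*} {G : SimpleGraph V} (H : JacobiMatrix G) : Set ℂ :=
  {z | ∃ (V' : Type) (G' : SimpleGraph V') (hG' : BoundedDegree G') (H' : JacobiMatrix G'),
    IsRLimit H H' ∧ z ∈ spectrum ℂ (H'.op hG')}

/-! ### The graphs of the construction -/

/-- Every vertex has exactly `d` neighbours. -/
def IsRegularGraph {V : Type*} (G : SimpleGraph V) (d : ℕ) : Prop :=
  ∀ v, (G.neighborSet v).encard = d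

/-- `G` is isomorphic to the line, the graph on `ℤ` with edges `{n, n + 1}`. -/
def IsLine {V : Type*} (G : SimpleGraph V) : Prop :=
  Nonempty (G ≃g SimpleGraph.hasse ℤ)

/-- `G` is a `d`-regular tree. -/
def IsRegularTree {V : Type*} (G : SimpleGraph V) (d : ℕ) : Prop :=
  G.IsTree ∧ IsRegularGraph G d

/-- The graph obtained from the disjoint union of `T` and the half-line, i.e. the graph on `ℕ` with
edges `{n, n + 1}`, by joining the vertex `o` of `T` to the end point of the half-line. -/
def joinHalfLine {W : Type*} (T : SimpleGraph W) (o : W) : SimpleGraph (W ⊕ ℕ) :=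
  SimpleGraph.sum T (SimpleGraph.hasse ℕ) ⊔ SimpleGraph.edge (Sum.inl o) (Sum.inr 0)

/-- `G` is isomorphic to a `d`-regular tree with a half-line joined to one of its vertices. -/
def IsRegularTreeWithHalfLine {V : Type*} (G : SimpleGraph V) (d : ℕ) : Prop :=
  ∃ (W : Type) (T : SimpleGraph W) (o : W), IsRegularTree T d ∧ Nonempty (G ≃g joinHalfLine T o)

/-- One orientation of the edges of the graph obtained from the half-line on `ℕ` by replacing, for
each `i`, the edge `{k i, k i + 1}` by the graph `Γ i` with its marked vertices `p i`, `q i`. -/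
inductive ReplacedEdge {W : ℕ → Type*} (Γ : ∀ i, SimpleGraph (W i)) (p q : ∀ i, W i)
    (k : ℕ → ℕ) : (ℕ ⊕ Σ i, W i) → (ℕ ⊕ Σ i, W i) → Prop
  | line (n : ℕ) (hn : ∀ i, n ≠ k i) : ReplacedEdge Γ p q k (Sum.inl n) (Sum.inl (n + 1))
  | inner (i : ℕ) (x y : W i) (h : (Γ i).Adj x y) :
      ReplacedEdge Γ p q k (Sum.inr ⟨i, x⟩) (Sum.inr ⟨i, y⟩)
  | left (i : ℕ) : ReplacedEdge Γ p q k (Sum.inl (k i)) (Sum.inr ⟨i, p i⟩)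
  | right (i : ℕ) : ReplacedEdge Γ p q k (Sum.inr ⟨i, q i⟩) (Sum.inl (k i + 1))

/-- The graph obtained from the half-line on `ℕ` by replacing the edges `{k i, k i + 1}` by the
graphs `Γ i`, attached through `p i` to `k i` and through `q i` to `k i + 1`. -/
def replaceEdges {W : ℕ → Type*} (Γ : ∀ i, SimpleGraph (W i)) (p q : ∀ i, W i) (k : ℕ → ℕ) :
    SimpleGraph (ℕ ⊕ Σ i, W i) :=
  SimpleGraph.fromRel (ReplacedEdge Γ p q k)

end

noncomputable section

/-! ### Weyl's criterion -/

section Weyl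

variable {E : Type*} [NormedAddCommGroup E] [InnerProductSpace ℂ E]

/-! The number `d` comes from the finite blocks `Γ i`, and local limits do not see it. The indicator
function of a `d`-regular block satisfies the eigenvalue equation for `d` up to unit defects at the
two attaching vertices `k i` and `k i + 1`. After normalisation the defect is at most `2 / √|Γ i|`,
and the blocks are disjoint, so Weyl's criterion (`mem_essentialSpectrum_of_orthonormal`,
`ReplaceEdges.mem_essentialSpectrum`) puts `d` into the essential spectrum.

An `R`-limit only records balls of fixed radius far out. Since the girths grow, these balls contain
no cycle of any given length in the end, and every limit is a tree
(`ReplaceEdges.isTree_of_locallyConverges`). On a tree with degrees at most `s ^ 2`, a Schur test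
with weights `s` towards a root and `s⁻¹` away from it bounds the adjacency operator by `2 * s`
(`SimpleGraph.IsTree.norm_le_of_mem_spectrum`). Limits have degrees at most `d + 1`, so for `d = 8`
all their spectra lie in the closed disc of radius `6`, and so does the closure of their union.

For the classification, the vertices of degree two in a limit are those coming from the half-line.
As the gaps of `k` and the distances between the marked vertices grow, a ball far out contains at
most one edge joining the half-line to a block. Without such an edge the limit is a line or a
regular tree; cutting the edge otherwise leaves a half-line and a regular tree.

For the occurrence, a geodesic ray from the vertex `0` must visit every vertex of the half-line,
every `q i`, and a point deep inside each block. Base points of these three kinds have convergent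
subsequences by compactness (`exists_local_limit`), and their limits are of the three types. The
blocks themselves are Cayley graphs of finite groups generated by `d` involutions acting on
truncated reduced words. -/

theorem Orthonormal.tendsto_inner_zero {ψ : ℕ → E} (hψ : Orthonormal ℂ ψ) (x : E) :
    Tendsto (fun n => inner ℂ x (ψ n)) atTop (𝓝 0) := by
  have h := (hψ.inner_products_summable x).tendsto_atTop_zero
  rw [tendsto_zero_iff_norm_tendsto_zero]
  have h2 := h.sqrt
  simp only [Real.sqrt_zero, Real.sqrt_sq (norm_nonneg _)] at h2
  refine h2.congr fun n => ?_
  rw [← inner_conj_symm, RCLike.norm_conj]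

variable [CompleteSpace E]

/-- By Bessel's inequality an orthonormal sequence tends weakly to zero. Expanding `P x` in an
orthonormal basis of `K` leaves finitely many scalar products, so weak convergence suffices. -/
theorem Orthonormal.tendsto_apply_zero_of_finiteDimensional {ψ : ℕ → E} (hψ : Orthonormal ℂ ψ)
    (P : E →L[ℂ] E) (K : Submodule ℂ E) [FiniteDimensional ℂ K] (hP : ∀ x, P x ∈ K) :
    Tendsto (fun n => P (ψ n)) atTop (𝓝 0) := by
  have key : ∀ x, P x = ∑ i, inner ℂ ((ContinuousLinearMap.adjoint P)
      (stdOrthonormalBasis ℂ K i : E)) x • (stdOrthonormalBasis ℂ K i : E) := by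
    intro x
    have h := (stdOrthonormalBasis ℂ K).sum_repr' ⟨P x, hP x⟩
    refine (congrArg Subtype.val h).symm.trans ?_
    simp only [Submodule.coe_inner, Submodule.coe_sum, Submodule.coe_smul,
      ContinuousLinearMap.adjoint_inner_left]
  simp_rw [key]
  have : (0 : E) = ∑ i, (0 : ℂ) • (stdOrthonormalBasis ℂ K i : E) := by simp
  rw [this]
  exact tendsto_finsetSum _ fun i _ => (hψ.tendsto_inner_zero _).smul_const _

/-- A left inverse `S` of `T - z` modulo finite rank would turn `T ψ - z ψ → 0` into `ψ → 0`,
against `‖ψ n‖ = 1`. This serves both for points of the resolvent set and for discrete eigenvalues.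
-/
theorem Orthonormal.not_exists_parametrix {ψ : ℕ → E} (hψ : Orthonormal ℂ ψ)
    {T : E →L[ℂ] E} {z : ℂ} (hT : Tendsto (fun n => T (ψ n) - z • ψ n) atTop (𝓝 0))
    (S P : E →L[ℂ] E) (K : Submodule ℂ E) [FiniteDimensional ℂ K] (hP : ∀ x, P x ∈ K)
    (hS : ∀ x, S (T x - z • x) = x - P x) : False := by
  have h1 : Tendsto (fun n => S (T (ψ n) - z • ψ n) + P (ψ n)) atTop (𝓝 0) := by
    have := ((S.continuous.tendsto 0).comp hT).add
      (hψ.tendsto_apply_zero_of_finiteDimensional P K hP)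
    simpa using this
  simp only [hS, sub_add_cancel] at h1
  have h2 := h1.norm
  simp only [hψ.1, norm_zero] at h2
  exact one_ne_zero (tendsto_nhds_unique tendsto_const_nhds h2)

theorem continuousOn_of_isolated {s : Set ℂ} {z : ℂ} {ε : ℝ} (hε : 0 < ε)
    (hiso : ∀ w ∈ s, dist w z < ε → w = z) {f : ℂ → ℂ} (hf : ContinuousOn f {z}ᶜ) :
    ContinuousOn f s := by
  intro w hw
  by_cases hwz : w = z
  · subst hwz
    have : f =ᶠ[𝓝[s] w] fun _ => f w := by
      filter_upwards [self_mem_nhdsWithin, nhdsWithin_le_nhds (Metric.ball_mem_nhds w hε)]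
        with u hu hu2
      rw [hiso u hu hu2]
    exact (tendsto_const_nhds).congr' this.symm
  · exact (hf.continuousAt (isOpen_compl_singleton.mem_nhds hwz)).continuousWithinAt

/-- Off the spectrum the resolvent is a left inverse. At a discrete eigenvalue the functional
calculus supplies a reduced resolvent, which is a left inverse modulo the spectral projection, whose
range lies in the finite-dimensional eigenspace. -/
theorem mem_essentialSpectrum_of_orthonormal {T : E →L[ℂ] E} (hT : IsStarNormal T) {ψ : ℕ → E}
    (hψ : Orthonormal ℂ ψ) {z : ℂ} (h : Tendsto (fun n => T (ψ n) - z • ψ n) atTop (𝓝 0)) :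
    z ∈ essentialSpectrum T := by
  refine ⟨?_, ?_⟩
  · rw [spectrum.mem_iff]
    rintro ⟨u, hu⟩
    -- The unit `u` is `z - T`, whence the sign.
    refine hψ.not_exists_parametrix h (-(↑u⁻¹ : E →L[ℂ] E)) 0 ⊥ (by simp) fun x => ?_
    have h1 : T x - z • x = -((u : E →L[ℂ] E) x) := by
      rw [hu]; simp [Algebra.algebraMap_eq_smul_one]
    have h2 : (↑u⁻¹ : E →L[ℂ] E) ((u : E →L[ℂ] E) x) = x := by
      exact congrArg (fun A : E →L[ℂ] E => A x) u.inv_mul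
    rw [h1]
    simp [h2]
  · rintro ⟨-, ⟨ε, hε, hiso⟩, -, hfin⟩
    set χ : ℂ → ℂ := fun w => if w = z then 1 else 0 with hχ
    -- The default value `g z = 0` makes `g w * (w - z) = 1 - χ w` true at `w = z` as well.
    set g : ℂ → ℂ := fun w => (w - z)⁻¹ with hg
    have hχc : ContinuousOn χ (spectrum ℂ T) := by
      refine continuousOn_of_isolated hε hiso ?_
      refine (continuousOn_const (c := (0 : ℂ))).congr fun w hw => ?_
      simp [hχ, show w ≠ z from hw]
    have hgc : ContinuousOn g (spectrum ℂ T) := by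
      refine continuousOn_of_isolated hε hiso ?_
      refine ContinuousOn.inv₀ (by fun_prop) fun w hw => sub_ne_zero.2 hw
    have hsub : cfc (fun w : ℂ => w - z) T = T - algebraMap ℂ _ z := by
      rw [cfc_sub (fun w : ℂ => w) (fun _ => z) T, cfc_id' ℂ T, cfc_const z T]
    have h1 : (T - algebraMap ℂ _ z) * cfc χ T = 0 := by
      rw [← hsub, ← cfc_mul (fun w : ℂ => w - z) χ T]
      have : (fun w : ℂ => (w - z) * χ w) = fun _ => 0 := by
        funext w
        by_cases hw : w = z <;> simp [hχ, hw]
      rw [this]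
      simp
    have h2 : cfc g T * (T - algebraMap ℂ _ z) = 1 - cfc χ T := by
      rw [← hsub, ← cfc_mul g (fun w : ℂ => w - z) T, ← cfc_one ℂ T, ← cfc_sub _ χ T]
      congr 1
      funext w
      by_cases hw : w = z
      · simp [hχ, hg, hw]
      · simp [hχ, hg, hw, sub_ne_zero.2 hw]
    refine hψ.not_exists_parametrix h (cfc g T) (cfc χ T)
      (Module.End.eigenspace (T : E →ₗ[ℂ] E) z) (fun x => ?_) fun x => ?_
    · rw [Module.End.mem_eigenspace_iff]
      have := congrArg (fun A : E →L[ℂ] E => A x) h1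
      simpa [Algebra.algebraMap_eq_smul_one, sub_eq_zero] using this
    · have := congrArg (fun A : E →L[ℂ] E => A x) h2
      simpa [Algebra.algebraMap_eq_smul_one] using this

end Weyl

/-! ### Jacobi operators are self-adjoint -/

section SelfAdjoint

variable {V : Type*} {G : SimpleGraph V}

theorem JacobiMatrix.op_single_apply [DecidableEq V] (H : JacobiMatrix G) (hG : BoundedDegree G)
    (u v : V) (c : ℂ) : H.op hG (lp.single 2 u c) v = (H.entry u v : ℂ) * c := by
  classical
  rw [JacobiMatrix.op_apply, JacobiMatrix.entry]
  have h1 : ∑ w ∈ hG.nbrs v, (H.a w v : ℂ) * (lp.single (E := fun _ : V => ℂ) 2 u c) w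
      = (H.a u v : ℂ) * c := by
    have : ∀ w ∈ hG.nbrs v, (H.a w v : ℂ) * (lp.single (E := fun _ : V => ℂ) 2 u c) w =
        if w = u then (H.a u v : ℂ) * c else 0 := by
      intro w _
      by_cases hw : w = u
      · subst hw; simp
      · rw [lp.single_apply_ne _ _ _ hw]; simp [hw]
    rw [Finset.sum_congr rfl this, Finset.sum_ite_eq' (hG.nbrs v) u]
    split_ifs with h
    · rfl
    · rw [hG.mem_nbrs, G.adj_comm] at h
      rw [H.a_eq_zero _ _ h]; simp
  rw [h1]
  by_cases huv : u = v
  · subst huv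
    simp
    ring
  · rw [lp.single_apply_ne _ _ _ (Ne.symm huv)]
    simp [huv]

theorem JacobiMatrix.entry_comm (H : JacobiMatrix G) (u v : V) : H.entry u v = H.entry v u := by
  unfold JacobiMatrix.entry
  rw [H.a_symm]
  by_cases huv : u = v
  · subst huv; rfl
  · simp [huv, Ne.symm huv]

/-- A bounded operator on `ℓ²` is determined by its values on point masses, where the claim is the
symmetry of the real matrix entries. -/
theorem JacobiMatrix.isSelfAdjoint_op (H : JacobiMatrix G) (hG : BoundedDegree G) :
    IsSelfAdjoint (H.op hG) := by
  classical
  rw [ContinuousLinearMap.isSelfAdjoint_iff']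
  refine lp.ext_continuousLinearMap (by norm_num) fun u => ?_
  refine ContinuousLinearMap.ext fun c => ?_
  ext v
  simp only [ContinuousLinearMap.comp_apply]
  have h1 : ∀ f : EllTwo V, f v = inner ℂ (lp.single (E := fun _ : V => ℂ) 2 v (1 : ℂ)) f := by
    intro f
    rw [lp.inner_single_left]; simp
  rw [h1, ContinuousLinearMap.adjoint_inner_right]
  simp only [lp.singleContinuousLinearMap_apply]
  rw [lp.inner_single_right, H.op_single_apply, H.op_single_apply, H.entry_comm v u]
  simp [mul_comm]

end SelfAdjoint

/-! ### Approximate eigenvectors from indicator functions -/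

section Indicator

variable {V : Type*} {G : SimpleGraph V}

theorem adjacencyMatrix_isAdjacency (G : SimpleGraph V) : (adjacencyMatrix G).IsAdjacency :=
  ⟨fun u v h => by simp [adjacencyMatrix, h], fun _ => rfl⟩

theorem JacobiMatrix.IsAdjacency.op_apply {H : JacobiMatrix G} (hH : H.IsAdjacency)
    (hG : BoundedDegree G) (ψ : EllTwo V) (v : V) : H.op hG ψ v = ∑ u ∈ hG.nbrs v, ψ u := by
  rw [JacobiMatrix.op_apply, hH.2 v]
  simp only [Complex.ofReal_zero, zero_mul, add_zero]
  refine Finset.sum_congr rfl fun u hu => ?_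
  rw [hH.1 u v ((hG.mem_nbrs v u).1 hu).symm]
  simp

/-- The indicator function of a finite set as an element of `ℓ²`. -/
def indicatorVec (F : Finset V) : EllTwo V :=
  open Classical in ∑ u ∈ F, lp.single (E := fun _ : V => ℂ) 2 u (1 : ℂ)

open Classical in
theorem indicatorVec_apply (F : Finset V) (v : V) : indicatorVec F v = if v ∈ F then 1 else 0 := by
  unfold indicatorVec
  rw [lp.coeFn_sum, Finset.sum_apply]
  have : ∀ u ∈ F, (lp.single (E := fun _ : V => ℂ) 2 u (1 : ℂ)) v = if u = v then 1 else 0 := by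
    intro u _
    by_cases h : v = u
    · subst h; simp
    · rw [lp.single_apply_ne _ _ _ h]; simp [Ne.symm h]
  rw [Finset.sum_congr rfl this, Finset.sum_ite_eq']

open Classical in
theorem inner_indicatorVec (F F' : Finset V) :
    inner ℂ (indicatorVec F) (indicatorVec F') = ((F ∩ F').card : ℂ) := by
  rw [lp.inner_eq_tsum, tsum_eq_sum (s := F ∩ F')]
  · rw [Finset.sum_congr rfl (g := fun _ => (1 : ℂ))]
    · simp
    · intro v hv
      rw [Finset.mem_inter] at hv
      simp [indicatorVec_apply, hv.1, hv.2]
  · intro v hv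
    rw [Finset.mem_inter] at hv
    by_cases h : v ∈ F
    · have : v ∉ F' := fun h' => hv ⟨h, h'⟩
      simp [indicatorVec_apply, this]
    · simp [indicatorVec_apply, h]

/-- If infinitely many disjoint finite sets `F i` of growing size are almost invariant, in the
sense that the indicator function of each satisfies the eigenvalue equation for `d` up to two
unit defects, then `d` lies in the essential spectrum. -/
theorem mem_essentialSpectrum_of_finsets (hG : BoundedDegree G) (d : ℕ) (F : ℕ → Finset V)
    (hne : ∀ i, (F i).Nonempty) (hdisj : ∀ i j, i ≠ j → Disjoint (F i) (F j))
    (hcard : Tendsto (fun i => (F i).card) atTop atTop) (a b : ℕ → V)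
    (hdef : ∀ i, (adjacencyMatrix G).op hG (indicatorVec (F i)) =
      (d : ℂ) • indicatorVec (F i) + (indicatorVec {a i} + indicatorVec {b i})) :
    (d : ℂ) ∈ essentialSpectrum ((adjacencyMatrix G).op hG) := by
  classical
  have hpos : ∀ i, 0 < ((F i).card : ℝ) := fun i => by exact_mod_cast (hne i).card_pos
  have hnorm : ∀ i, ‖indicatorVec (F i)‖ = √((F i).card : ℝ) := by
    intro i
    have h := norm_sq_eq_re_inner (𝕜 := ℂ) (indicatorVec (F i))
    rw [inner_indicatorVec, Finset.inter_self] at h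
    rw [← Real.sqrt_sq (norm_nonneg (indicatorVec (F i))), h]
    simp
  have hone : ∀ v : V, ‖indicatorVec {v}‖ = 1 := by
    intro v
    have h := norm_sq_eq_re_inner (𝕜 := ℂ) (indicatorVec {v})
    rw [inner_indicatorVec, Finset.inter_self] at h
    rw [← Real.sqrt_sq (norm_nonneg (indicatorVec {v})), h]
    simp
  set ψ : ℕ → EllTwo V := fun i => ((√((F i).card : ℝ))⁻¹ : ℂ) • indicatorVec (F i) with hψdef
  have hψ : Orthonormal ℂ ψ := by
    refine ⟨fun i => ?_, fun i j hij => ?_⟩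
    · rw [hψdef, norm_smul, hnorm, norm_inv, Complex.norm_real, Real.norm_eq_abs,
        abs_of_nonneg (Real.sqrt_nonneg _)]
      exact inv_mul_cancel₀ (Real.sqrt_pos.2 (hpos i)).ne'
    · simp only [hψdef]
      rw [inner_smul_left, inner_smul_right, inner_indicatorVec,
        Finset.disjoint_iff_inter_eq_empty.1 (hdisj i j hij)]
      simp
  refine mem_essentialSpectrum_of_orthonormal
    ((adjacencyMatrix G).isSelfAdjoint_op hG).isStarNormal hψ ?_
  rw [tendsto_zero_iff_norm_tendsto_zero]
  have hbound : ∀ i, ‖(adjacencyMatrix G).op hG (ψ i) - (d : ℂ) • ψ i‖ ≤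
      (√((F i).card : ℝ))⁻¹ * 2 := by
    intro i
    have : (adjacencyMatrix G).op hG (ψ i) - (d : ℂ) • ψ i =
        ((√((F i).card : ℝ))⁻¹ : ℂ) • (indicatorVec {a i} + indicatorVec {b i}) := by
      simp only [hψdef, map_smul, hdef, smul_add, smul_comm (d : ℂ)]
      abel
    rw [this, norm_smul, norm_inv, Complex.norm_real, Real.norm_eq_abs,
      abs_of_nonneg (Real.sqrt_nonneg _)]
    refine mul_le_mul_of_nonneg_left ((norm_add_le _ _).trans ?_) (by positivity)
    rw [hone, hone]
    norm_num
  refine squeeze_zero (fun _ => norm_nonneg _) hbound ?_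
  have h1 : Tendsto (fun i => √((F i).card : ℝ)) atTop atTop :=
    Real.tendsto_sqrt_atTop.comp (tendsto_natCast_atTop_atTop.comp hcard)
  simpa using h1.inv_tendsto_atTop.mul_const 2

end Indicator

/-! ### The spectrum of a tree of bounded degree -/

section TreeBound

variable {V : Type*} {G : SimpleGraph V}

/-- Each such neighbour is the penultimate vertex of a geodesic from `o` to `v`, and a tree has only
one path from `o` to `v`. -/
theorem SimpleGraph.IsTree.eq_of_dist_add_one (hT : G.IsTree) (o : V) {u u' v : V}
    (hu : G.Adj u v) (hu' : G.Adj u' v) (h : G.dist o u + 1 = G.dist o v)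
    (h' : G.dist o u' + 1 = G.dist o v) : u = u' := by
  have key : ∀ x, G.Adj x v → G.dist o x + 1 = G.dist o v →
      ∃ p : G.Path o v, p.1.penultimate = x := by
    intro x hx hd
    obtain ⟨p, hp⟩ := hT.connected.exists_walk_length_eq_dist o x
    refine ⟨⟨p.concat hx, ?_⟩, by simp⟩
    exact SimpleGraph.Walk.isPath_of_length_eq_dist _ (by simp [hp, hd])
  obtain ⟨p, hp⟩ := key u hu h
  obtain ⟨p', hp'⟩ := key u' hu' h'
  rw [← hp, ← hp', (hT.isAcyclic.subsingleton_path o v).elim p p']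

open Classical in
-- At most one neighbour is the parent, of weight `s`; the at most `s ^ 2` others have weight `s⁻¹`.
theorem SimpleGraph.IsTree.sum_weight_le (hT : G.IsTree) (hG : BoundedDegree G) (o : V) {s : ℝ}
    (hs : 0 < s) (v : V) (hdeg : ((hG.nbrs v).card : ℝ) ≤ s ^ 2) :
    ∑ u ∈ hG.nbrs v, (if G.dist o u + 1 = G.dist o v then s else s⁻¹) ≤ 2 * s := by
  rw [Finset.sum_ite, Finset.sum_const, Finset.sum_const, nsmul_eq_mul, nsmul_eq_mul]
  have h1 : ((hG.nbrs v).filter fun u => G.dist o u + 1 = G.dist o v).card ≤ 1 := by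
    rw [Finset.card_le_one]
    intro x hx y hy
    rw [Finset.mem_filter, hG.mem_nbrs] at hx hy
    exact hT.eq_of_dist_add_one o hx.1.symm hy.1.symm hx.2 hy.2
  have h2 : (((hG.nbrs v).filter fun u => ¬ G.dist o u + 1 = G.dist o v).card : ℝ) ≤ s ^ 2 :=
    le_trans (by exact_mod_cast Finset.card_filter_le _ _) hdeg
  have h1' : (((hG.nbrs v).filter fun u => G.dist o u + 1 = G.dist o v).card : ℝ) ≤ 1 := by
    exact_mod_cast h1
  calc _ ≤ 1 * s + s ^ 2 * s⁻¹ := by gcongr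
    _ = 2 * s := by field_simp; norm_num

/-- Schur test. Adjacent vertices of a tree differ by exactly one in their distance to the root, so
the two orientations of an edge carry reciprocal weights. Cauchy–Schwarz then splits off one
weighted sum, exchanging the order of summation produces the other, and each is at most `2 * s`. -/
theorem SimpleGraph.IsTree.sum_norm_sq_le (hT : G.IsTree) (hG : BoundedDegree G) {s : ℝ}
    (hs : 0 < s) (hdeg : ∀ v, ((hG.nbrs v).card : ℝ) ≤ s ^ 2) (ψ : EllTwo V) (t : Finset V) :
    ∑ v ∈ t, ‖∑ u ∈ hG.nbrs v, ψ u‖ ^ 2 ≤ (2 * s * ‖ψ‖) ^ 2 := by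
  classical
  obtain ⟨o⟩ := hT.connected.nonempty
  set c : V → V → ℝ := fun v u => if G.dist o u + 1 = G.dist o v then s else s⁻¹ with hc
  have hc0 : ∀ v u, 0 < c v u := fun v u => by
    simp only [hc]; split_ifs <;> positivity
  have hcc : ∀ v u, G.Adj v u → c v u * c u v = 1 := by
    intro v u h
    rcases hT.dist_eq_dist_add_one_of_adj o h with h1 | h1
    · have h2 : ¬ G.dist o v + 1 = G.dist o u := by omega
      simp only [hc]
      rw [if_pos h1.symm, if_neg h2, mul_inv_cancel₀ hs.ne']
    · have h2 : ¬ G.dist o u + 1 = G.dist o v := by omega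
      simp only [hc]
      rw [if_neg h2, if_pos h1.symm, inv_mul_cancel₀ hs.ne']
  have hsum : ∀ (t : Finset V), ∑ v ∈ t, ‖ψ v‖ ^ 2 ≤ ‖ψ‖ ^ 2 := by
    intro t
    have h := lp.sum_rpow_le_norm_rpow (p := 2) (by norm_num) ψ t
    simpa using h
  have hpt : ∀ v, ‖∑ u ∈ hG.nbrs v, ψ u‖ ^ 2 ≤ 2 * s * ∑ u ∈ hG.nbrs v, c u v * ‖ψ u‖ ^ 2 := by
    intro v
    calc ‖∑ u ∈ hG.nbrs v, ψ u‖ ^ 2 ≤ (∑ u ∈ hG.nbrs v, ‖ψ u‖) ^ 2 := by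
          gcongr; exact norm_sum_le _ _
      _ ≤ (∑ u ∈ hG.nbrs v, c v u) * ∑ u ∈ hG.nbrs v, c u v * ‖ψ u‖ ^ 2 := by
          refine Finset.sum_sq_le_sum_mul_sum_of_sq_le_mul _ (fun u _ => (hc0 v u).le)
            (fun u _ => mul_nonneg (hc0 u v).le (by positivity)) fun u hu => ?_
          rw [← mul_assoc, hcc v u ((hG.mem_nbrs v u).1 hu), one_mul]
      _ ≤ _ := by
          refine mul_le_mul_of_nonneg_right (hT.sum_weight_le hG o hs v (hdeg v)) ?_
          exact Finset.sum_nonneg fun u _ => mul_nonneg (hc0 u v).le (by positivity)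
  have hswap : ∑ v ∈ t, ∑ u ∈ hG.nbrs v, c u v * ‖ψ u‖ ^ 2 ≤ 2 * s * ‖ψ‖ ^ 2 := by
    have h1 : ∑ v ∈ t, ∑ u ∈ hG.nbrs v, c u v * ‖ψ u‖ ^ 2 =
        ∑ u ∈ t.biUnion hG.nbrs, ∑ v ∈ t.filter (fun v => G.Adj v u), c u v * ‖ψ u‖ ^ 2 := by
      refine Finset.sum_comm' fun v u => ?_
      simp only [hG.mem_nbrs, Finset.mem_biUnion, Finset.mem_filter]
      exact ⟨fun ⟨hv, hu⟩ => ⟨⟨hv, hu⟩, v, hv, hu⟩, fun h => h.1⟩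
    rw [h1]
    calc _ ≤ ∑ u ∈ t.biUnion hG.nbrs, 2 * s * ‖ψ u‖ ^ 2 := by
          refine Finset.sum_le_sum fun u _ => ?_
          rw [← Finset.sum_mul]
          refine mul_le_mul_of_nonneg_right ?_ (by positivity)
          refine (Finset.sum_le_sum_of_subset_of_nonneg (fun v hv => ?_)
            fun v _ _ => (hc0 u v).le).trans (hT.sum_weight_le hG o hs u (hdeg u))
          rw [hG.mem_nbrs]
          exact (Finset.mem_filter.1 hv).2.symm
      _ = 2 * s * ∑ u ∈ t.biUnion hG.nbrs, ‖ψ u‖ ^ 2 := by rw [Finset.mul_sum]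
      _ ≤ _ := by gcongr; exact hsum _
  calc _ ≤ ∑ v ∈ t, 2 * s * ∑ u ∈ hG.nbrs v, c u v * ‖ψ u‖ ^ 2 :=
        Finset.sum_le_sum fun v _ => hpt v
    _ = 2 * s * ∑ v ∈ t, ∑ u ∈ hG.nbrs v, c u v * ‖ψ u‖ ^ 2 := by rw [Finset.mul_sum]
    _ ≤ 2 * s * (2 * s * ‖ψ‖ ^ 2) := by gcongr
    _ = _ := by ring

/-- The spectral radius of a tree with vertex degrees at most `s ^ 2` is at most `2 * s`. -/
theorem SimpleGraph.IsTree.norm_le_of_mem_spectrum (hT : G.IsTree) (hG : BoundedDegree G) {s : ℝ}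
    (hs : 0 < s) (hdeg : ∀ v, ((hG.nbrs v).card : ℝ) ≤ s ^ 2) {H : JacobiMatrix G}
    (hH : H.IsAdjacency) {z : ℂ} (hz : z ∈ spectrum ℂ (H.op hG)) : ‖z‖ ≤ 2 * s := by
  have h1 : ‖H.op hG‖ ≤ 2 * s := by
    refine ContinuousLinearMap.opNorm_le_bound _ (by positivity) fun ψ => ?_
    refine lp.norm_le_of_forall_sum_le (by norm_num) (by positivity) fun t => ?_
    have := hT.sum_norm_sq_le hG hs hdeg ψ t
    simpa [hH.op_apply hG] using this
  have h2 := spectrum.norm_le_norm_mul_of_mem hz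
  have h3 : ‖(1 : EllTwo V →L[ℂ] EllTwo V)‖ ≤ 1 := ContinuousLinearMap.norm_id_le
  calc ‖z‖ ≤ ‖H.op hG‖ * ‖(1 : EllTwo V →L[ℂ] EllTwo V)‖ := h2
    _ ≤ 2 * s * 1 := by gcongr
    _ = 2 * s := mul_one _

end TreeBound

/-! ### Finite regular graphs of large girth -/

/-- Reduced words of length at most `r + 1`: no letter occurs twice in a row. -/
@[ext]
structure ReducedWord (d r : ℕ) where
  word : List (Fin d)
  chain : word.IsChain (· ≠ ·)
  length_le : word.length ≤ r + 1

namespace ReducedWord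

variable {d r : ℕ}

instance : Finite (ReducedWord d r) := by
  have := ((List.finite_length_le (Fin d) (r + 1))).to_subtype
  exact Finite.of_injective
    (fun w : ReducedWord d r => (⟨w.word, w.length_le⟩ : {l : List (Fin d) | l.length ≤ r + 1}))
    fun w w' h => ReducedWord.ext (congrArg Subtype.val h)

/-- The empty word. -/
def nil : ReducedWord d r := ⟨[], by simp, by simp⟩

@[simp]
theorem nil_word : (nil : ReducedWord d r).word = [] := rfl

/-- Left multiplication by the letter `c`, which acts trivially where the word would become too
long. -/
def push (c : Fin d) (w : ReducedWord d r) : ReducedWord d r :=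
  if h : w.word.head? = some c then
    ⟨w.word.tail, w.chain.tail, by have := w.length_le; simp; omega⟩
  else if hlen : w.word.length < r + 1 then ⟨c :: w.word, by
    rw [List.isChain_cons]
    refine ⟨fun y hy hc => ?_, w.chain⟩
    subst hc
    exact h hy, by simp; omega⟩
  else w

theorem push_word_of_head (c : Fin d) (t : List (Fin d)) (w : ReducedWord d r)
    (h : w.word = c :: t) : (push c w).word = t := by
  unfold push
  rw [dif_pos (by simp [h])]
  simp [h]

theorem push_word_of_lt (c : Fin d) (w : ReducedWord d r) (h : w.word.head? ≠ some c)
    (hlen : w.word.length < r + 1) : (push c w).word = c :: w.word := by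
  unfold push
  rw [dif_neg h, dif_pos hlen]

theorem push_of_le (c : Fin d) (w : ReducedWord d r) (h : w.word.head? ≠ some c)
    (hlen : ¬ w.word.length < r + 1) : push c w = w := by
  unfold push
  rw [dif_neg h, dif_neg hlen]

/-- Removing a leading `c` and prepending `c` undo each other because words are reduced; the words
that would grow too long are fixed points. -/
theorem push_involutive (c : Fin d) : Function.Involutive (push (r := r) c) := by
  intro w
  by_cases h : w.word.head? = some c
  · obtain ⟨t, ht⟩ : ∃ t, w.word = c :: t := List.head?_eq_some_iff.1 h
    have h1 := push_word_of_head c t w ht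
    have h2 := w.chain
    have h3 := w.length_le
    rw [ht] at h2 h3
    rw [List.isChain_cons] at h2
    refine ReducedWord.ext ?_
    rw [push_word_of_lt, h1, ht]
    · rw [h1]
      exact fun h4 => h2.1 c h4 rfl
    · rw [h1]
      simpa using h3
  · by_cases hlen : w.word.length < r + 1
    · exact ReducedWord.ext (push_word_of_head c w.word _ (push_word_of_lt c w h hlen))
    · rw [push_of_le c w h hlen, push_of_le c w h hlen]

theorem length_push_le (c : Fin d) (w : ReducedWord d r) :
    (push c w).word.length ≤ w.word.length + 1 := by
  unfold push
  split_ifs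
  · simp; omega
  · simp
  · simp

/-- The involution given by a letter. -/
def letterPerm (c : Fin d) : Equiv.Perm (ReducedWord d r) := (push_involutive c).toPerm

theorem letterPerm_apply (c : Fin d) (w : ReducedWord d r) : letterPerm c w = push c w := rfl

theorem letterPerm_mul_self (c : Fin d) : letterPerm (r := r) c * letterPerm c = 1 := by
  ext1 w
  exact push_involutive c w

theorem letterPerm_nil (c : Fin d) : (letterPerm (r := r) c nil).word = [c] :=
  push_word_of_lt c nil (by simp) (by simp)

/-- The group generated by the letters. -/
def letterGroup (d r : ℕ) : Subgroup (Equiv.Perm (ReducedWord d r)) :=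
  Subgroup.closure (Set.range letterPerm)

/-- A letter as an element of the group. -/
def letter (c : Fin d) : letterGroup d r :=
  ⟨letterPerm c, Subgroup.subset_closure ⟨c, rfl⟩⟩

theorem letter_mul_self (c : Fin d) : letter (r := r) c * letter c = 1 :=
  Subtype.ext (letterPerm_mul_self c)

/-- The images of the empty word are the one-letter words, which fit since the maximal length `r +
1` is positive. -/
theorem letter_injective : Function.Injective (letter (d := d) (r := r)) := by
  intro c c' h
  have h1 := congrArg (fun g : letterGroup d r => (g.1 nil).word) h
  simpa [letter, letterPerm_nil] using h1

theorem letter_ne_one (c : Fin d) : letter (r := r) c ≠ 1 := by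
  intro h
  have h1 := congrArg (fun g : letterGroup d r => (g.1 nil).word) h
  simp [letter, letterPerm_nil] at h1

/-- The Cayley graph of the group generated by the letters. -/
def cayley (d r : ℕ) : SimpleGraph (letterGroup d r) where
  Adj g h := ∃ c, h = g * letter c
  symm := ⟨by
    rintro g h ⟨c, rfl⟩
    exact ⟨c, by rw [mul_assoc, letter_mul_self, mul_one]⟩⟩
  loopless := ⟨by
    rintro g ⟨c, hc⟩
    exact letter_ne_one c (left_eq_mul.1 hc)⟩

theorem cayley_regular (d r : ℕ) : IsRegularGraph (cayley d r) d := by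
  intro g
  have : (cayley d r).neighborSet g = Set.range fun c => g * letter c := by
    ext h
    simp [cayley, eq_comm]
  rw [this, ← Set.image_univ, Function.Injective.encard_image]
  · simp
  · exact fun c c' h => letter_injective (mul_left_cancel h)

theorem cayley_connected (d r : ℕ) : (cayley d r).Connected := by
  have key : ∀ h (hh : h ∈ letterGroup d r) (g : letterGroup d r),
      (cayley d r).Reachable g (g * ⟨h, hh⟩) := by
    intro h hh
    induction hh using Subgroup.closure_induction with
    | mem x hx =>
      intro g
      obtain ⟨c, rfl⟩ := hx
      exact SimpleGraph.Adj.reachable ⟨c, rfl⟩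
    | one => intro g; exact (mul_one g) ▸ SimpleGraph.Reachable.refl _
    | mul x y hx hy h1 h2 =>
      intro g
      have := (h1 g).trans (h2 (g * ⟨x, hx⟩))
      rwa [mul_assoc] at this
    | inv x hx h1 =>
      intro g
      have := h1 (g * ⟨x, hx⟩⁻¹)
      rw [inv_mul_cancel_right] at this
      exact this.symm
  have : Nonempty (letterGroup d r) := ⟨1⟩
  refine ⟨fun g h => ?_⟩
  have := key _ (g⁻¹ * h).2 g
  rwa [Subtype.coe_eta, mul_inv_cancel_left] at this

theorem one_apply_nil : (1 : letterGroup d r).1 nil = nil := rfl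

/-- The first step of the walk splits one letter off the left of `u⁻¹ * v`, and a letter lengthens a
word by at most one. This bounds distances in the Cayley graph from below. -/
theorem length_apply_nil_le {u v : letterGroup d r} (w : (cayley d r).Walk u v) :
    ((u⁻¹ * v).1 nil).word.length ≤ w.length := by
  induction w with
  | nil => simp
  | @cons u x v h w ih =>
    obtain ⟨c, hc⟩ := id h
    have h1 : u⁻¹ * v = letter c * (x⁻¹ * v) := by
      rw [hc]
      group
    rw [h1]
    refine (length_push_le c _).trans ?_
    simpa using ih

theorem exists_apply_nil (l : List (Fin d)) (hl : l.IsChain (· ≠ ·)) (hlen : l.length ≤ r + 1) :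
    ∃ g : letterGroup d r, (g.1 nil).word = l := by
  induction l with
  | nil => exact ⟨1, rfl⟩
  | cons c t ih =>
    rw [List.isChain_cons] at hl
    rw [List.length_cons] at hlen
    obtain ⟨g, hg⟩ := ih hl.2 (by omega)
    refine ⟨letter c * g, ?_⟩
    have h3 : (letter c * g).1 nil = push c (g.1 nil) := rfl
    rw [h3, push_word_of_lt, hg]
    · rw [hg]
      exact fun h => hl.1 c h rfl
    · rw [hg]
      omega

theorem exists_isChain_ne_length (hd : 2 < d) (n : ℕ) :
    ∃ l : List (Fin d), l.IsChain (· ≠ ·) ∧ l.length = n := by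
  induction n with
  | zero => exact ⟨[], by simp⟩
  | succ n ih =>
    obtain ⟨l, hl, hn⟩ := ih
    rcases l with _ | ⟨a, t⟩
    · exact ⟨[⟨0, by omega⟩], by simp, by simp at hn ⊢; omega⟩
    · have : Nontrivial (Fin d) := Fin.nontrivial_iff_two_le.2 (by omega)
      obtain ⟨b, hb⟩ := exists_ne a
      exact ⟨b :: a :: t, List.isChain_cons_cons.2 ⟨hb, hl⟩, by simpa using hn⟩

/-- Some group element carries the empty word to a reduced word of the maximal length `r + 1`, so it
is that far from the identity. -/
theorem exists_le_dist (hd : 2 < d) :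
    ∃ p q : letterGroup d r, r + 1 ≤ (cayley d r).dist p q := by
  obtain ⟨l, hl, hn⟩ := exists_isChain_ne_length hd (r + 1)
  obtain ⟨g, hg⟩ := exists_apply_nil (r := r) l hl hn.le
  refine ⟨1, g, ?_⟩
  obtain ⟨w, hw⟩ := (cayley_connected d r).exists_walk_length_eq_dist 1 g
  have h := length_apply_nil_le w
  rw [hw] at h
  simp only [inv_one, one_mul, hg, hn] at h
  exact h

/-- Up to the truncation length, a walk that never turns back acts on the empty word without
cancellation, as in the free product of `d` groups of order two. The second conclusion carries the
induction: the leading letter records the first edge, so a cancellation would force the walk to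
repeat that edge at once. -/
theorem apply_nil_of_isChain {u v : letterGroup d r} (w : (cayley d r).Walk u v)
    (hw : w.edges.IsChain (· ≠ ·)) (hlen : w.length ≤ r + 1) :
    ((u⁻¹ * v).1 nil).word.length = w.length ∧
      ∀ c, ((u⁻¹ * v).1 nil).word.head? = some c → w.snd = u * letter c := by
  induction w with
  | nil => simp
  | @cons u x v h w ih =>
    obtain ⟨c, hc⟩ := id h
    have h1 : u⁻¹ * v = letter c * (x⁻¹ * v) := by
      rw [hc]
      group
    have h2 : (letter c * (x⁻¹ * v)).1 nil = push c ((x⁻¹ * v).1 nil) := rfl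
    simp only [SimpleGraph.Walk.length_cons] at hlen
    rw [SimpleGraph.Walk.edges_cons, List.isChain_cons] at hw
    obtain ⟨ih1, ih2⟩ := ih hw.2 (by omega)
    have h3 : ((x⁻¹ * v).1 nil).word.head? ≠ some c := by
      intro h4
      have h5 := ih2 c h4
      rcases w with _ | ⟨hxy, w⟩
      · simp at h4
      · simp only [SimpleGraph.Walk.snd_cons] at h5
        refine hw.1 _ (by rw [SimpleGraph.Walk.edges_cons]; rfl) ?_
        rw [h5, hc, mul_assoc, letter_mul_self, mul_one]
        exact Sym2.eq_swap
    have h4 := push_word_of_lt c _ h3 (by rw [ih1]; omega)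
    rw [h1, h2, h4]
    refine ⟨by rw [List.length_cons, ih1, SimpleGraph.Walk.length_cons], fun c' hc' => ?_⟩
    simp only [List.head?_cons, Option.some.injEq] at hc'
    rw [SimpleGraph.Walk.snd_cons, hc, hc']

/-- A closed walk represents the identity, which fixes the empty word, while a short cycle would
produce a word as long as itself. -/
theorem lt_length_of_isCycle {u : letterGroup d r} {w : (cayley d r).Walk u u} (hw : w.IsCycle) :
    r + 1 < w.length := by
  by_contra h
  have h1 := apply_nil_of_isChain w
    (List.Pairwise.isChain hw.isTrail.edges_nodup) (by omega)
  have h2 := hw.three_le_length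
  have h3 := h1.1
  rw [inv_mul_cancel, one_apply_nil] at h3
  simp at h3
  omega

end ReducedWord

/-- A nontrivial finite tree has a leaf. A cycle is needed because `girth` takes the default value
`0` on acyclic graphs. -/
theorem SimpleGraph.not_isAcyclic_of_isRegularGraph {W : Type*} {Γ : SimpleGraph W} [Finite W]
    (hc : Γ.Connected) {d : ℕ} (hd : 2 < d) (hr : IsRegularGraph Γ d) : ¬ Γ.IsAcyclic := by
  classical
  intro ha
  have := Fintype.ofFinite W
  have hdeg : ∀ v, Γ.degree v = d := by
    intro v
    have h := hr v
    rw [← SimpleGraph.coe_neighborFinset, Set.encard_coe_eq_coe_finsetCard] at h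
    exact_mod_cast h
  obtain ⟨v⟩ := hc.nonempty
  have : Nontrivial W := by
    have h1 : 0 < Γ.degree v := by rw [hdeg]; omega
    obtain ⟨u, hu⟩ := (Γ.degree_pos_iff_exists_adj v).1 h1
    exact ⟨v, u, hu.ne⟩
  obtain ⟨u, hu⟩ := SimpleGraph.IsTree.exists_vert_degree_one_of_nontrivial ⟨hc, ha⟩
  rw [hdeg] at hu
  omega

theorem exists_regularGraph_girth_gt {d : ℕ} (hd : 2 < d) (n : ℕ) :
    ∃ (W : Type) (Γ : SimpleGraph W) (p q : W), Finite W ∧ Γ.Connected ∧ IsRegularGraph Γ d ∧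
      n < Γ.girth ∧ n < Γ.dist p q := by
  obtain ⟨p, q, hpq⟩ := ReducedWord.exists_le_dist (r := n) hd
  refine ⟨ReducedWord.letterGroup d n, ReducedWord.cayley d n, p, q, inferInstance,
    ReducedWord.cayley_connected d n, ReducedWord.cayley_regular d n, ?_, hpq⟩
  have hna := SimpleGraph.not_isAcyclic_of_isRegularGraph (ReducedWord.cayley_connected d n) hd
    (ReducedWord.cayley_regular d n)
  obtain ⟨a, w, hw, hl⟩ := SimpleGraph.exists_girth_eq_length.2 hna
  rw [hl]
  have := ReducedWord.lt_length_of_isCycle hw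
  omega

/-! ### Trees with a half-line, lines -/

section Distance

variable {V W : Type*} {G : SimpleGraph V} {G' : SimpleGraph W}

theorem SimpleGraph.Connected.exists_adj_dist_add_one (hG : G.Connected) {a x : V} (hx : x ≠ a) :
    ∃ y, G.Adj y x ∧ G.dist a y + 1 = G.dist a x := by
  obtain ⟨w, hw⟩ := hG.exists_walk_length_eq_dist x a
  rcases w with _ | ⟨h, w⟩
  · exact absurd rfl hx
  · rename_i y
    refine ⟨y, h.symm, ?_⟩
    have h1 := SimpleGraph.dist_le w
    have h2 := hG.dist_triangle (u := x) (v := y) (w := a)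
    have h3 : G.dist x y = 1 := SimpleGraph.dist_eq_one_iff_adj.2 h
    rw [SimpleGraph.Walk.length_cons] at hw
    rw [G.dist_comm (u := a), G.dist_comm (u := a)]
    omega

theorem SimpleGraph.Connected.dist_le_dist_add_one (hG : G.Connected) (a : V) {x y : V}
    (h : G.Adj x y) : G.dist a y ≤ G.dist a x + 1 := by
  have h2 := hG.dist_triangle (u := a) (v := x) (w := y)
  rwa [SimpleGraph.dist_eq_one_iff_adj.2 h] at h2

theorem SimpleGraph.Walk.exists_walk_map_le {π : V → W}
    (hπ : ∀ u v, G.Adj u v → π u = π v ∨ G'.Adj (π u) (π v)) {u v : V} (w : G.Walk u v) :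
    ∃ w' : G'.Walk (π u) (π v), w'.length ≤ w.length := by
  induction w with
  | nil => exact ⟨.nil, le_rfl⟩
  | @cons u x v h w ih =>
    obtain ⟨w', hw'⟩ := ih
    rcases hπ u x h with h1 | h1
    · exact ⟨w'.copy h1.symm rfl, by simp; omega⟩
    · exact ⟨.cons h1 w', by simpa using hw'⟩

/-- Project a geodesic and drop the collapsed steps. The maps in question are inclusions of blocks
and retractions onto them. -/
theorem SimpleGraph.Connected.dist_map_le (hG : G.Connected) {π : V → W}
    (hπ : ∀ u v, G.Adj u v → π u = π v ∨ G'.Adj (π u) (π v)) (u v : V) :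
    G'.dist (π u) (π v) ≤ G.dist u v := by
  obtain ⟨w, hw⟩ := hG.exists_walk_length_eq_dist u v
  obtain ⟨w', hw'⟩ := w.exists_walk_map_le hπ
  exact (SimpleGraph.dist_le w').trans (hw'.trans hw.le)

theorem SimpleGraph.Connected.of_retraction (hG : G.Connected) {π : V → W}
    (hπ : ∀ u v, G.Adj u v → π u = π v ∨ G'.Adj (π u) (π v)) (hs : Function.Surjective π) :
    G'.Connected := by
  have : Nonempty W := hG.nonempty.map π
  refine ⟨fun x y => ?_⟩
  obtain ⟨u, rfl⟩ := hs x
  obtain ⟨v, rfl⟩ := hs y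
  obtain ⟨w⟩ := hG u v
  obtain ⟨w', -⟩ := w.exists_walk_map_le hπ
  exact ⟨w'⟩

/-- Exactly one of the two neighbours is the parent; in a tree the other must be farther from `a`.
-/
theorem SimpleGraph.IsTree.existsUnique_child (hT : G.IsTree) (a : V) {x : V} (hx : x ≠ a)
    (hdeg : (G.neighborSet x).encard = 2) : ∃! y, G.Adj x y ∧ G.dist a y = G.dist a x + 1 := by
  obtain ⟨y, z, hyz, hN⟩ := Set.encard_eq_two.1 hdeg
  have hmem : ∀ w, G.Adj x w ↔ w = y ∨ w = z := fun w => by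
    rw [← SimpleGraph.mem_neighborSet, hN]; simp
  obtain ⟨p, hp, hpd⟩ := hT.connected.exists_adj_dist_add_one hx
  have huniq : ∀ q, G.Adj x q → q ≠ p → G.dist a q = G.dist a x + 1 := by
    intro q hq hqp
    rcases hT.dist_eq_dist_add_one_of_adj a hq with h | h
    · exact absurd (hT.eq_of_dist_add_one a hq.symm hp h.symm hpd) hqp
    · exact h
  rcases (hmem p).1 hp.symm with rfl | rfl
  · refine ⟨z, ⟨(hmem z).2 (Or.inr rfl), huniq z ((hmem z).2 (Or.inr rfl)) hyz.symm⟩, ?_⟩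
    rintro w ⟨hw, hwd⟩
    rcases (hmem w).1 hw with rfl | rfl
    · omega
    · rfl
  · refine ⟨y, ⟨(hmem y).2 (Or.inl rfl), huniq y ((hmem y).2 (Or.inl rfl)) hyz⟩, ?_⟩
    rintro w ⟨hw, hwd⟩
    rcases (hmem w).1 hw with rfl | rfl
    · rfl
    · omega

end Distance

/-! ### Recognising the half-line and the line among trees -/

section HalfLine

variable {V : Type*} {G : SimpleGraph V}

/-- A tree in which all vertices have degree two, except for one vertex of degree one, is the
half-line. -/
theorem SimpleGraph.IsTree.exists_iso_hasse_nat (hT : G.IsTree) (a : V)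
    (ha : (G.neighborSet a).encard = 1) (hdeg : ∀ x, x ≠ a → (G.neighborSet x).encard = 2) :
    ∃ φ : G ≃g SimpleGraph.hasse ℕ, φ a = 0 := by
  have hc := hT.connected
  have hchild : ∀ x, ∃! y, G.Adj x y ∧ G.dist a y = G.dist a x + 1 := by
    intro x
    by_cases hx : x = a
    · subst hx
      obtain ⟨y, hy⟩ := Set.encard_eq_one.1 ha
      have hmem : ∀ w, G.Adj x w ↔ w = y := fun w => by
        rw [← SimpleGraph.mem_neighborSet, hy]; simp
      refine ⟨y, ⟨(hmem y).2 rfl, ?_⟩, fun w hw => (hmem w).1 hw.1⟩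
      rw [SimpleGraph.dist_self, SimpleGraph.dist_eq_one_iff_adj]
      exact (hmem y).2 rfl
    · exact hT.existsUnique_child a hx (hdeg x hx)
  have hinj : ∀ n x y, G.dist a x = n → G.dist a y = n → x = y := by
    intro n
    induction n with
    | zero =>
      intro x y hx hy
      rw [hc.dist_eq_zero_iff] at hx hy
      rw [← hx, ← hy]
    | succ n ih =>
      intro x y hx hy
      have hxa : x ≠ a := by rintro rfl; simp at hx
      have hya : y ≠ a := by rintro rfl; simp at hy
      obtain ⟨x', hx', hxd⟩ := hc.exists_adj_dist_add_one hxa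
      obtain ⟨y', hy', hyd⟩ := hc.exists_adj_dist_add_one hya
      obtain rfl := ih x' y' (by omega) (by omega)
      exact (hchild x').unique ⟨hx', by omega⟩ ⟨hy', by omega⟩
  have hsurj : ∀ n, ∃ x, G.dist a x = n := by
    intro n
    induction n with
    | zero => exact ⟨a, by simp⟩
    | succ n ih =>
      obtain ⟨x, hx⟩ := ih
      obtain ⟨y, hy, -⟩ := hchild x
      exact ⟨y, by omega⟩
  have key : ∀ x y, G.dist a x + 1 = G.dist a y → G.Adj x y := by
    intro x y h
    obtain ⟨x', hx', hd⟩ := hc.exists_adj_dist_add_one (a := a) (x := y)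
      (by rintro rfl; simp at h)
    rwa [hinj _ x x' rfl (by omega)]
  -- The distance from the end point is the coordinate.
  have hbij : Function.Bijective (G.dist a) := ⟨fun x y h => hinj _ x y h rfl, hsurj⟩
  refine ⟨⟨Equiv.ofBijective _ hbij, ?_⟩, SimpleGraph.dist_self⟩
  intro x y
  simp only [Equiv.ofBijective_apply, SimpleGraph.hasse_adj, Nat.covBy_iff_add_one_eq]
  constructor
  · rintro (h | h)
    · exact key x y h
    · exact (key y x h).symm
  · intro h
    rcases hT.dist_eq_dist_add_one_of_adj a h with h1 | h1
    · exact Or.inr h1.symm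
    · exact Or.inl h1.symm

/-- A tree in which all vertices have degree two is the line. -/
theorem SimpleGraph.IsTree.isLine (hT : G.IsTree) (hdeg : ∀ x, (G.neighborSet x).encard = 2) :
    IsLine G := by
  classical
  have hc := hT.connected
  obtain ⟨o⟩ := hc.nonempty
  obtain ⟨b, c, hbc, hN⟩ := Set.encard_eq_two.1 (hdeg o)
  have hmem : ∀ w, G.Adj o w ↔ w = b ∨ w = c := fun w => by
    rw [← SimpleGraph.mem_neighborSet, hN]; simp
  have hob : G.Adj o b := (hmem b).2 (Or.inl rfl)
  have hoc : G.Adj o c := (hmem c).2 (Or.inr rfl)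
  have hb1 : G.dist o b = 1 := SimpleGraph.dist_eq_one_iff_adj.2 hob
  have hc1 : G.dist o c = 1 := SimpleGraph.dist_eq_one_iff_adj.2 hoc
  -- `P x` means that `x` lies on the side of `b`, that is, `b` lies on a geodesic from `o` to `x`.
  set P : V → Prop := fun x => G.dist b x + 1 = G.dist o x with hP
  have hnP : ∀ x, ¬ P x → G.dist b x = G.dist o x + 1 := by
    intro x hx
    have := hT.dist_eq_dist_add_one_of_adj x hob
    rw [G.dist_comm (u := x), G.dist_comm (u := x)] at this
    simp only [hP] at hx
    omega
  have hPb : P b := by simp [hP, hb1]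
  have hPc : ¬ P c := by
    intro h
    simp only [hP, hc1] at h
    exact hbc (hc.dist_eq_zero_iff.1 (by omega))
  have hPo : ¬ P o := by simp [hP]
  -- the side does not change when moving away from `o`
  have hside : ∀ x y, x ≠ o → G.Adj x y → G.dist o y = G.dist o x + 1 → (P x ↔ P y) := by
    intro x y hx hxy hd
    constructor
    · intro hPx
      by_contra hPy
      have h1 := hnP y hPy
      have h2 := hc.dist_le_dist_add_one b hxy
      simp only [hP] at hPx
      omega
    · intro hPy
      by_contra hPx
      have h1 := hnP x hPx
      simp only [hP] at hPy
      obtain ⟨z, hz, hzd⟩ := hc.exists_adj_dist_add_one hx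
      have h2 : G.dist b z ≤ G.dist o z + 1 := by
        by_cases h : P z
        · simp only [hP] at h; omega
        · rw [hnP z h]
      have h3 := hc.dist_le_dist_add_one b hz
      -- Both `z` and `y` are one step from `x` towards `b`, hence equal, although they lie on
      -- different sides of `x` as seen from `o`.
      have h4 := hT.eq_of_dist_add_one b hz hxy.symm (by omega) (by omega)
      subst h4
      omega
  have hchild : ∀ x, x ≠ o → ∃! y, G.Adj x y ∧ G.dist o y = G.dist o x + 1 :=
    fun x hx => hT.existsUnique_child o hx (hdeg x)
  have hne : ∀ x n, G.dist o x = n + 1 → x ≠ o := by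
    rintro x n h rfl
    simp at h
  have hinj : ∀ n x y, G.dist o x = n → G.dist o y = n → (P x ↔ P y) → x = y := by
    intro n
    induction n with
    | zero =>
      intro x y hx hy _
      rw [hc.dist_eq_zero_iff] at hx hy
      rw [← hx, ← hy]
    | succ n ih =>
      intro x y hx hy hxy
      obtain ⟨x', hx', hxd⟩ := hc.exists_adj_dist_add_one (hne x n hx)
      obtain ⟨y', hy', hyd⟩ := hc.exists_adj_dist_add_one (hne y n hy)
      rcases n with _ | n
      · rw [zero_add, SimpleGraph.dist_eq_one_iff_adj, hmem] at hx hy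
        rcases hx with rfl | rfl <;> rcases hy with rfl | rfl
        · rfl
        · exact absurd (hxy.1 hPb) hPc
        · exact absurd (hxy.2 hPb) hPc
        · rfl
      · have hx'o := hne x' n (by omega)
        have hy'o := hne y' n (by omega)
        obtain rfl := ih x' y' (by omega) (by omega)
          (by rw [hside x' x hx'o hx' (by omega), hside y' y hy'o hy' (by omega), hxy])
        exact (hchild x' hx'o).unique ⟨hx', by omega⟩ ⟨hy', by omega⟩
  have hsurj : ∀ n s, (s = b ∨ s = c) → ∃ x, G.dist o x = n + 1 ∧ (P x ↔ P s) := by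
    intro n s hs
    induction n with
    | zero => exact ⟨s, by rcases hs with rfl | rfl <;> simp [hb1, hc1], Iff.rfl⟩
    | succ n ih =>
      obtain ⟨x, hx, hxs⟩ := ih
      have hxo := hne x n hx
      obtain ⟨y, hy, -⟩ := hchild x hxo
      exact ⟨y, by omega, by rw [← hside x y hxo hy.1 hy.2, hxs]⟩
  -- The signed distance from `o`, positive on the side of `b`, is the coordinate.
  set f : V → ℤ := fun x => if P x then (G.dist o x : ℤ) else -(G.dist o x : ℤ) with hf
  have hfo : f o = 0 := by simp [hf]
  have hfP : ∀ x, P x → f x = G.dist o x := fun x hx => by simp [hf, hx]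
  have hfN : ∀ x, ¬ P x → f x = -(G.dist o x : ℤ) := fun x hx => by simp [hf, hx]
  have hpos : ∀ x, P x → 0 < G.dist o x := fun x hx => by simp only [hP] at hx; omega
  have hfinj : Function.Injective f := by
    intro x y hxy
    by_cases hx : P x <;> by_cases hy : P y
    · rw [hfP x hx, hfP y hy] at hxy
      exact hinj _ x y rfl (by omega) (by simp [hx, hy])
    · rw [hfP x hx, hfN y hy] at hxy
      have := hpos x hx
      omega
    · rw [hfN x hx, hfP y hy] at hxy
      have := hpos y hy
      omega
    · rw [hfN x hx, hfN y hy] at hxy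
      exact hinj _ x y rfl (by omega) (by simp [hx, hy])
  have hfsurj : Function.Surjective f := by
    intro m
    rcases lt_trichotomy m 0 with hm | rfl | hm
    · obtain ⟨x, hx, hxs⟩ := hsurj (m.natAbs - 1) c (Or.inr rfl)
      exact ⟨x, by rw [hfN x (by rw [hxs]; exact hPc)]; omega⟩
    · exact ⟨o, hfo⟩
    · obtain ⟨x, hx, hxs⟩ := hsurj (m.natAbs - 1) b (Or.inl rfl)
      exact ⟨x, by rw [hfP x (by rw [hxs]; exact hPb)]; omega⟩
  have hout : ∀ x y, G.Adj x y → G.dist o y = G.dist o x + 1 → f y = f x + 1 ∨ f x = f y + 1 := by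
    intro x y hxy hd
    by_cases hx : x = o
    · subst hx
      by_cases hy : P y
      · left; rw [hfo, hfP y hy, hd]; simp
      · right; rw [hfo, hfN y hy, hd]; simp
    · have h1 := hside x y hx hxy hd
      by_cases hPx : P x
      · left; rw [hfP x hPx, hfP y (h1.1 hPx)]; omega
      · right; rw [hfN x hPx, hfN y (fun h => hPx (h1.2 h))]; omega
  have hadj : ∀ x y, G.Adj x y → f y = f x + 1 ∨ f x = f y + 1 := by
    intro x y hxy
    rcases hT.dist_eq_dist_add_one_of_adj o hxy with h | h
    · exact (hout y x hxy.symm h).symm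
    · exact hout x y hxy h
  have key : ∀ x y, f y = f x + 1 → G.Adj x y := by
    intro x y hxy
    by_cases hy : P y
    · obtain ⟨z, hz, hzd⟩ := hc.exists_adj_dist_add_one (hne y (G.dist o y - 1)
        (by have := hpos y hy; omega))
      have h1 := hfP y hy
      have h2 : f z = (G.dist o z : ℤ) := by
        by_cases hzo : z = o
        · subst hzo; simp [hfo]
        · exact hfP z ((hside z y hzo hz hzd.symm).2 hy)
      rwa [hfinj (show f x = f z by omega)]
    · have h1 := hfN y hy
      have hx : ¬ P x := fun hx => by have := hfP x hx; omega
      have h2 := hfN x hx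
      obtain ⟨z, hz, hzd⟩ := hc.exists_adj_dist_add_one (hne x (G.dist o x - 1) (by omega))
      have h3 : f z = -(G.dist o z : ℤ) := by
        by_cases hzo : z = o
        · subst hzo; simp [hfo]
        · exact hfN z fun h => hx ((hside z x hzo hz hzd.symm).1 h)
      rw [hfinj (show f y = f z by omega)]
      exact hz.symm
  refine ⟨⟨Equiv.ofBijective f ⟨hfinj, hfsurj⟩, ?_⟩⟩
  intro x y
  simp only [SimpleGraph.hasse_adj, Order.covBy_iff_add_one_eq]
  constructor
  · rintro (h | h)
    · exact key x y h.symm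
    · exact (key y x h.symm).symm
  · intro h
    rcases hadj x y h with h1 | h1
    · exact Or.inl h1.symm
    · exact Or.inr h1.symm

end HalfLine

/-! ### Trees with at most one edge between line vertices and tree vertices -/

section Classification

variable {V : Type*} {G : SimpleGraph V}

theorem SimpleGraph.encard_neighborSet_induce (s : Set V) (x : s) :
    ((G.induce s).neighborSet x).encard = (G.neighborSet x ∩ s).encard := by
  rw [← Function.Injective.encard_image (f := ((↑) : s → V)) Subtype.val_injective]
  congr 1
  ext y
  simp [and_comm]

theorem SimpleGraph.Reachable.mem_iff_of_no_boundary {L : Set V}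
    (h : ∀ x y, G.Adj x y → x ∈ L → y ∈ L) {x y : V} (hxy : G.Reachable x y) : x ∈ L ↔ y ∈ L := by
  obtain ⟨w⟩ := hxy
  induction w with
  | nil => rfl
  | cons hxy w ih => rw [← ih]; exact ⟨h _ _ hxy, h _ _ hxy.symm⟩

theorem SimpleGraph.IsTree.isRegularTree_of_forall_notMem (hT : G.IsTree) {L : Set V} {d : ℕ}
    (hd : ∀ x, x ∉ L → (G.neighborSet x ∩ Lᶜ).encard = d) (hL : ∀ x, x ∉ L) :
    IsRegularTree G d := by
  refine ⟨hT, fun x => ?_⟩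
  rw [← hd x (hL x)]
  congr 1
  ext y
  simp [hL y]

/-- Cutting the only edge between `L` and its complement leaves two subtrees. In `L` all degrees
remain two except that `a` loses a neighbour, which gives a half-line ending at `a`; the complement
is `d`-regular. -/
theorem SimpleGraph.IsTree.isRegularTreeWithHalfLine {V : Type} {G : SimpleGraph V}
    (hT : G.IsTree) {L : Set V} {d : ℕ}
    (hL : ∀ x ∈ L, (G.neighborSet x).encard = 2)
    (hd : ∀ x, x ∉ L → (G.neighborSet x ∩ Lᶜ).encard = d)
    (huniq : ∀ a ∈ L, ∀ a' ∈ L, ∀ o, o ∉ L → ∀ o', o' ∉ L → G.Adj a o → G.Adj a' o' →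
      a = a' ∧ o = o')
    {a o : V} (ha : a ∈ L) (ho : o ∉ L) (hao : G.Adj a o) : IsRegularTreeWithHalfLine G d := by
  classical
  have hc := hT.connected
  -- the part of degree two is a half-line
  have hLc : (G.induce L).Connected := by
    -- Collapsing the complement to `a` respects edges because every mixed edge ends at `a`.
    refine hc.of_retraction (π := fun x => if h : x ∈ L then ⟨x, h⟩ else ⟨a, ha⟩) ?_ ?_
    · intro u v huv
      by_cases hu : u ∈ L <;> by_cases hv : v ∈ L
      · right; simpa [hu, hv] using huv
      · left; simp [hu, hv, (huniq a ha u hu o ho v hv hao huv).1]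
      · left; simp [hu, hv, (huniq a ha v hv o ho u hu hao huv.symm).1]
      · left; simp [hu, hv]
    · exact fun x => ⟨x, by simp⟩
  have hLcc : (G.induce Lᶜ).Connected := by
    refine hc.of_retraction (π := fun x => if h : x ∈ Lᶜ then ⟨x, h⟩ else ⟨o, ho⟩) ?_ ?_
    · intro u v huv
      by_cases hu : u ∈ L <;> by_cases hv : v ∈ L
      · left; simp [hu, hv]
      · left; simp [hu, hv, (huniq a ha u hu o ho v hv hao huv).2]
      · left; simp [hu, hv, (huniq a ha v hv o ho u hu hao huv.symm).2]
      · right; simpa [hu, hv] using huv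
    · rintro ⟨x, hx⟩
      exact ⟨x, dif_pos hx⟩
  have hdegL : ∀ x : L, x ≠ ⟨a, ha⟩ → ((G.induce L).neighborSet x).encard = 2 := by
    intro x hx
    rw [SimpleGraph.encard_neighborSet_induce, ← hL x x.2]
    congr 1
    rw [Set.inter_eq_left]
    intro y hy
    by_contra hyL
    exact hx (Subtype.ext (huniq a ha x x.2 o ho y hyL hao hy).1.symm)
  have hdega : ((G.induce L).neighborSet ⟨a, ha⟩).encard = 1 := by
    rw [SimpleGraph.encard_neighborSet_induce]
    have h1 : G.neighborSet a = insert o (G.neighborSet a ∩ L) := by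
      ext y
      simp only [SimpleGraph.mem_neighborSet, Set.mem_insert_iff, Set.mem_inter_iff]
      constructor
      · intro h
        by_cases hy : y ∈ L
        · exact Or.inr ⟨h, hy⟩
        · exact Or.inl (huniq a ha a ha o ho y hy hao h).2.symm
      · rintro (rfl | h)
        · exact hao
        · exact h.1
    have h2 := hL a ha
    rw [h1, Set.encard_insert_of_notMem (fun h => ho h.2)] at h2
    have h3 : (2 : ℕ∞) = 1 + 1 := by norm_num
    rw [h3] at h2
    exact (ENat.add_left_injective_of_ne_top ENat.one_ne_top h2)
  obtain ⟨φ, hφ⟩ := SimpleGraph.IsTree.exists_iso_hasse_nat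
    ⟨hLc, hT.isAcyclic.induce L⟩ ⟨a, ha⟩ hdega hdegL
  have hφ0 : φ.symm 0 = ⟨a, ha⟩ := by rw [← hφ]; simp
  have hmix : ∀ (x : (Lᶜ : Set V)) (n : ℕ),
      G.Adj x (φ.symm n) ↔ x = ⟨o, ho⟩ ∧ n = 0 := by
    intro x n
    constructor
    · intro h
      obtain ⟨h1, h2⟩ := huniq a ha _ (φ.symm n).2 o ho x x.2 hao h.symm
      refine ⟨Subtype.ext h2.symm, ?_⟩
      rw [← hφ, ← φ.apply_symm_apply n]
      exact congrArg φ (Subtype.ext h1.symm)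
    · rintro ⟨rfl, rfl⟩
      rw [hφ0]
      exact hao.symm
  refine ⟨(Lᶜ : Set V), G.induce Lᶜ, ⟨o, ho⟩, ⟨⟨hLcc, hT.isAcyclic.induce _⟩, fun x => ?_⟩, ?_⟩
  · rw [SimpleGraph.encard_neighborSet_induce, hd x x.2]
  · set ψ : (Lᶜ : Set V) ⊕ ℕ → V := Sum.elim (fun x => (x : V)) (fun n => (φ.symm n : V)) with hψ
    have hψb : Function.Bijective ψ := by
      constructor
      · rintro (x | n) (y | m) h
        · simp only [hψ, Sum.elim_inl] at h
          rw [Subtype.ext h]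
        · simp only [hψ, Sum.elim_inl, Sum.elim_inr] at h
          exact absurd (φ.symm m).2 (h ▸ x.2)
        · simp only [hψ, Sum.elim_inl, Sum.elim_inr] at h
          exact absurd (φ.symm n).2 (h ▸ y.2)
        · simp only [hψ, Sum.elim_inr] at h
          rw [φ.symm.injective (Subtype.ext h)]
      · intro x
        by_cases hx : x ∈ L
        · exact ⟨Sum.inr (φ ⟨x, hx⟩), by simp [hψ]⟩
        · exact ⟨Sum.inl ⟨x, hx⟩, rfl⟩
    refine ⟨(⟨Equiv.ofBijective ψ hψb, ?_⟩ : joinHalfLine (G.induce Lᶜ) ⟨o, ho⟩ ≃g G).symm⟩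
    rintro (x | n) (y | m)
    · simp [hψ, joinHalfLine, SimpleGraph.edge_adj]
    · have := hmix x m
      simp [hψ, joinHalfLine, SimpleGraph.edge_adj, this]
    · have := hmix y n
      rw [G.adj_comm] at this
      simp [hψ, joinHalfLine, SimpleGraph.edge_adj, this, and_comm]
    · have h1 : G.Adj (φ.symm n) (φ.symm m) ↔ (SimpleGraph.hasse ℕ).Adj n m := by
        rw [← φ.symm.map_adj_iff]; rfl
      simp [hψ, joinHalfLine, SimpleGraph.edge_adj, h1]

end Classification

/-! ### Local convergence of graphs -/

/-- The balls of `G` about the points `w j` are eventually isomorphic to the balls of `G'` about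
`o`. (The isomorphism of balls of radius at least one need not respect the centres.) -/
def LocallyConverges {V V' : Type*} (G : SimpleGraph V) (w : ℕ → V) (G' : SimpleGraph V')
    (o : V') : Prop :=
  ∀ r, 1 ≤ r → ∀ᶠ j in atTop, ∃ f : V' → V,
    (∀ s, 1 ≤ s → s ≤ r → Set.BijOn f (graphBall G' o s) (graphBall G (w j) s)) ∧
    ∀ x ∈ graphBall G' o r, ∀ y ∈ graphBall G' o r, (G'.Adj x y ↔ G.Adj (f x) (f y))

/-- The set `{0, 1}` is closed and discrete. This turns convergence of adjacency matrices into
eventual equality. -/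
theorem eventually_eq_of_tendsto_of_eq_zero_or_one {x : ℕ → ℝ} {c : ℝ}
    (hx : ∀ j, x j = 0 ∨ x j = 1) (h : Tendsto x atTop (𝓝 c)) :
    (c = 0 ∨ c = 1) ∧ ∀ᶠ j in atTop, x j = c := by
  have hc : c ∈ ({0, 1} : Set ℝ) :=
    (Set.toFinite _).isClosed.mem_of_tendsto h (Eventually.of_forall fun j => by simpa using hx j)
  have hc' : c = 0 ∨ c = 1 := by simpa using hc
  refine ⟨hc', ?_⟩
  filter_upwards [h (Metric.ball_mem_nhds c (show (0 : ℝ) < 1 / 2 by norm_num))] with j hj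
  rw [Set.mem_preimage, Metric.mem_ball, Real.dist_eq, abs_lt] at hj
  rcases hx j with h1 | h1 <;> rcases hc' with h2 | h2 <;> rw [h1, h2] at hj ⊢ <;> norm_num at hj

theorem graphBall_mono {V : Type*} (G : SimpleGraph V) (v : V) {r s : ℕ} (h : r ≤ s) :
    graphBall G v r ⊆ graphBall G v s := fun _ hu => le_trans hu h

theorem SimpleGraph.Connected.mem_graphBall_succ {V : Type*} {G : SimpleGraph V}
    (hG : G.Connected) {v x y : V} {r : ℕ} (hx : x ∈ graphBall G v r) (h : G.Adj x y) :
    y ∈ graphBall G v (r + 1) := by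
  have h1 := hG.dist_le_dist_add_one v h
  have h2 : G.dist x v ≤ r := hx
  rw [G.dist_comm] at h2
  show G.dist y v ≤ r + 1
  rw [G.dist_comm]
  omega

section InduceWalk

variable {V : Type*} {G : SimpleGraph V} {s : Set V} {u v : V}

theorem SimpleGraph.Walk.length_induce (c : G.Walk u v) (hs : ∀ x ∈ c.support, x ∈ s) :
    (c.induce s hs).length = c.length :=
  (SimpleGraph.Walk.length_map (SimpleGraph.Embedding.induce _).toHom _).symm.trans
    (congrArg SimpleGraph.Walk.length (SimpleGraph.Walk.map_induce c hs))

theorem SimpleGraph.Walk.IsCycle.induce {c : G.Walk u u} (hc : c.IsCycle)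
    (hs : ∀ x ∈ c.support, x ∈ s) : (c.induce s hs).IsCycle := by
  rw [← SimpleGraph.Walk.isCycle_map_iff_of_injective
    (f := (SimpleGraph.Embedding.induce s).toHom) Subtype.val_injective,
    SimpleGraph.Walk.map_induce]
  exact hc

end InduceWalk

/-! ### From convergence of matrices to isomorphism of balls -/

section CoherentEnum

variable {V V' : Type*} {G : SimpleGraph V} {G' : SimpleGraph V'}

theorem CoherentEnum.coherent_le {v : V} (η : CoherentEnum G v) {s r : ℕ} (hs : 1 ≤ s)
    (hsr : s ≤ r) (u : V) (hu : u ∈ graphBall G v s) (hu' : u ∈ graphBall G v r) :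
    (η.enum r ⟨u, hu'⟩ : ℕ) = η.enum s ⟨u, hu⟩ := by
  rcases hsr.eq_or_lt with rfl | h
  · rfl
  · exact η.coherent s r hs h u hu hu'

/-- Match vertices with the same number in the ball of radius `r`. By coherence the numbers do not
depend on the radius, so the same `f` serves all smaller balls. -/
theorem CoherentEnum.exists_bijOn {v : V} {o : V'} (η : CoherentEnum G v) (η' : CoherentEnum G' o)
    {r : ℕ} (hr : 1 ≤ r) (hcard : ∀ s, 1 ≤ s → s ≤ r → ballCard G v s = ballCard G' o s) :
    ∃ f : V' → V, (∀ s, 1 ≤ s → s ≤ r → Set.BijOn f (graphBall G' o s) (graphBall G v s)) ∧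
      ∀ x (hx : x ∈ graphBall G' o r), ∃ hfx : f x ∈ graphBall G v r,
        (η.enum r ⟨f x, hfx⟩ : ℕ) = η'.enum r ⟨x, hx⟩ := by
  classical
  set f : V' → V := fun x => if hx : x ∈ graphBall G' o r then
    ((η.enum r).symm (finCongr (hcard r hr le_rfl).symm (η'.enum r ⟨x, hx⟩))).1 else v with hf
  have hfr : ∀ x (hx : x ∈ graphBall G' o r), ∃ hfx : f x ∈ graphBall G v r,
      (η.enum r ⟨f x, hfx⟩ : ℕ) = η'.enum r ⟨x, hx⟩ := by
    intro x hx
    have h1 : f x = ((η.enum r).symm (finCongr (hcard r hr le_rfl).symm (η'.enum r ⟨x, hx⟩))).1 :=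
      dif_pos hx
    refine ⟨h1 ▸ Subtype.coe_prop _, ?_⟩
    simp [h1]
  have huniq : ∀ s, 1 ≤ s → s ≤ r → ∀ x (hx : x ∈ graphBall G' o s) u (hu : u ∈ graphBall G v s),
      (η.enum s ⟨u, hu⟩ : ℕ) = η'.enum s ⟨x, hx⟩ → f x = u := by
    intro s hs hsr x hx u hu h
    obtain ⟨hfx, h1⟩ := hfr x (graphBall_mono _ _ hsr hx)
    rw [η'.coherent_le hs hsr x hx, ← h,
      ← η.coherent_le hs hsr u hu (graphBall_mono _ _ hsr hu)] at h1
    exact congrArg Subtype.val ((η.enum r).injective (Fin.ext h1))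
  refine ⟨f, fun s hs hsr => ⟨?_, ?_, ?_⟩, hfr⟩
  · intro x hx
    set u := (η.enum s).symm (finCongr (hcard s hs hsr).symm (η'.enum s ⟨x, hx⟩)) with hu
    have h1 := huniq s hs hsr x hx u u.2 (by simp [hu])
    rw [h1]
    exact u.2
  · intro x hx y hy hxy
    obtain ⟨hfx, h1⟩ := hfr x (graphBall_mono _ _ hsr hx)
    obtain ⟨hfy, h2⟩ := hfr y (graphBall_mono _ _ hsr hy)
    have h3 : (η'.enum r ⟨x, graphBall_mono _ _ hsr hx⟩ : ℕ) =
        η'.enum r ⟨y, graphBall_mono _ _ hsr hy⟩ := by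
      rw [← h1, ← h2]
      simp only [hxy]
    exact congrArg Subtype.val ((η'.enum r).injective (Fin.ext h3))
  · intro u hu
    set x := (η'.enum s).symm (finCongr (hcard s hs hsr) (η.enum s ⟨u, hu⟩)) with hx
    exact ⟨x, x.2, huniq s hs hsr x x.2 u hu (by simp [hx])⟩

theorem adjacencyMatrix_entry (u w : V) :
    (adjacencyMatrix G).entry u w = open Classical in if G.Adj u w then 1 else 0 := by
  simp [JacobiMatrix.entry, adjacencyMatrix]

/-- An `R`-limit of an adjacency matrix is an adjacency matrix, and the graphs converge locally. -/
theorem locallyConverges_of_tendsto {w : ℕ → V} {o : V'}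
    {H' : JacobiMatrix G'} (η : ∀ j, CoherentEnum G (w j)) (η' : CoherentEnum G' o)
    (h : ∀ r, 1 ≤ r → (∀ᶠ j in atTop, ballCard G (w j) r = ballCard G' o r) ∧
      Tendsto (fun j => if h : ballCard G (w j) r = ballCard G' o r then
        Matrix.reindex (finCongr h) (finCongr h) ((η j).matrix (adjacencyMatrix G) r) else 0)
        atTop (𝓝 (η'.matrix H' r))) :
    H'.IsAdjacency ∧ LocallyConverges G w G' o := by
  classical
  have key : ∀ r, 1 ≤ r → ∀ᶠ j in atTop, ∃ f : V' → V,
      (∀ s, 1 ≤ s → s ≤ r → Set.BijOn f (graphBall G' o s) (graphBall G (w j) s)) ∧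
      ∀ x ∈ graphBall G' o r, ∀ y ∈ graphBall G' o r,
        H'.entry x y = (adjacencyMatrix G).entry (f x) (f y) := by
    intro r hr
    have hcard : ∀ᶠ j in atTop, ∀ s ∈ Finset.Icc 1 r, ballCard G (w j) s = ballCard G' o s :=
      (Finset.eventually_all _).2 fun s hs => (h s (Finset.mem_Icc.1 hs).1).1
    have hent : ∀ᶠ j in atTop, ∀ i l, (if h : ballCard G (w j) r = ballCard G' o r then
        Matrix.reindex (finCongr h) (finCongr h) ((η j).matrix (adjacencyMatrix G) r) else 0) i l
          = η'.matrix H' r i l := by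
      rw [eventually_all]
      intro i
      rw [eventually_all]
      intro l
      refine (eventually_eq_of_tendsto_of_eq_zero_or_one (fun j => ?_)
        (tendsto_pi_nhds.1 (tendsto_pi_nhds.1 (h r hr).2 i) l)).2
      split_ifs with hj
      · simp only [Matrix.reindex_apply, Matrix.submatrix_apply, CoherentEnum.matrix,
          Matrix.of_apply, adjacencyMatrix_entry]
        split_ifs <;> simp
      · left; rfl
    filter_upwards [hcard, hent] with j hj hj'
    obtain ⟨f, hf, hf'⟩ := (η j).exists_bijOn η' hr
      fun s hs hsr => hj s (Finset.mem_Icc.2 ⟨hs, hsr⟩)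
    refine ⟨f, hf, fun x hx y hy => ?_⟩
    have hc := hj r (Finset.mem_Icc.2 ⟨hr, le_rfl⟩)
    have h1 := hj' (η'.enum r ⟨x, hx⟩) (η'.enum r ⟨y, hy⟩)
    rw [dif_pos hc] at h1
    have h2 : ∀ z (hz : z ∈ graphBall G' o r),
        ((η j).enum r).symm ((finCongr hc).symm (η'.enum r ⟨z, hz⟩)) = f z := by
      intro z hz
      obtain ⟨hfz, h3⟩ := hf' z hz
      have h4 : (finCongr hc).symm (η'.enum r ⟨z, hz⟩) = (η j).enum r ⟨f z, hfz⟩ :=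
        Fin.ext (by simp [h3])
      rw [h4, Equiv.symm_apply_apply]
    simp only [Matrix.reindex_apply, Matrix.submatrix_apply, CoherentEnum.matrix,
      Matrix.of_apply, h2, Equiv.symm_apply_apply] at h1
    exact h1.symm
  have hball : ∀ x y, ∃ r, 1 ≤ r ∧ x ∈ graphBall G' o r ∧ y ∈ graphBall G' o r := fun x y =>
    ⟨1 + G'.dist x o + G'.dist y o, by omega, by simp only [graphBall, Set.mem_ofPred_eq]; omega,
      by simp only [graphBall, Set.mem_ofPred_eq]; omega⟩
  have hb : ∀ x, H'.b x = 0 := by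
    intro x
    obtain ⟨r, hr, hx, -⟩ := hball x x
    obtain ⟨j, f, -, hf⟩ := (key r hr).exists
    have h1 := hf x hx x hx
    rw [adjacencyMatrix_entry] at h1
    simpa [JacobiMatrix.entry, H'.a_eq_zero x x (G'.loopless.irrefl x)] using h1
  have ha : ∀ x y, H'.entry x y = H'.a x y := fun x y => by
    simp [JacobiMatrix.entry, hb]
  refine ⟨⟨fun x y hxy => ?_, hb⟩, fun r hr => ?_⟩
  · obtain ⟨r, hr, hx, hy⟩ := hball x y
    obtain ⟨j, f, -, hf⟩ := (key r hr).exists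
    have h1 := hf x hx y hy
    -- The weight equals a matrix entry `0` or `1`, and it is positive on an edge.
    have h2 := H'.a_pos x y hxy
    rw [ha, adjacencyMatrix_entry] at h1
    rw [h1] at h2 ⊢
    split_ifs at h2 ⊢
    · rfl
    · exact absurd h2 (lt_irrefl _)
  · filter_upwards [key r hr] with j ⟨f, hf, hf'⟩
    refine ⟨f, hf, fun x hx y hy => ?_⟩
    have h1 := hf' x hx y hy
    rw [ha, adjacencyMatrix_entry] at h1
    constructor
    · intro hxy
      by_contra hn
      have h2 := H'.a_pos x y hxy
      rw [h1, if_neg hn] at h2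
      exact lt_irrefl _ h2
    · intro hxy
      by_contra hn
      rw [H'.a_eq_zero x y hn, if_pos hxy] at h1
      exact zero_ne_one h1

end CoherentEnum

section LocallyConverges

variable {V V' : Type*} {G : SimpleGraph V} {G' : SimpleGraph V'} {w : ℕ → V} {o : V'}

/-- The ball of radius `r + 1` contains all neighbours of the vertices of the ball of radius `r`. -/
theorem LocallyConverges.eventually_bijOn_neighborSet (h : LocallyConverges G w G' o)
    (hG : G.Connected) (hG' : G'.Connected) {r : ℕ} (hr : 1 ≤ r) :
    ∀ᶠ j in atTop, ∃ f : V' → V, Set.BijOn f (graphBall G' o r) (graphBall G (w j) r) ∧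
      (∀ x ∈ graphBall G' o r, ∀ y ∈ graphBall G' o r, (G'.Adj x y ↔ G.Adj (f x) (f y))) ∧
      ∀ x ∈ graphBall G' o r, Set.BijOn f (G'.neighborSet x) (G.neighborSet (f x)) := by
  filter_upwards [h (r + 1) (by omega)] with j ⟨f, hf, hf'⟩
  have h1 := hf r hr (by omega)
  have h2 := hf (r + 1) (by omega) le_rfl
  have hmem : ∀ x ∈ graphBall G' o r, x ∈ graphBall G' o (r + 1) :=
    fun x hx => graphBall_mono _ _ (by omega) hx
  refine ⟨f, h1, fun x hx y hy => hf' x (hmem x hx) y (hmem y hy), fun x hx => ?_⟩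
  have hsub : G'.neighborSet x ⊆ graphBall G' o (r + 1) :=
    fun y hy => hG'.mem_graphBall_succ hx hy
  refine ⟨fun y hy => ?_, h2.injOn.mono hsub, fun u hu => ?_⟩
  · exact (hf' x (hmem x hx) y (hsub hy)).1 hy
  · obtain ⟨y, hy, rfl⟩ := h2.surjOn (hG.mem_graphBall_succ (h1.mapsTo hx) hu)
    exact ⟨y, (hf' x (hmem x hx) y hy).2 hu, rfl⟩

theorem exists_mem_graphBall (G' : SimpleGraph V') (o : V') (s : Finset V') :
    ∃ r, 1 ≤ r ∧ ∀ x ∈ s, x ∈ graphBall G' o r :=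
  ⟨1 + s.sup fun x => G'.dist x o, by omega, fun x hx =>
    (Finset.le_sup (f := fun x => G'.dist x o) hx).trans (by omega)⟩

theorem LocallyConverges.encard_neighborSet_le (h : LocallyConverges G w G' o)
    (hG : G.Connected) (hG' : G'.Connected) {D : ℕ} (hD : ∀ v, (G.neighborSet v).encard ≤ D)
    (x : V') : (G'.neighborSet x).encard ≤ D := by
  obtain ⟨r, hr, hx⟩ := exists_mem_graphBall G' o {x}
  obtain ⟨j, f, -, -, hN⟩ := (h.eventually_bijOn_neighborSet hG hG' hr).exists
  have h1 := hN x (hx x (by simp))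
  rw [← h1.injOn.encard_image, h1.image_eq]
  exact hD _

/-- A cycle in a local limit is found in the balls about the points `w j`. -/
theorem LocallyConverges.exists_isCycle (h : LocallyConverges G w G' o) {x : V'}
    {c : G'.Walk x x} (hc : c.IsCycle) : ∃ r, ∀ᶠ j in atTop, ∃ u ∈ graphBall G (w j) r,
      ∃ c' : G.Walk u u, c'.IsCycle ∧ c'.length = c.length := by
  classical
  obtain ⟨r, hr, hx⟩ := exists_mem_graphBall G' o c.support.toFinset
  refine ⟨r, ?_⟩
  filter_upwards [h r hr] with j ⟨f, hf, hf'⟩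
  have hsupp : ∀ y ∈ c.support, y ∈ graphBall G' o r := fun y hy => hx y (by simpa using hy)
  have hmap := hf r hr le_rfl
  set φ : G'.induce (graphBall G' o r) →g G :=
    ⟨fun y => f y, fun {y z} hyz => (hf' y y.2 z z.2).1 hyz⟩ with hφ
  have hφinj : Function.Injective φ := fun y z hyz => Subtype.ext (hmap.injOn y.2 z.2 hyz)
  refine ⟨_, hmap.mapsTo (hsupp x c.start_mem_support), (c.induce _ hsupp).map φ,
    (hc.induce hsupp).map hφinj, ?_⟩
  rw [SimpleGraph.Walk.length_map, SimpleGraph.Walk.length_induce]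

end LocallyConverges

/-! ### The half-line with edges replaced by finite graphs -/

namespace ReplaceEdges

variable {W : ℕ → Type*} {Γ : ∀ i, SimpleGraph (W i)} {p q : ∀ i, W i} {k : ℕ → ℕ}

/-- The level of a vertex: `2 n` for the vertex `n` of the half-line, and `2 k i + 1` for the
vertices of the graph `Γ i`. -/
def level (k : ℕ → ℕ) : (ℕ ⊕ Σ i, W i) → ℕ
  | Sum.inl n => 2 * n
  | Sum.inr s => 2 * k s.1 + 1

@[simp] theorem level_inl (n : ℕ) : level (W := W) k (Sum.inl n) = 2 * n := rfl

@[simp] theorem level_inr (s : Σ i, W i) : level k (Sum.inr s) = 2 * k s.1 + 1 := rfl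

theorem _root_.ReplacedEdge.level_le {x y : ℕ ⊕ Σ i, W i} (h : ReplacedEdge Γ p q k x y) :
    level k x ≤ level k y ∧ level k y ≤ level k x + 2 := by
  cases h <;> simp <;> omega

theorem _root_.ReplacedEdge.ne {x y : ℕ ⊕ Σ i, W i} (h : ReplacedEdge Γ p q k x y) : x ≠ y := by
  cases h with
  | line n hn => simp
  | inner i x y h => simpa using h.ne
  | left i => simp
  | right i => simp

theorem adj_iff {x y : ℕ ⊕ Σ i, W i} : (replaceEdges Γ p q k).Adj x y ↔
    ReplacedEdge Γ p q k x y ∨ ReplacedEdge Γ p q k y x := by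
  rw [replaceEdges, SimpleGraph.fromRel_adj]
  constructor
  · exact fun h => h.2
  · rintro (h | h)
    · exact ⟨h.ne, Or.inl h⟩
    · exact ⟨h.ne.symm, Or.inr h⟩

theorem replacedEdge_of_adj {x y : ℕ ⊕ Σ i, W i} (h : (replaceEdges Γ p q k).Adj x y)
    (hxy : level k x < level k y) : ReplacedEdge Γ p q k x y := by
  rcases adj_iff.1 h with h | h
  · exact h
  · have := h.level_le
    omega

theorem level_le_of_adj {x y : ℕ ⊕ Σ i, W i} (h : (replaceEdges Γ p q k).Adj x y) :
    level k y ≤ level k x + 2 := by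
  rcases adj_iff.1 h with h | h
  · exact h.level_le.2
  · have := h.level_le.1
    omega

/-- Only one edge crosses each level. -/
theorem _root_.ReplacedEdge.eq_of_crossing (hk : StrictMono k) {m : ℕ} {x y x' y' : ℕ ⊕ Σ i, W i}
    (h : ReplacedEdge Γ p q k x y) (h' : ReplacedEdge Γ p q k x' y')
    (hx : level k x ≤ m) (hy : m < level k y) (hx' : level k x' ≤ m) (hy' : m < level k y') :
    x = x' ∧ y = y' := by
  cases h with
  | inner i a b hab => simp at hx hy; omega
  | line n hn =>
    cases h' with
    | inner i a b hab => simp at hx' hy'; omega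
    | line n' hn' =>
      simp at hx hy hx' hy'
      obtain rfl : n = n' := by omega
      exact ⟨rfl, rfl⟩
    | left i => simp at hx hy hx' hy'; exact absurd (by omega) (hn i)
    | right i => simp at hx hy hx' hy'; exact absurd (by omega) (hn i)
  | left i =>
    cases h' with
    | inner i a b hab => simp at hx' hy'; omega
    | line n' hn' => simp at hx hy hx' hy'; exact absurd (by omega) (hn' i)
    | left j =>
      simp at hx hy hx' hy'
      obtain rfl : i = j := hk.injective (by omega)
      exact ⟨rfl, rfl⟩
    | right j => simp at hx hy hx' hy'; omega
  | right i =>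
    cases h' with
    | inner i a b hab => simp at hx' hy'; omega
    | line n' hn' => simp at hx hy hx' hy'; exact absurd (by omega) (hn' i)
    | left j => simp at hx hy hx' hy'; omega
    | right j =>
      simp at hx hy hx' hy'
      obtain rfl : i = j := hk.injective (by omega)
      exact ⟨rfl, rfl⟩

theorem eq_of_crossing (hk : StrictMono k) {m : ℕ} {x y x' y' : ℕ ⊕ Σ i, W i}
    (h : (replaceEdges Γ p q k).Adj x y) (h' : (replaceEdges Γ p q k).Adj x' y')
    (hx : level k x ≤ m) (hy : m < level k y) (hx' : level k x' ≤ m) (hy' : m < level k y') :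
    x = x' ∧ y = y' :=
  (replacedEdge_of_adj h (by omega)).eq_of_crossing hk (replacedEdge_of_adj h' (by omega))
    hx hy hx' hy'

theorem adj_inr_inr {i : ℕ} {x y : W i} :
    (replaceEdges Γ p q k).Adj (Sum.inr ⟨i, x⟩) (Sum.inr ⟨i, y⟩) ↔ (Γ i).Adj x y := by
  rw [adj_iff]
  constructor
  · rintro (h | h)
    · cases h; assumption
    · cases h; exact SimpleGraph.Adj.symm ‹_›
  · exact fun h => Or.inl (.inner i x y h)

theorem fst_eq_of_adj {s t : Σ i, W i} (h : (replaceEdges Γ p q k).Adj (Sum.inr s) (Sum.inr t)) :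
    s.1 = t.1 := by
  rcases adj_iff.1 h with h | h <;> cases h <;> rfl

theorem adj_inl_inr {n i : ℕ} {x : W i} : (replaceEdges Γ p q k).Adj (Sum.inl n) (Sum.inr ⟨i, x⟩) ↔
    (n = k i ∧ x = p i) ∨ (n = k i + 1 ∧ x = q i) := by
  rw [adj_iff]
  constructor
  · rintro (h | h) <;> cases h
    · exact Or.inl ⟨rfl, rfl⟩
    · exact Or.inr ⟨rfl, rfl⟩
  · rintro (⟨rfl, rfl⟩ | ⟨rfl, rfl⟩)
    · exact Or.inl (.left i)
    · exact Or.inr (.right i)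

theorem level_ne_of_adj_inl {n : ℕ} {y : ℕ ⊕ Σ i, W i}
    (h : (replaceEdges Γ p q k).Adj (Sum.inl n) y) : level k y ≠ 2 * n := by
  rcases y with m | s
  · have := h.ne
    simp at this ⊢
    omega
  · simp; omega

/-! #### Neighbourhoods -/

theorem neighborSet_inr_inter (i : ℕ) (x : W i) :
    (replaceEdges Γ p q k).neighborSet (Sum.inr ⟨i, x⟩) ∩ (Set.range Sum.inl)ᶜ =
      (fun y => Sum.inr ⟨i, y⟩) '' (Γ i).neighborSet x := by
  ext y
  simp only [Set.mem_inter_iff, SimpleGraph.mem_neighborSet, Set.mem_compl_iff, Set.mem_image]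
  constructor
  · rintro ⟨h, hy⟩
    rcases y with n | ⟨j, y⟩
    · exact absurd ⟨n, rfl⟩ hy
    · obtain rfl : i = j := fst_eq_of_adj h
      exact ⟨y, adj_inr_inr.1 h, rfl⟩
  · rintro ⟨y, hy, rfl⟩
    exact ⟨adj_inr_inr.2 hy, by simp⟩

theorem encard_neighborSet_inr_inter {d : ℕ} (hreg : ∀ i, IsRegularGraph (Γ i) d) (s : Σ i, W i) :
    ((replaceEdges Γ p q k).neighborSet (Sum.inr s) ∩ (Set.range Sum.inl)ᶜ).encard = d := by
  obtain ⟨i, x⟩ := s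
  rw [neighborSet_inr_inter, Function.Injective.encard_image, hreg i x]
  intro y z h
  simpa using h

theorem encard_neighborSet_inr_le {d : ℕ} (hreg : ∀ i, IsRegularGraph (Γ i) d) (s : Σ i, W i) :
    ((replaceEdges Γ p q k).neighborSet (Sum.inr s)).encard ≤ d + 2 := by
  have h1 : (replaceEdges Γ p q k).neighborSet (Sum.inr s) ⊆
      ((replaceEdges Γ p q k).neighborSet (Sum.inr s) ∩ (Set.range Sum.inl)ᶜ) ∪
        {Sum.inl (k s.1), Sum.inl (k s.1 + 1)} := by
    intro y hy
    rcases y with n | t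
    · right
      obtain ⟨i, x⟩ := s
      rcases adj_inl_inr.1 (SimpleGraph.Adj.symm hy) with h | h <;> simp [h.1]
    · exact Or.inl ⟨hy, by simp⟩
  refine (Set.encard_le_encard h1).trans ((Set.encard_union_le _ _).trans ?_)
  rw [encard_neighborSet_inr_inter hreg]
  gcongr
  exact (Set.encard_insert_le _ _).trans (by rw [Set.encard_singleton]; norm_num)

theorem exists_adj_above (n : ℕ) :
    ∃ y, (replaceEdges Γ p q k).Adj (Sum.inl n) y ∧ 2 * n < level k y := by
  by_cases h : ∃ i, n = k i
  · obtain ⟨i, rfl⟩ := h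
    exact ⟨_, adj_iff.2 (Or.inl (.left i)), by simp⟩
  · push Not at h
    exact ⟨_, adj_iff.2 (Or.inl (.line n h)), by simp⟩

theorem exists_adj_below (n : ℕ) :
    ∃ y, (replaceEdges Γ p q k).Adj (Sum.inl (n + 1)) y ∧ level k y ≤ 2 * n + 1 := by
  by_cases h : ∃ i, n = k i
  · obtain ⟨i, rfl⟩ := h
    exact ⟨_, adj_iff.2 (Or.inr (.right i)), by simp⟩
  · push Not at h
    exact ⟨_, adj_iff.2 (Or.inr (.line n h)), by simp⟩

/-- One edge leads up and one leads down, and a second one would cross the same level. -/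
theorem encard_neighborSet_inl (hk : StrictMono k) (n : ℕ) :
    ((replaceEdges Γ p q k).neighborSet (Sum.inl (n + 1))).encard = 2 := by
  obtain ⟨y, hy, hyl⟩ := exists_adj_above (Γ := Γ) (p := p) (q := q) (k := k) (n + 1)
  obtain ⟨z, hz, hzl⟩ := exists_adj_below (Γ := Γ) (p := p) (q := q) (k := k) n
  rw [Set.encard_eq_two]
  refine ⟨y, z, by rintro rfl; omega, Set.ext fun x => ?_⟩
  simp only [SimpleGraph.mem_neighborSet, Set.mem_insert_iff, Set.mem_singleton_iff]
  constructor
  · intro hx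
    have h1 := level_ne_of_adj_inl hx
    rcases lt_or_gt_of_ne h1 with h | h
    · exact Or.inr (eq_of_crossing (m := 2 * n + 1) hk hx.symm hz.symm (by omega) (by simp; omega)
        hzl (by simp; omega)).1
    · exact Or.inl (eq_of_crossing (m := 2 * (n + 1)) hk hx hy (by simp) h (by simp) hyl).2
  · rintro (rfl | rfl) <;> assumption

theorem encard_neighborSet_inl_zero_le (hk : StrictMono k) :
    ((replaceEdges Γ p q k).neighborSet (Sum.inl 0)).encard ≤ 2 := by
  refine le_trans (Set.encard_le_one_iff.2 fun y z hy hz => ?_) one_le_two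
  have h1 := level_ne_of_adj_inl hy
  have h2 := level_ne_of_adj_inl hz
  exact (eq_of_crossing (m := 0) hk hy hz (by simp) (by omega) (by simp) (by omega)).2

theorem encard_neighborSet_le (hk : StrictMono k) {d : ℕ} (hreg : ∀ i, IsRegularGraph (Γ i) d)
    (v : ℕ ⊕ Σ i, W i) : ((replaceEdges Γ p q k).neighborSet v).encard ≤ (d + 2 : ℕ) := by
  rcases v with (_ | n) | s
  · refine (encard_neighborSet_inl_zero_le hk).trans ?_
    push_cast
    exact le_add_self
  · rw [encard_neighborSet_inl hk]
    push_cast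
    exact le_add_self
  · exact_mod_cast encard_neighborSet_inr_le hreg s

theorem boundedDegree (hk : StrictMono k) {d : ℕ} (hreg : ∀ i, IsRegularGraph (Γ i) d) :
    BoundedDegree (replaceEdges Γ p q k) :=
  ⟨d + 2, encard_neighborSet_le hk hreg⟩

/-! #### Connectedness and distances -/

theorem reachable_inr (hc : ∀ i, (Γ i).Connected) (i : ℕ) (x y : W i) :
    (replaceEdges Γ p q k).Reachable (Sum.inr ⟨i, x⟩) (Sum.inr ⟨i, y⟩) :=
  (hc i x y).map
    (⟨fun x => Sum.inr ⟨i, x⟩, fun h => adj_inr_inr.2 h⟩ : Γ i →g replaceEdges Γ p q k)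

theorem connected (hc : ∀ i, (Γ i).Connected) : (replaceEdges Γ p q k).Connected := by
  have hline : ∀ n, (replaceEdges Γ p q k).Reachable (Sum.inl 0) (Sum.inl n) := by
    intro n
    induction n with
    | zero => rfl
    | succ n ih =>
      refine ih.trans ?_
      by_cases h : ∃ i, n = k i
      · obtain ⟨i, rfl⟩ := h
        exact (adj_iff.2 (Or.inl (.left i))).reachable.trans ((reachable_inr hc i _ _).trans
          (adj_iff.2 (Or.inl (.right i))).reachable)
      · push Not at h
        exact (adj_iff.2 (Or.inl (.line n h))).reachable
  have hall : ∀ v, (replaceEdges Γ p q k).Reachable (Sum.inl 0) v := by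
    rintro (n | ⟨i, x⟩)
    · exact hline n
    · exact (hline (k i)).trans ((adj_iff.2 (Or.inl (.left i))).reachable.trans
        (reachable_inr hc i _ _))
  have : Nonempty (ℕ ⊕ Σ i, W i) := ⟨Sum.inl 0⟩
  exact ⟨fun u v => (hall u).symm.trans (hall v)⟩

/-- Each edge raises the level by at most two, so a ball reaches only a bounded range of levels. -/
theorem level_le_add_dist (hc : ∀ i, (Γ i).Connected) (u v : ℕ ⊕ Σ i, W i) :
    level k v ≤ level k u + 2 * (replaceEdges Γ p q k).dist u v := by
  obtain ⟨w, hw⟩ := (connected (p := p) (q := q) (k := k) hc).exists_walk_length_eq_dist u v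
  rw [← hw]
  clear hw
  induction w with
  | nil => simp
  | cons h w ih =>
    have := level_le_of_adj h
    rw [SimpleGraph.Walk.length_cons]
    omega

/-- The retraction onto `Γ i`. -/
def retract (p q : ∀ i, W i) (k : ℕ → ℕ) (i : ℕ) : (ℕ ⊕ Σ i, W i) → W i
  | Sum.inl n => if n ≤ k i then p i else q i
  | Sum.inr s => if h : s.1 = i then h ▸ s.2 else if s.1 < i then p i else q i

@[simp] theorem retract_inr_self (i : ℕ) (x : W i) : retract p q k i (Sum.inr ⟨i, x⟩) = x := by
  simp [retract]

theorem _root_.ReplacedEdge.retract (hk : StrictMono k) (i : ℕ) {x y : ℕ ⊕ Σ i, W i}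
    (h : ReplacedEdge Γ p q k x y) : retract p q k i x = retract p q k i y ∨
      (Γ i).Adj (retract p q k i x) (retract p q k i y) := by
  cases h with
  | line n hn =>
    left
    have := hn i
    simp only [ReplaceEdges.retract]
    congr 1
    exact propext ⟨fun h => by omega, fun h => by omega⟩
  | inner j x y h =>
    by_cases hj : j = i
    · subst hj
      right
      simpa using h
    · left
      simp [ReplaceEdges.retract, hj]
  | left j =>
    left
    rcases lt_trichotomy j i with hj | rfl | hj
    · simp [ReplaceEdges.retract, hj, hj.ne, (hk hj).le]
    · simp [ReplaceEdges.retract]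
    · simp [ReplaceEdges.retract, hj.ne', hj.not_gt, (hk hj).not_ge]
  | right j =>
    left
    rcases lt_trichotomy j i with hj | rfl | hj
    · have := hk hj
      simp [ReplaceEdges.retract, hj, hj.ne, Nat.succ_le_of_lt this]
    · simp [ReplaceEdges.retract]
    · have := hk hj
      simp [ReplaceEdges.retract, hj.ne', hj.not_gt, show ¬ k j + 1 ≤ k i by omega]

/-- What comes before `Γ i` is collapsed to `p i` and what comes after it to `q i`, so detours
outside `Γ i` offer no shortcut. -/
theorem dist_retract_le (hc : ∀ i, (Γ i).Connected) (hk : StrictMono k) (i : ℕ)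
    (u v : ℕ ⊕ Σ i, W i) :
    (Γ i).dist (retract p q k i u) (retract p q k i v) ≤ (replaceEdges Γ p q k).dist u v := by
  refine (connected hc).dist_map_le (fun x y h => ?_) u v
  rcases adj_iff.1 h with h | h
  · exact h.retract hk i
  · exact (h.retract hk i).imp Eq.symm SimpleGraph.Adj.symm

/-- Edges between the half-line and the graphs `Γ i` are far apart. -/
theorem exists_mixed_unique (hc : ∀ i, (Γ i).Connected) (hk : StrictMono k)
    (hpq : Tendsto (fun i => (Γ i).dist (p i) (q i)) atTop atTop)
    (hkk : Tendsto (fun i => k (i + 1) - k i) atTop atTop) (R : ℕ) :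
    ∃ N, ∀ (n n' : ℕ) (s s' : Σ i, W i), (replaceEdges Γ p q k).Adj (Sum.inl n) (Sum.inr s) →
      (replaceEdges Γ p q k).Adj (Sum.inl n') (Sum.inr s') → N ≤ n → N ≤ n' →
      (replaceEdges Γ p q k).dist (Sum.inl n) (Sum.inl n') ≤ R → n = n' ∧ s = s' := by
  obtain ⟨I, hI⟩ := eventually_atTop.1
    ((hpq.eventually_gt_atTop R).and (hkk.eventually_gt_atTop (R + 1)))
  -- Different blocks are separated by a gap larger than `R + 1`, where the extra `1` allows for `n
  -- = k i + 1`.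
  have key : ∀ (i i' n n' : ℕ), (n = k i ∨ n = k i + 1) → (n' = k i' ∨ n' = k i' + 1) →
      k I + 2 ≤ n → (replaceEdges Γ p q k).dist (Sum.inl n) (Sum.inl n') ≤ R → ¬ i < i' := by
    intro i i' n n' hn hn' hN hR hlt
    have h1 : I ≤ i := by
      have : k I < k i := by omega
      exact (hk.lt_iff_lt.1 this).le
    have h2 := (hI i h1).2
    have h3 : k (i + 1) ≤ k i' := hk.monotone hlt
    have h4 := level_le_add_dist (p := p) (q := q) (k := k) hc (Sum.inl n) (Sum.inl n')
    simp only [level_inl] at h4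
    omega
  -- The two attaching vertices of one block retract to `p i` and `q i`, which are more than `R`
  -- apart.
  have key2 : ∀ i, k I + 2 ≤ k i + 1 →
      ¬ (replaceEdges Γ p q k).dist (Sum.inl (k i)) (Sum.inl (k i + 1)) ≤ R := by
    intro i hi h
    have h1 : I ≤ i := by
      have : k I < k i := by omega
      exact (hk.lt_iff_lt.1 this).le
    have h2 := (hI i h1).1
    have h3 := dist_retract_le (p := p) (q := q) hc hk i (Sum.inl (k i)) (Sum.inl (k i + 1))
    simp [retract] at h3
    omega
  -- As `n ≤ k i + 1`, this threshold forces `k I < k i`.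
  refine ⟨k I + 2, ?_⟩
  rintro n n' ⟨i, x⟩ ⟨i', x'⟩ h h' hn hn' hR
  rw [adj_inl_inr] at h h'
  have hR' := hR
  rw [SimpleGraph.dist_comm] at hR'
  have h1 := key i i' n n' (by omega) (by omega) hn hR
  have h2 := key i' i n' n (by omega) (by omega) hn' hR'
  obtain rfl : i = i' := by omega
  rcases h with ⟨rfl, rfl⟩ | ⟨rfl, rfl⟩ <;> rcases h' with ⟨rfl, rfl⟩ | ⟨rfl, rfl⟩
  · exact ⟨rfl, rfl⟩
  · exact absurd hR (key2 i (by omega))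
  · exact absurd hR' (key2 i (by omega))
  · exact ⟨rfl, rfl⟩

/-! #### Cycles -/

/-- Once the only edge crossing the level of `x` is deleted, no edge leaves the set of vertices of
at most that level. Hence a cycle never changes level. -/
theorem isBridge_of_level_lt (hk : StrictMono k) {x y : ℕ ⊕ Σ i, W i}
    (h : (replaceEdges Γ p q k).Adj x y) (hlt : level k x < level k y) :
    (replaceEdges Γ p q k).IsBridge s(x, y) := by
  rw [SimpleGraph.isBridge_iff]
  intro hr
  have hcross : ∀ u v, ((replaceEdges Γ p q k).deleteEdges {s(x, y)}).Adj u v →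
      u ∈ {z | level k z ≤ level k x} → v ∈ {z | level k z ≤ level k x} := by
    intro u v huv hu
    rw [SimpleGraph.deleteEdges_adj] at huv
    by_contra hv
    have h1 : level k u ≤ level k x := hu
    have h2 : ¬ level k v ≤ level k x := hv
    obtain ⟨rfl, rfl⟩ := eq_of_crossing hk h huv.1 le_rfl hlt h1 (by omega)
    exact huv.2 rfl
  have h1 : level k x ≤ level k x ↔ level k y ≤ level k x := hr.mem_iff_of_no_boundary hcross
  omega

theorem level_eq_of_mem_support {x y : ℕ ⊕ Σ i, W i} (w : (replaceEdges Γ p q k).Walk x y)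
    (hw : ∀ u v, s(u, v) ∈ w.edges → level k u = level k v) :
    ∀ z ∈ w.support, level k z = level k x := by
  induction w with
  | nil => simp
  | @cons x z y h w ih =>
    intro u hu
    rw [SimpleGraph.Walk.support_cons, List.mem_cons] at hu
    have h1 := hw x z (by simp)
    rcases hu with rfl | hu
    · rfl
    · rw [h1]
      exact ih (fun a b hab => hw a b (by simp [hab])) u hu

/-- Every cycle lies in one of the graphs `Γ i`. -/
theorem exists_girth_le (hk : StrictMono k) {u : ℕ ⊕ Σ i, W i}
    {c : (replaceEdges Γ p q k).Walk u u} (hc : c.IsCycle) :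
    ∃ i, level k u = 2 * k i + 1 ∧ (Γ i).girth ≤ c.length := by
  have hedge : ∀ x y, s(x, y) ∈ c.edges → level k x = level k y := by
    have hle : ∀ x y, s(x, y) ∈ c.edges → ¬ level k x < level k y := by
      intro x y hxy hlt
      have hadj := c.adj_of_mem_edges hxy
      exact (SimpleGraph.isBridge_iff_forall_cycle_notMem hadj).1
        (isBridge_of_level_lt hk hadj hlt) c hc hxy
    intro x y hxy
    have h1 := hle x y hxy
    have h2 := hle y x (by rwa [Sym2.eq_swap])
    omega
  have hsupp := level_eq_of_mem_support c hedge
  rcases u with n | ⟨i, x⟩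
  -- A vertex of the half-line has no neighbour on its own level.
  · exfalso
    have h1 := c.adj_snd hc.not_nil
    exact level_ne_of_adj_inl h1 (hsupp _ (c.getVert_mem_support 1))
  · refine ⟨i, rfl, ?_⟩
    set S : Set (ℕ ⊕ Σ i, W i) := {z | level k z = 2 * k i + 1} with hS
    have hSmem : ∀ z ∈ S, ∃ y : W i, z = Sum.inr ⟨i, y⟩ := by
      rintro (n | ⟨j, y⟩) hz
      · simp [hS] at hz; omega
      · have h1 : k j = k i := by simpa [hS] using hz
        obtain rfl := hk.injective h1
        exact ⟨y, rfl⟩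
    set φ : (replaceEdges Γ p q k).induce S →g Γ i := ⟨fun z => retract p q k i z, by
      rintro ⟨z, hz⟩ ⟨z', hz'⟩ hzz
      obtain ⟨y, rfl⟩ := hSmem z hz
      obtain ⟨y', rfl⟩ := hSmem z' hz'
      simpa using adj_inr_inr.1 hzz⟩ with hφ
    have hφinj : Function.Injective φ := by
      rintro ⟨z, hz⟩ ⟨z', hz'⟩ hzz
      obtain ⟨y, rfl⟩ := hSmem z hz
      obtain ⟨y', rfl⟩ := hSmem z' hz'
      have : y = y' := by simpa [hφ] using hzz
      rw [Subtype.mk.injEq, this]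
    have hsupp' : ∀ z ∈ c.support, z ∈ S := hsupp
    have h3 := SimpleGraph.girth_le_length ((hc.induce hsupp').map hφinj)
    rwa [SimpleGraph.Walk.length_map, SimpleGraph.Walk.length_induce] at h3

end ReplaceEdges

namespace ReplaceEdges

variable {W : ℕ → Type*} {Γ : ∀ i, SimpleGraph (W i)} {p q : ∀ i, W i} {k : ℕ → ℕ}

/-! #### The essential spectrum -/

/-- The vertices of `Γ i`. -/
def block (W : ℕ → Type*) [∀ i, Finite (W i)] (i : ℕ) : Finset (ℕ ⊕ Σ i, W i) :=
  (Set.toFinite (Set.range fun x : W i => (Sum.inr ⟨i, x⟩ : ℕ ⊕ Σ i, W i))).toFinset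

theorem mem_block [∀ i, Finite (W i)] {i : ℕ} {v : ℕ ⊕ Σ i, W i} :
    v ∈ block W i ↔ ∃ x : W i, Sum.inr ⟨i, x⟩ = v := by
  simp [block]

theorem card_block [∀ i, Finite (W i)] (i : ℕ) : (block W i).card = Nat.card (W i) := by
  have h1 : Function.Injective (fun x : W i => (Sum.inr ⟨i, x⟩ : ℕ ⊕ Σ i, W i)) := by
    intro y z h
    simpa using h
  rw [← Nat.card_range_of_injective h1, block, Nat.card_coe_set_eq]
  exact (Set.ncard_eq_toFinset_card _ _).symm

open Classical in
-- This number is the value at `v` of the adjacency operator applied to the indicator function of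
-- the block. Regularity gives `d` inside; outside, only the two attaching vertices have a neighbour
-- in the block, one each.
theorem card_nbrs_inter_block [∀ i, Finite (W i)] {d : ℕ}
    (hreg : ∀ i, IsRegularGraph (Γ i) d) (hG : BoundedDegree (replaceEdges Γ p q k)) (i : ℕ)
    (v : ℕ ⊕ Σ i, W i) : ((hG.nbrs v).filter (· ∈ block W i)).card =
      d * (if v ∈ block W i then 1 else 0) + ((if v = Sum.inl (k i) then 1 else 0) +
        (if v = Sum.inl (k i + 1) then 1 else 0)) := by
  rcases v with n | ⟨j, x⟩
  · have hb : ¬ (Sum.inl n : ℕ ⊕ Σ i, W i) ∈ block W i := by simp [mem_block]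
    rw [if_neg hb]
    by_cases h1 : n = k i
    · subst h1
      have : (hG.nbrs (Sum.inl (k i))).filter (· ∈ block W i) = {Sum.inr ⟨i, p i⟩} := by
        ext u
        rw [Finset.mem_filter, hG.mem_nbrs, Finset.mem_singleton, mem_block]
        constructor
        · rintro ⟨h, y, rfl⟩
          rw [adj_inl_inr] at h
          obtain ⟨-, rfl⟩ | ⟨h, -⟩ := h
          · rfl
          · omega
        · rintro rfl
          exact ⟨adj_inl_inr.2 (Or.inl ⟨rfl, rfl⟩), _, rfl⟩
      rw [this]
      simp
    · by_cases h2 : n = k i + 1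
      · subst h2
        have : (hG.nbrs (Sum.inl (k i + 1))).filter (· ∈ block W i) = {Sum.inr ⟨i, q i⟩} := by
          ext u
          rw [Finset.mem_filter, hG.mem_nbrs, Finset.mem_singleton, mem_block]
          constructor
          · rintro ⟨h, y, rfl⟩
            rw [adj_inl_inr] at h
            obtain ⟨h, -⟩ | ⟨-, rfl⟩ := h
            · omega
            · rfl
          · rintro rfl
            exact ⟨adj_inl_inr.2 (Or.inr ⟨rfl, rfl⟩), _, rfl⟩
        rw [this]
        simp
      · have : (hG.nbrs (Sum.inl n)).filter (· ∈ block W i) = ∅ := by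
          ext u
          rw [Finset.mem_filter, hG.mem_nbrs, mem_block]
          simp only [Finset.notMem_empty, iff_false]
          rintro ⟨h, y, rfl⟩
          rw [adj_inl_inr] at h
          omega
        rw [this]
        simp [h1, h2]
  · by_cases hj : j = i
    · subst hj
      have h1 : (((hG.nbrs (Sum.inr ⟨j, x⟩)).filter (· ∈ block W j) : Finset _) : Set _) =
          (replaceEdges Γ p q k).neighborSet (Sum.inr ⟨j, x⟩) ∩ (Set.range Sum.inl)ᶜ := by
        ext u
        rw [Finset.mem_coe, Finset.mem_filter, hG.mem_nbrs, mem_block]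
        constructor
        · rintro ⟨h, y, rfl⟩
          exact ⟨h, by simp⟩
        · rintro ⟨h, hu⟩
          refine ⟨h, ?_⟩
          rw [← mem_block]
          have h2 : u ∈ (fun y => (Sum.inr ⟨j, y⟩ : ℕ ⊕ Σ i, W i)) '' (Γ j).neighborSet x := by
            rw [← neighborSet_inr_inter (Γ := Γ) (p := p) (q := q) (k := k)]
            exact ⟨h, hu⟩
          obtain ⟨y, -, rfl⟩ := h2
          exact mem_block.2 ⟨y, rfl⟩
      have h2 := encard_neighborSet_inr_inter (p := p) (q := q) (k := k) hreg ⟨j, x⟩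
      rw [← h1, Set.encard_coe_eq_coe_finsetCard] at h2
      have h3 : (Sum.inr ⟨j, x⟩ : ℕ ⊕ Σ i, W i) ∈ block W j := mem_block.2 ⟨x, rfl⟩
      rw [if_pos h3]
      simpa using h2
    · have hb : ¬ (Sum.inr ⟨j, x⟩ : ℕ ⊕ Σ i, W i) ∈ block W i := by
        rw [mem_block]
        rintro ⟨y, hy⟩
        simp only [Sum.inr.injEq, Sigma.mk.injEq] at hy
        exact hj hy.1.symm
      have : (hG.nbrs (Sum.inr ⟨j, x⟩)).filter (· ∈ block W i) = ∅ := by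
        ext u
        rw [Finset.mem_filter, hG.mem_nbrs, mem_block]
        simp only [Finset.notMem_empty, iff_false]
        rintro ⟨h, y, rfl⟩
        exact hj (fst_eq_of_adj h)
      rw [this, if_neg hb]
      simp

theorem mem_essentialSpectrum [∀ i, Finite (W i)] {d : ℕ}
    (hreg : ∀ i, IsRegularGraph (Γ i) d) (hG : BoundedDegree (replaceEdges Γ p q k))
    (hcard : Tendsto (fun i => Nat.card (W i)) atTop atTop) :
    (d : ℂ) ∈ essentialSpectrum ((adjacencyMatrix (replaceEdges Γ p q k)).op hG) := by
  classical
  refine mem_essentialSpectrum_of_finsets hG d (block W)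
    (fun i => ⟨Sum.inr ⟨i, p i⟩, mem_block.2 ⟨_, rfl⟩⟩) (fun i j hij => ?_)
    (by simpa only [card_block] using hcard) (fun i => Sum.inl (k i)) (fun i => Sum.inl (k i + 1))
    fun i => ?_
  · rw [Finset.disjoint_left]
    intro v hv hv'
    obtain ⟨x, rfl⟩ := mem_block.1 hv
    obtain ⟨y, hy⟩ := mem_block.1 hv'
    simp only [Sum.inr.injEq, Sigma.mk.injEq] at hy
    exact hij hy.1.symm
  · ext v
    rw [(adjacencyMatrix_isAdjacency _).op_apply hG]
    simp only [lp.coeFn_add, lp.coeFn_smul, Pi.add_apply, Pi.smul_apply, indicatorVec_apply,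
      Finset.mem_singleton, smul_eq_mul]
    refine Eq.trans ?_ ((congrArg (Nat.cast (R := ℂ)) (card_nbrs_inter_block hreg hG i v)).trans ?_)
    · rw [Finset.card_filter]
      push_cast
      exact Finset.sum_congr rfl fun u _ => by congr
    · push_cast
      congr

/-! #### Local limits -/

theorem finite_level_le [∀ i, Finite (W i)] (hk : StrictMono k) (M : ℕ) :
    {v : ℕ ⊕ Σ i, W i | level k v ≤ M}.Finite := by
  refine ((Set.finite_Iic M).image Sum.inl |>.union
    ((Set.finite_Iic M).biUnion fun i _ => (block W i).finite_toSet)).subset ?_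
  rintro (n | ⟨i, x⟩) h
  · left
    have : 2 * n ≤ M := h
    exact ⟨n, by simp; omega, rfl⟩
  · right
    have h1 : 2 * k i + 1 ≤ M := h
    have h2 : i ≤ k i := hk.le_apply
    rw [Set.mem_iUnion₂]
    exact ⟨i, by simp; omega, mem_block.2 ⟨x, rfl⟩⟩

/-- Only finitely many vertices lie below a given level, and their distances from `v 0` are bounded.
-/
theorem _root_.IsPathToInfinity.tendsto_level [∀ i, Finite (W i)] (hk : StrictMono k)
    {v : ℕ → ℕ ⊕ Σ i, W i} (hv : IsPathToInfinity (replaceEdges Γ p q k) v) :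
    Tendsto (fun n => level k (v n)) atTop atTop := by
  rw [tendsto_atTop]
  intro M
  obtain ⟨B, hB⟩ := ((finite_level_le (W := W) hk M).image
    fun u => (replaceEdges Γ p q k).dist u (v 0)).bddAbove
  filter_upwards [hv.tendsto.eventually_gt_atTop B] with n hn
  by_contra h
  have : (replaceEdges Γ p q k).dist (v n) (v 0) ≤ B :=
    hB ⟨v n, show level k (v n) ≤ M by omega, rfl⟩
  omega

theorem level_le_of_mem_graphBall (hc : ∀ i, (Γ i).Connected) {u v : ℕ ⊕ Σ i, W i} {r : ℕ}
    (hu : u ∈ graphBall (replaceEdges Γ p q k) v r) :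
    level k v ≤ level k u + 2 * r ∧ level k u ≤ level k v + 2 * r := by
  have h1 : (replaceEdges Γ p q k).dist u v ≤ r := hu
  have h2 := level_le_add_dist (p := p) (q := q) (k := k) hc u v
  have h3 := level_le_add_dist (p := p) (q := q) (k := k) hc v u
  rw [SimpleGraph.dist_comm] at h3
  omega

variable {V' : Type*} {G' : SimpleGraph V'} {w : ℕ → ℕ ⊕ Σ i, W i} {o : V'}

/-- In a local limit along points of growing level, the vertices of degree two are those coming
from the half-line. -/
theorem eventually_bijOn (hc : ∀ i, (Γ i).Connected) (hk : StrictMono k) {d : ℕ} (hd : 2 < d)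
    (hreg : ∀ i, IsRegularGraph (Γ i) d) (hG' : G'.Connected)
    (h : LocallyConverges (replaceEdges Γ p q k) w G' o)
    (hw : Tendsto (fun j => level k (w j)) atTop atTop) {r : ℕ} (hr : 1 ≤ r) :
    ∀ᶠ j in atTop, ∃ f : V' → ℕ ⊕ Σ i, W i,
      Set.BijOn f (graphBall G' o r) (graphBall (replaceEdges Γ p q k) (w j) r) ∧
      (∀ x ∈ graphBall G' o r, ∀ y ∈ graphBall G' o r,
        (G'.Adj x y ↔ (replaceEdges Γ p q k).Adj (f x) (f y))) ∧
      (∀ x ∈ graphBall G' o r, Set.BijOn f (G'.neighborSet x)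
        ((replaceEdges Γ p q k).neighborSet (f x))) ∧
      ∀ x ∈ graphBall G' o r, ((G'.neighborSet x).encard = 2 ↔ ∃ n, f x = Sum.inl n) := by
  -- A level above `2 * r` keeps the end point `0` of the half-line out of the ball. Block vertices
  -- have degree at least `d > 2`, so degree two singles out the half-line.
  filter_upwards [h.eventually_bijOn_neighborSet (connected hc) hG' hr,
    hw.eventually_gt_atTop (2 * r)] with j ⟨f, hf, hadj, hN⟩ hj
  refine ⟨f, hf, hadj, hN, fun x hx => ?_⟩
  rw [← (hN x hx).injOn.encard_image, (hN x hx).image_eq]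
  have h1 := (level_le_of_mem_graphBall hc (hf.mapsTo hx)).1
  rcases hfx : f x with (_ | n) | s
  · rw [hfx] at h1
    simp only [level_inl] at h1
    omega
  · simp [encard_neighborSet_inl hk]
  · simp only [reduceCtorEq, exists_false, iff_false]
    intro h2
    have h3 := Set.encard_le_encard (Set.inter_subset_left
      (s := (replaceEdges Γ p q k).neighborSet (Sum.inr s)) (t := (Set.range Sum.inl)ᶜ))
    rw [encard_neighborSet_inr_inter hreg, h2] at h3
    have h4 : d ≤ 2 := by exact_mod_cast h3
    omega

/-- A cycle of the limit would reappear with the same length arbitrarily far out, where every cycle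
lies in some `Γ i` of larger girth. -/
theorem isTree_of_locallyConverges (hc : ∀ i, (Γ i).Connected) (hk : StrictMono k)
    (hgirth : Tendsto (fun i => (Γ i).girth) atTop atTop) (hG' : G'.Connected)
    (h : LocallyConverges (replaceEdges Γ p q k) w G' o)
    (hw : Tendsto (fun j => level k (w j)) atTop atTop) : G'.IsTree := by
  refine ⟨hG', fun x c hcyc => ?_⟩
  obtain ⟨r, hr⟩ := h.exists_isCycle hcyc
  obtain ⟨I, hI⟩ := eventually_atTop.1 (hgirth.eventually_gt_atTop c.length)
  obtain ⟨j, ⟨u, hu, c', hc', hlen⟩, hj⟩ :=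
    (hr.and (hw.eventually_gt_atTop (2 * k I + 1 + 2 * r))).exists
  obtain ⟨i, hi, hg⟩ := exists_girth_le hk hc'
  have h1 := (level_le_of_mem_graphBall hc hu).1
  have h2 : k I < k i := by omega
  have h3 := hI i (hk.lt_iff_lt.1 h2).le
  omega

theorem encard_inter_of_locallyConverges (hc : ∀ i, (Γ i).Connected) (hk : StrictMono k) {d : ℕ}
    (hd : 2 < d) (hreg : ∀ i, IsRegularGraph (Γ i) d) (hG' : G'.Connected)
    (h : LocallyConverges (replaceEdges Γ p q k) w G' o)
    (hw : Tendsto (fun j => level k (w j)) atTop atTop) (x : V')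
    (hx : x ∉ {x | (G'.neighborSet x).encard = 2}) :
    (G'.neighborSet x ∩ {x | (G'.neighborSet x).encard = 2}ᶜ).encard = d := by
  obtain ⟨r, hr, hxr⟩ := exists_mem_graphBall G' o {x}
  replace hxr := hxr x (by simp)
  -- With radius `r + 1` the degrees of the neighbours of `x` are read off correctly too.
  obtain ⟨j, f, hf, hadj, hN, hL⟩ :=
    (eventually_bijOn hc hk hd hreg hG' h hw (r := r + 1) (by omega)).exists
  have hxr' := graphBall_mono G' o (Nat.le_succ r) hxr
  have h1 : f '' (G'.neighborSet x ∩ {x | (G'.neighborSet x).encard = 2}ᶜ) =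
      (replaceEdges Γ p q k).neighborSet (f x) ∩ (Set.range Sum.inl)ᶜ := by
    rw [← (hN x hxr').image_eq]
    ext u
    constructor
    · rintro ⟨y, ⟨hy, hyL⟩, rfl⟩
      refine ⟨⟨y, hy, rfl⟩, fun ⟨n, hn⟩ => hyL ?_⟩
      exact (hL y (hG'.mem_graphBall_succ hxr hy)).2 ⟨n, hn.symm⟩
    · rintro ⟨⟨y, hy, rfl⟩, hu⟩
      refine ⟨y, ⟨hy, fun hyL => hu ?_⟩, rfl⟩
      obtain ⟨n, hn⟩ := (hL y (hG'.mem_graphBall_succ hxr hy)).1 hyL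
      exact ⟨n, hn.symm⟩
  rw [← ((hN x hxr').injOn.mono Set.inter_subset_left).encard_image, h1]
  rcases hfx : f x with n | s
  · exact absurd ((hL x hxr').2 ⟨n, hfx⟩) hx
  · exact encard_neighborSet_inr_inter hreg s

/-- Two mixed edges of the limit lie in a common ball of radius `r`, so their copies far out have
half-line ends at distance at most `2 * r`, where `exists_mixed_unique` applies. -/
theorem mixed_unique_of_locallyConverges (hc : ∀ i, (Γ i).Connected) (hk : StrictMono k) {d : ℕ}
    (hd : 2 < d) (hreg : ∀ i, IsRegularGraph (Γ i) d)
    (hpq : Tendsto (fun i => (Γ i).dist (p i) (q i)) atTop atTop)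
    (hkk : Tendsto (fun i => k (i + 1) - k i) atTop atTop) (hG' : G'.Connected)
    (h : LocallyConverges (replaceEdges Γ p q k) w G' o)
    (hw : Tendsto (fun j => level k (w j)) atTop atTop) :
    ∀ a ∈ {x | (G'.neighborSet x).encard = 2}, ∀ a' ∈ {x | (G'.neighborSet x).encard = 2},
    ∀ b, b ∉ {x | (G'.neighborSet x).encard = 2} → ∀ b', b' ∉ {x | (G'.neighborSet x).encard = 2} →
    G'.Adj a b → G'.Adj a' b' → a = a' ∧ b = b' := by
  classical
  intro a ha a' ha' b hb b' hb' hab hab'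
  obtain ⟨r, hr, hxr⟩ := exists_mem_graphBall G' o {a, a', b, b'}
  obtain ⟨N, hN⟩ := exists_mixed_unique (p := p) (q := q) hc hk hpq hkk (2 * r)
  obtain ⟨j, ⟨f, hf, hadj, -, hL⟩, hj⟩ := ((eventually_bijOn hc hk hd hreg hG' h hw hr).and
    (hw.eventually_gt_atTop (2 * N + 2 * r))).exists
  have har := hxr a (by simp)
  have har' := hxr a' (by simp)
  have hbr := hxr b (by simp)
  have hbr' := hxr b' (by simp)
  obtain ⟨n, hn⟩ := (hL a har).1 ha
  obtain ⟨n', hn'⟩ := (hL a' har').1 ha'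
  have hinr : ∀ y ∈ graphBall G' o r, y ∉ {x | (G'.neighborSet x).encard = 2} →
      ∃ s, f y = Sum.inr s := by
    intro y hy hyL
    rcases hfy : f y with m | s
    · exact absurd ((hL y hy).2 ⟨m, hfy⟩) hyL
    · exact ⟨s, rfl⟩
  obtain ⟨s, hs⟩ := hinr b hbr hb
  obtain ⟨s', hs'⟩ := hinr b' hbr' hb'
  have h1 := (hadj a har b hbr).1 hab
  have h2 := (hadj a' har' b' hbr').1 hab'
  have h3 := hf.mapsTo har
  have h4 := hf.mapsTo har'
  rw [hn, hs] at h1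
  rw [hn', hs'] at h2
  rw [hn] at h3
  rw [hn'] at h4
  have h5 := (level_le_of_mem_graphBall hc h3).1
  have h6 := (level_le_of_mem_graphBall hc h4).1
  simp only [level_inl] at h5 h6
  have h7 : (replaceEdges Γ p q k).dist (Sum.inl n) (Sum.inl n') ≤ 2 * r := by
    have h8 := (connected (p := p) (q := q) (k := k) hc).dist_triangle
      (u := Sum.inl n) (v := w j) (w := Sum.inl n')
    have h9 : (replaceEdges Γ p q k).dist (Sum.inl n) (w j) ≤ r := h3
    have h10 : (replaceEdges Γ p q k).dist (Sum.inl n') (w j) ≤ r := h4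
    rw [SimpleGraph.dist_comm (u := w j)] at h8
    omega
  obtain ⟨rfl, rfl⟩ := hN n n' s s' h1 h2 (by omega) (by omega) h7
  exact ⟨hf.injOn har har' (hn.trans hn'.symm), hf.injOn hbr hbr' (hs.trans hs'.symm)⟩

end ReplaceEdges

/-! ### Compactness: every sequence of base points has a locally convergent subsequence -/

section Balls

variable {V : Type*} {G : SimpleGraph V}

theorem graphBall_zero (hG : G.Connected) (v : V) : graphBall G v 0 = {v} := by
  ext u
  have : u ∈ graphBall G v 0 ↔ G.dist u v = 0 := Nat.le_zero
  rw [this, hG.dist_eq_zero_iff, Set.mem_singleton_iff]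

theorem mem_graphBall_succ_iff (hG : G.Connected) {v u : V} {r : ℕ} :
    u ∈ graphBall G v (r + 1) ↔ u ∈ graphBall G v r ∨ ∃ x ∈ graphBall G v r, G.Adj x u := by
  constructor
  · intro hu
    by_cases h : u ∈ graphBall G v r
    · exact Or.inl h
    · right
      have hne : u ≠ v := by
        rintro rfl
        exact h (by simp [graphBall])
      obtain ⟨x, hx, hd⟩ := hG.exists_adj_dist_add_one hne
      refine ⟨x, ?_, hx⟩
      have h1 : G.dist u v ≤ r + 1 := hu
      show G.dist x v ≤ r
      rw [G.dist_comm] at h1 ⊢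
      omega
  · rintro (h | ⟨x, hx, hxu⟩)
    · exact graphBall_mono G v (Nat.le_succ r) h
    · exact hG.mem_graphBall_succ hx hxu

theorem exists_encard_graphBall_le (hG : G.Connected) {D : ℕ}
    (hD : ∀ v, (G.neighborSet v).encard ≤ D) (r : ℕ) :
    ∃ C : ℕ, ∀ v, (graphBall G v r).encard ≤ C := by
  induction r with
  | zero => exact ⟨1, fun v => by rw [graphBall_zero hG]; simp⟩
  | succ r ih =>
    obtain ⟨C, hC⟩ := ih
    refine ⟨C + C * D, fun v => ?_⟩
    have hfin : (graphBall G v r).Finite := Set.finite_of_encard_le_coe (hC v)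
    have hsub : graphBall G v (r + 1) ⊆
        graphBall G v r ∪ ⋃ x ∈ hfin.toFinset, G.neighborSet x := by
      intro u hu
      rcases (mem_graphBall_succ_iff hG).1 hu with h | ⟨x, hx, hxu⟩
      · exact Or.inl h
      · exact Or.inr (Set.mem_biUnion (hfin.mem_toFinset.2 hx) hxu)
    refine (Set.encard_le_encard hsub).trans ((Set.encard_union_le _ _).trans ?_)
    push_cast
    gcongr
    · exact hC v
    · refine (Finset.set_encard_biUnion_le _ _).trans
        ((Finset.sum_le_sum fun x _ => hD x).trans ?_)
      rw [Finset.sum_const, nsmul_eq_mul]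
      gcongr
      have := hC v
      rw [hfin.encard_eq_coe_toFinset_card] at this
      exact_mod_cast this

theorem graphBall_finite (hG : G.Connected) (hb : BoundedDegree G) (v : V) (r : ℕ) :
    (graphBall G v r).Finite := by
  obtain ⟨D, hD⟩ := hb
  obtain ⟨C, hC⟩ := exists_encard_graphBall_le hG hD r
  exact Set.finite_of_encard_le_coe (hC v)

/-- A ball equal to the next one would be closed under adjacency, hence the whole infinite graph; so
balls grow strictly. -/
theorem le_ballCard (hG : G.Connected) (hb : BoundedDegree G) [Infinite V] (v : V) (r : ℕ) :
    r ≤ ballCard G v r := by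
  refine StrictMono.le_apply (f := ballCard G v) (strictMono_nat_of_lt_succ fun r => ?_)
  refine Set.ncard_lt_ncard ?_ (graphBall_finite hG hb v (r + 1))
  refine (graphBall_mono G v (Nat.le_succ r)).ssubset_of_ne fun heq => ?_
  have hall : ∀ u, u ∈ graphBall G v r := by
    intro u
    refine ((hG v u).mem_iff_of_no_boundary (L := graphBall G v r) fun x y hxy hx => ?_).1
      (by simp [graphBall])
    rw [heq]
    exact hG.mem_graphBall_succ hx hxy
  exact Set.infinite_univ ((graphBall_finite hG hb v r).subset fun u _ => hall u)

/-- An enumeration of the vertices in which the balls about `v` are initial segments. -/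
theorem exists_equiv_nat (hG : G.Connected) (hb : BoundedDegree G) [Infinite V] [Countable V]
    (v : V) : ∃ e : V ≃ ℕ, ∀ r u, u ∈ graphBall G v r ↔ e u < ballCard G v r := by
  obtain ⟨c, hc⟩ := exists_injective_nat V
  -- The predecessors of `u` when vertices are ordered by distance from `v`, with ties broken by
  -- `c`. Their number is the position of `u`.
  set S : V → Set V := fun u =>
    {x | G.dist x v < G.dist u v ∨ (G.dist x v = G.dist u v ∧ c x < c u)} with hS
  have hSball : ∀ r u, u ∈ graphBall G v r → S u ⊂ graphBall G v r := by
    intro r u hu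
    have hu' : G.dist u v ≤ r := hu
    refine ⟨fun x hx => ?_, fun h => ?_⟩
    · show G.dist x v ≤ r
      rcases hx with hx | hx <;> omega
    · rcases h hu with h | h <;> omega
  have hSfin : ∀ u, (S u).Finite := fun u =>
    (graphBall_finite hG hb v (G.dist u v)).subset (hSball _ u
      (show u ∈ graphBall G v (G.dist u v) from le_refl (G.dist u v))).subset
  set ρ : V → ℕ := fun u => (S u).ncard with hρ
  have hlt : ∀ x u, x ∈ S u → ρ x < ρ u := by
    intro x u hx
    refine Set.ncard_lt_ncard ⟨fun y hy => ?_, fun h => ?_⟩ (hSfin u)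
    · simp only [hS, Set.mem_ofPred_eq] at hx hy ⊢
      omega
    · rcases h hx with h | h <;> omega
  have hinj : Function.Injective ρ := by
    intro x y hxy
    by_contra hne
    have hcne : c x ≠ c y := fun h => hne (hc h)
    have : x ∈ S y ∨ y ∈ S x := by
      simp only [hS, Set.mem_ofPred_eq]
      omega
    rcases this with h | h
    · exact absurd hxy (hlt x y h).ne
    · exact absurd hxy (hlt y x h).ne'
  have hmap : ∀ r u, u ∈ graphBall G v r → ρ u < ballCard G v r := fun r u hu =>
    Set.ncard_lt_ncard (hSball r u hu) (graphBall_finite hG hb v r)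
  have himg : ∀ r, ρ '' graphBall G v r = Set.Iio (ballCard G v r) := by
    intro r
    refine Set.eq_of_subset_of_ncard_le ?_ ?_ (Set.finite_Iio _)
    · rintro _ ⟨u, hu, rfl⟩
      exact hmap r u hu
    · rw [Set.ncard_image_of_injective _ hinj, ← Finset.coe_Iio, Set.ncard_coe_finset,
        Nat.card_Iio]
      rfl
  refine ⟨Equiv.ofBijective ρ ⟨hinj, fun m => ?_⟩, fun r u => ⟨hmap r u, fun h => ?_⟩⟩
  · have h1 := le_ballCard hG hb v (m + 1)
    have h2 : m ∈ ρ '' graphBall G v (m + 1) := by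
      rw [himg]
      exact h1
    obtain ⟨u, -, hu⟩ := h2
    exact ⟨u, hu⟩
  · have h2 : ρ u ∈ ρ '' graphBall G v r := by
      rw [himg]
      exact h
    obtain ⟨x, hx, hxu⟩ := h2
    rwa [← hinj hxu]

/-- An enumeration in which the balls about `v` are initial segments is coherent. -/
def CoherentEnum.ofEquiv {v : V} (e : V ≃ ℕ)
    (he : ∀ r u, u ∈ graphBall G v r ↔ e u < ballCard G v r) : CoherentEnum G v where
  enum r :=
    { toFun := fun u => ⟨e u, (he r u).1 u.2⟩
      invFun := fun i => ⟨e.symm i, (he r _).2 (by simp)⟩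
      left_inv := fun u => by simp
      right_inv := fun i => by simp }
  coherent r s _ _ u _ _ := rfl

theorem CoherentEnum.ofEquiv_symm_apply {v : V} (e : V ≃ ℕ)
    (he : ∀ r u, u ∈ graphBall G v r ↔ e u < ballCard G v r) (r : ℕ) (i : Fin (ballCard G v r)) :
    (((CoherentEnum.ofEquiv e he).enum r).symm i : V) = e.symm i := rfl

end Balls

section Compactness

variable {V : Type*} {G : SimpleGraph V}

/-- Number the vertices outwards from each `w j`, and join two numbers in the limit if they are
adjacent for almost all `j` along a nonprincipal ultrafilter. Bounded degree bounds the ball sizes,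
so these also stabilise along the ultrafilter. Each finite set of these conditions holds for
infinitely many `j`, and a diagonal subsequence realises all of them. -/
theorem exists_local_limit (hG : G.Connected) (hb : BoundedDegree G) [Infinite V] [Countable V]
    (w : ℕ → V) : ∃ G' : SimpleGraph ℕ, G'.Connected ∧ BoundedDegree G' ∧ ∃ φ : ℕ → ℕ,
      StrictMono φ ∧ ∃ (η : ∀ j, CoherentEnum G (w (φ j))) (η' : CoherentEnum G' 0),
      ∀ r, 1 ≤ r → (∀ᶠ j in atTop, ballCard G (w (φ j)) r = ballCard G' 0 r) ∧
        Tendsto (fun j => if h : ballCard G (w (φ j)) r = ballCard G' 0 r then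
          Matrix.reindex (finCongr h) (finCongr h) ((η j).matrix (adjacencyMatrix G) r) else 0)
          atTop (𝓝 (η'.matrix (adjacencyMatrix G') r)) := by
  classical
  obtain ⟨D, hD⟩ := id hb
  choose e he using fun j => exists_equiv_nat hG hb (w j)
  set U : Ultrafilter ℕ := hyperfilter ℕ with hU
  have hc : ∀ r, ∃ c, ∀ᶠ j in U, ballCard G (w j) r = c := by
    intro r
    obtain ⟨C, hC⟩ := exists_encard_graphBall_le hG hD r
    have h1 : ∀ᶠ j in U, ∃ c ∈ Set.Iic C, ballCard G (w j) r = c := by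
      refine Eventually.of_forall fun j => ⟨_, ?_, rfl⟩
      have h2 := hC (w j)
      rw [← (graphBall_finite hG hb (w j) r).cast_ncard_eq] at h2
      exact_mod_cast h2
    obtain ⟨c, -, hc⟩ := (Ultrafilter.eventually_exists_mem_iff (Set.finite_Iic C)).1 h1
    exact ⟨c, hc⟩
  choose c hc using hc
  have hcle : ∀ r, r ≤ c r := by
    intro r
    obtain ⟨j, hj⟩ := (hc r).exists
    rw [← hj]
    exact le_ballCard hG hb (w j) r
  have hc0 : c 0 = 1 := by
    obtain ⟨j, hj⟩ := (hc 0).exists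
    rw [← hj, ballCard, graphBall_zero hG, Set.ncard_singleton]
  have hcm : Monotone c := by
    refine monotone_nat_of_le_succ fun r => ?_
    obtain ⟨j, hj, hj'⟩ := ((hc r).and (hc (r + 1))).exists
    rw [← hj, ← hj']
    exact Set.ncard_le_ncard (graphBall_mono _ _ (Nat.le_succ r)) (graphBall_finite hG hb _ _)
  set G' : SimpleGraph ℕ :=
    { Adj := fun m m' => ∀ᶠ j in U, G.Adj ((e j).symm m) ((e j).symm m')
      symm := ⟨fun m m' h => h.mono fun j hj => hj.symm⟩
      loopless := ⟨fun m h => by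
        obtain ⟨j, hj⟩ := h.exists
        exact hj.ne rfl⟩ } with hG'
  have hadj : ∀ m m', G'.Adj m m' ↔ ∀ᶠ j in U, G.Adj ((e j).symm m) ((e j).symm m') :=
    fun m m' => Iff.rfl
  have hmem : ∀ r, ∀ᶠ j in U, ∀ m, (e j).symm m ∈ graphBall G (w j) r ↔ m < c r := by
    intro r
    filter_upwards [hc r] with j hj m
    rw [he, Equiv.apply_symm_apply, hj]
  have hwalk : ∀ r m, m < c r → ∃ p : G'.Walk m 0, p.length ≤ r := by
    intro r
    induction r with
    | zero =>
      intro m hm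
      obtain rfl : m = 0 := by omega
      exact ⟨.nil, le_rfl⟩
    | succ r ih =>
      intro m hm
      by_cases hmr : m < c r
      · obtain ⟨p, hp⟩ := ih m hmr
        exact ⟨p, by omega⟩
      · have h1 : ∀ᶠ j in U, ∃ m' ∈ Set.Iio (c r), G.Adj ((e j).symm m) ((e j).symm m') := by
          filter_upwards [hmem r, hmem (r + 1)] with j hj hj'
          rcases (mem_graphBall_succ_iff hG).1 ((hj' m).2 hm) with h | ⟨x, hx, hxm⟩
          · exact absurd ((hj m).1 h) hmr
          · refine ⟨e j x, ?_, ?_⟩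
            · rw [Set.mem_Iio, ← hj, Equiv.symm_apply_apply]
              exact hx
            · rw [Equiv.symm_apply_apply]
              exact hxm.symm
        -- The neighbour in the smaller ball may depend on `j`; among finitely many candidates the
        -- ultrafilter selects one.
        obtain ⟨m', hm', h2⟩ := (Ultrafilter.eventually_exists_mem_iff (Set.finite_Iio _)).1 h1
        obtain ⟨p, hp⟩ := ih m' hm'
        exact ⟨.cons h2 p, by simpa using hp⟩
  have hstep : ∀ r m m', m < c r → G'.Adj m m' → m' < c (r + 1) := by
    intro r m m' hm h
    obtain ⟨j, hj, hj', hj2⟩ := (((hadj m m').1 h).and ((hmem r).and (hmem (r + 1)))).exists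
    rw [← hj2]
    exact hG.mem_graphBall_succ ((hj' m).2 hm) hj
  have hwalk' : ∀ m m' (p : G'.Walk m m') r, m < c r → m' < c (r + p.length) := by
    intro m m' p
    induction p with
    | nil => exact fun r h => h
    | cons h p ih =>
      intro r hr
      have := ih (r + 1) (hstep r _ _ hr h)
      rw [SimpleGraph.Walk.length_cons]
      convert this using 2
      omega
  have hconn : G'.Connected := by
    have h1 : ∀ m, G'.Reachable m 0 := by
      intro m
      obtain ⟨p, -⟩ := hwalk (m + 1) m (hcle (m + 1))
      exact ⟨p⟩
    exact ⟨fun m m' => (h1 m).trans (h1 m').symm⟩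
  have hball : ∀ r m, m ∈ graphBall G' 0 r ↔ m < c r := by
    intro r m
    constructor
    · intro hm
      have hm' : G'.dist m 0 ≤ r := hm
      obtain ⟨p, hp⟩ := hconn.exists_walk_length_eq_dist 0 m
      have h1 := hwalk' 0 m p 0 (by omega)
      rw [zero_add, hp, G'.dist_comm] at h1
      exact h1.trans_le (hcm hm')
    · intro hm
      obtain ⟨p, hp⟩ := hwalk r m hm
      exact (SimpleGraph.dist_le p).trans hp
  have hcard : ∀ r, ballCard G' 0 r = c r := by
    intro r
    have : graphBall G' 0 r = (Finset.Iio (c r) : Set ℕ) := by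
      ext m
      rw [hball]
      simp
    rw [ballCard, this, Set.ncard_coe_finset, Nat.card_Iio]
  have hfreq : ∀ N, ∃ᶠ j in atTop, (∀ r ∈ Finset.range (N + 1), ballCard G (w j) r = c r) ∧
      ∀ m ∈ Finset.range N, ∀ m' ∈ Finset.range N,
        (G.Adj ((e j).symm m) ((e j).symm m') ↔ G'.Adj m m') := by
    intro N
    have h1 : ∀ᶠ j in U, (∀ r ∈ Finset.range (N + 1), ballCard G (w j) r = c r) ∧
        ∀ m ∈ Finset.range N, ∀ m' ∈ Finset.range N,
          (G.Adj ((e j).symm m) ((e j).symm m') ↔ G'.Adj m m') := by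
      refine ((Finset.eventually_all _).2 fun r _ => hc r).and
        ((Finset.eventually_all _).2 fun m _ => (Finset.eventually_all _).2 fun m' _ => ?_)
      by_cases h : G'.Adj m m'
      · filter_upwards [(hadj m m').1 h] with j hj
        exact iff_of_true hj h
      · filter_upwards [Ultrafilter.eventually_not.2 (fun h' => h ((hadj m m').2 h'))] with j hj
        exact iff_of_false hj h
    exact h1.frequently.filter_mono Nat.hyperfilter_le_atTop
  obtain ⟨φ, hφ, hP⟩ := extraction_forall_of_frequently hfreq
  have he' : ∀ r u, u ∈ graphBall G' 0 r ↔ Equiv.refl ℕ u < ballCard G' 0 r := by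
    intro r u
    rw [hball, hcard]
    rfl
  have hlim : ∀ r, 1 ≤ r → (∀ᶠ j in atTop, ballCard G (w (φ j)) r = ballCard G' 0 r) ∧
      Tendsto (fun j => if h : ballCard G (w (φ j)) r = ballCard G' 0 r then
        Matrix.reindex (finCongr h) (finCongr h)
          ((CoherentEnum.ofEquiv (e (φ j)) (he (φ j))).matrix (adjacencyMatrix G) r) else 0)
        atTop (𝓝 ((CoherentEnum.ofEquiv (Equiv.refl ℕ) he').matrix (adjacencyMatrix G') r)) := by
    intro r _
    have h1 : ∀ j, r ≤ j → ballCard G (w (φ j)) r = ballCard G' 0 r := fun j hj => by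
      rw [(hP j).1 r (Finset.mem_range.2 (by omega)), hcard]
    refine ⟨eventually_atTop.2 ⟨r, h1⟩, tendsto_const_nhds.congr' ?_⟩
    filter_upwards [eventually_ge_atTop r, eventually_ge_atTop (c r)] with j hj hj'
    rw [dif_pos (h1 j hj)]
    ext i l
    simp only [Matrix.reindex_apply, Matrix.submatrix_apply, CoherentEnum.matrix,
      Matrix.of_apply, adjacencyMatrix_entry, CoherentEnum.ofEquiv_symm_apply]
    have hi : (i : ℕ) < c r := by rw [← hcard]; exact i.2
    have hl : (l : ℕ) < c r := by rw [← hcard]; exact l.2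
    have h2 := (hP j).2 i (Finset.mem_range.2 (by omega)) l (Finset.mem_range.2 (by omega))
    simp only [finCongr_symm, finCongr_apply, Fin.val_cast, Equiv.refl_symm, Equiv.refl_apply, h2]
    congr
  refine ⟨G', hconn, ?_, φ, hφ, fun j => CoherentEnum.ofEquiv (e (φ j)) (he (φ j)),
    CoherentEnum.ofEquiv (Equiv.refl ℕ) he', hlim⟩
  exact ⟨D, (locallyConverges_of_tendsto _ _ hlim).2.encard_neighborSet_le hG hconn hD⟩

end Compactness

/-! ### Geodesic rays -/

section Ray

variable {V : Type*} {G : SimpleGraph V}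

/-- A sequence of adjacent vertices whose `n`-th term has distance `n` from the first one. -/
structure IsGeodesicRay (G : SimpleGraph V) (v : ℕ → V) : Prop where
  adj : ∀ n, G.Adj (v n) (v (n + 1))
  dist_eq : ∀ n, G.dist (v 0) (v n) = n

/-- König's lemma for the sets `T x` of vertices reached from `o` by a geodesic through `x`: if `T
x` is infinite, so is `T x'` for one of the finitely many neighbours `x'` one step farther from `o`.
-/
theorem SimpleGraph.Connected.exists_isGeodesicRay (hG : G.Connected) (hb : BoundedDegree G)
    [Infinite V] (o : V) : ∃ v : ℕ → V, v 0 = o ∧ IsGeodesicRay G v := by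
  set T : V → Set V := fun x => {y | G.dist o x + G.dist x y = G.dist o y} with hT
  have hstep : ∀ x : {x // (T x).Infinite}, ∃ x' : {x // (T x).Infinite},
      G.Adj x x' ∧ G.dist o x' = G.dist o x + 1 := by
    rintro ⟨x, hx⟩
    by_contra! hcon
    refine hx (((Set.finite_singleton x).union ((hb.finite x).biUnion (t := fun x' =>
      {y | G.dist o x' = G.dist o x + 1 ∧ y ∈ T x'}) fun x' hx' => ?_)).subset fun y hy => ?_)
    · by_contra hinf
      have h1 : (T x').Infinite := by
        refine Set.Infinite.mono (fun y hy => ?_) hinf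
        exact hy.2
      obtain ⟨y, hy⟩ := Set.Infinite.nonempty hinf
      exact hcon ⟨x', h1⟩ hx' hy.1
    · by_cases hyx : y = x
      · exact Or.inl hyx
      · right
        obtain ⟨x', hx', hd⟩ := hG.exists_adj_dist_add_one (Ne.symm hyx)
        refine Set.mem_biUnion (show x' ∈ G.neighborSet x from hx'.symm) ?_
        have h1 : G.dist o x + G.dist x y = G.dist o y := hy
        have h2 := hG.dist_triangle (u := o) (v := x') (w := y)
        have h3 := hG.dist_le_dist_add_one o hx'.symm
        rw [G.dist_comm (u := y), G.dist_comm (u := y)] at hd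
        have h4 : G.dist o x' = G.dist o x + 1 := by omega
        exact ⟨h4, show G.dist o x' + G.dist x' y = G.dist o y by omega⟩
  choose next hadj hdist using hstep
  have ho : (T o).Infinite := by
    have : T o = Set.univ := by
      ext y
      simp [hT]
    rw [this]
    exact Set.infinite_univ
  set u : ℕ → {x // (T x).Infinite} := fun n => next^[n] ⟨o, ho⟩ with hu
  have hsucc : ∀ n, u (n + 1) = next (u n) := fun n => Function.iterate_succ_apply' next n _
  refine ⟨fun n => u n, rfl, fun n => ?_, fun n => ?_⟩
  · show G.Adj (u n) (u (n + 1))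
    rw [hsucc]
    exact hadj _
  · show G.dist o (u n) = n
    induction n with
    | zero => exact SimpleGraph.dist_self
    | succ n ih => rw [hsucc, hdist, ih]

variable {v : ℕ → V}

theorem IsGeodesicRay.isPathToInfinity (hv : IsGeodesicRay G v) : IsPathToInfinity G v := by
  have h : (fun n => G.dist (v n) (v 0)) = id := by
    funext n
    rw [G.dist_comm, hv.dist_eq]
    rfl
  refine ⟨fun n => (hv.adj n).symm, ?_, ?_⟩
  · rw [h]; exact monotone_id
  · rw [h]; exact tendsto_id

theorem IsGeodesicRay.injective (hv : IsGeodesicRay G v) : Function.Injective v := by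
  intro m n h
  rw [← hv.dist_eq m, ← hv.dist_eq n, h]

theorem IsGeodesicRay.dist_eq_sub (hv : IsGeodesicRay G v) (hG : G.Connected) {m n : ℕ}
    (h : m ≤ n) : G.dist (v m) (v n) = n - m := by
  have h1 := hG.dist_triangle (u := v 0) (v := v m) (w := v n)
  rw [hv.dist_eq, hv.dist_eq] at h1
  have h2 : ∀ l, G.dist (v m) (v (m + l)) ≤ l := by
    intro l
    induction l with
    | zero => simp
    | succ l ih =>
      have := hG.dist_le_dist_add_one (v m) (hv.adj (m + l))
      rw [← add_assoc]
      omega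
  have h3 := h2 (n - m)
  rw [Nat.add_sub_cancel' h] at h3
  omega

end Ray

namespace ReplaceEdges

variable {W : ℕ → Type*} {Γ : ∀ i, SimpleGraph (W i)} {p q : ∀ i, W i} {k : ℕ → ℕ}

/-! ### Levels along a geodesic ray -/

section RayLevels

variable {v : ℕ → ℕ ⊕ Σ i, W i}

theorem exists_crossing_lt {f : ℕ → ℕ} {m n : ℕ} (h0 : f 0 ≤ m) (hn : m < f n) :
    ∃ l < n, f l ≤ m ∧ m < f (l + 1) := by
  induction n with
  | zero => omega
  | succ n ih =>
    by_cases h : m < f n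
    · obtain ⟨l, hl, hl'⟩ := ih h
      exact ⟨l, by omega, hl'⟩
    · exact ⟨n, by omega, by omega, hn⟩

theorem dist_inr_le (hc : ∀ i, (Γ i).Connected) (i : ℕ) (x y : W i) :
    (replaceEdges Γ p q k).dist (Sum.inr ⟨i, x⟩) (Sum.inr ⟨i, y⟩) ≤ (Γ i).dist x y :=
  (hc i).dist_map_le (G' := replaceEdges Γ p q k) (π := fun x => (Sum.inr ⟨i, x⟩ : ℕ ⊕ Σ i, W i))
    (fun _ _ h => Or.inr (adj_inr_inr.2 h)) x y

/-- To descend, the ray would have to return through the only edge crossing that level, which it has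
already used on the way up; but it never repeats a vertex. -/
theorem monotone_level (hk : StrictMono k) (hv : IsGeodesicRay (replaceEdges Γ p q k) v)
    (h0 : v 0 = Sum.inl 0) : Monotone fun n => level k (v n) := by
  refine monotone_nat_of_le_succ fun n => ?_
  by_contra hlt
  obtain ⟨l, hl, hl1, hl2⟩ := exists_crossing_lt (f := fun n => level k (v n))
    (m := level k (v (n + 1))) (n := n) (by simp [h0]) (by omega)
  have := hv.injective (eq_of_crossing hk (hv.adj l) (hv.adj n).symm hl1 hl2 le_rfl (by omega)).1
  omega

variable [∀ i, Finite (W i)]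

/-- A geodesic ray traverses the edges which separate it from infinity. -/
theorem exists_traverse (hk : StrictMono k) (hv : IsGeodesicRay (replaceEdges Γ p q k) v)
    (h0 : v 0 = Sum.inl 0) {x y : ℕ ⊕ Σ i, W i} (h : (replaceEdges Γ p q k).Adj x y)
    (hlt : level k x < level k y) : ∃ n, v n = x ∧ v (n + 1) = y := by
  obtain ⟨n, hn⟩ := ((hv.isPathToInfinity.tendsto_level hk).eventually_gt_atTop (level k x)).exists
  obtain ⟨l, -, hl1, hl2⟩ := exists_crossing_lt (f := fun n => level k (v n)) (by simp [h0]) hn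
  exact ⟨l, eq_of_crossing hk (hv.adj l) h hl1 hl2 le_rfl hlt⟩

theorem exists_eq_inl (hk : StrictMono k) (hv : IsGeodesicRay (replaceEdges Γ p q k) v)
    (h0 : v 0 = Sum.inl 0) (m : ℕ) : ∃ n, v n = Sum.inl m := by
  obtain ⟨y, hy, hlt⟩ := exists_adj_above (Γ := Γ) (p := p) (q := q) (k := k) m
  obtain ⟨n, hn, -⟩ := exists_traverse hk hv h0 hy hlt
  exact ⟨n, hn⟩

theorem exists_eq_inr_right (hk : StrictMono k) (hv : IsGeodesicRay (replaceEdges Γ p q k) v)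
    (h0 : v 0 = Sum.inl 0) (i : ℕ) : ∃ n, v n = Sum.inr ⟨i, q i⟩ := by
  obtain ⟨n, hn, -⟩ := exists_traverse hk hv h0 (adj_iff.2 (Or.inl (.right i))) (by simp; omega)
  exact ⟨n, hn⟩

/-- A geodesic ray meets `Γ i` in a point far from both marked vertices. -/
theorem exists_eq_inr_mid (hc : ∀ i, (Γ i).Connected) (hk : StrictMono k)
    (hv : IsGeodesicRay (replaceEdges Γ p q k) v) (h0 : v 0 = Sum.inl 0) (i : ℕ) :
    ∃ n x, v n = Sum.inr ⟨i, x⟩ ∧ (Γ i).dist (p i) (q i) ≤ 2 * (Γ i).dist x (p i) + 1 ∧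
      (Γ i).dist (p i) (q i) ≤ 2 * (Γ i).dist x (q i) + 1 := by
  obtain ⟨S, hS, hS'⟩ := exists_traverse hk hv h0 (adj_iff.2 (Or.inl (.left i))) (by simp)
  obtain ⟨T, hT, hT'⟩ := exists_traverse hk hv h0 (adj_iff.2 (Or.inl (.right i))) (by simp; omega)
  have hG := connected (p := p) (q := q) (k := k) hc
  have hmono := monotone_level hk hv h0
  have hST : S + 1 ≤ T := by
    by_contra hlt
    have h1 : level k (v (T + 1)) ≤ level k (v (S + 1)) := hmono (by omega)
    rw [hS', hT'] at h1
    simp at h1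
    omega
  have h2 : (Γ i).dist (p i) (q i) ≤ T - (S + 1) := by
    rw [← hv.dist_eq_sub hG hST, hS', hT]
    simpa using dist_retract_le (p := p) (q := q) hc hk i (Sum.inr ⟨i, p i⟩) (Sum.inr ⟨i, q i⟩)
  -- The ray is at `p i` at time `S + 1` and at `q i` at time `T`. By monotonicity of the level it
  -- stays in `Γ i` in between. Rounding accounts for the `+ 1` in the bounds.
  set M := (S + 1 + T) / 2 with hM
  have hlev : level k (v M) = 2 * k i + 1 := by
    have h3 : level k (v (S + 1)) ≤ level k (v M) := hmono (by omega)
    have h4 : level k (v M) ≤ level k (v T) := hmono (by omega)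
    rw [hS'] at h3
    rw [hT] at h4
    simp at h3 h4
    omega
  rcases hvM : v M with m | ⟨j, x⟩
  · rw [hvM] at hlev
    simp at hlev
    omega
  · rw [hvM] at hlev
    have hij : k j = k i := by simpa using hlev
    obtain rfl := hk.injective hij
    refine ⟨M, x, hvM, ?_, ?_⟩
    · have h3 := hv.dist_eq_sub hG (show S + 1 ≤ M by omega)
      rw [hS', hvM, SimpleGraph.dist_comm] at h3
      have h4 := dist_inr_le (p := p) (q := q) (k := k) hc j x (p j)
      omega
    · have h3 := hv.dist_eq_sub hG (show M ≤ T by omega)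
      rw [hT, hvM] at h3
      have h4 := dist_inr_le (p := p) (q := q) (k := k) hc j x (q j)
      omega

end RayLevels

/-! #### The three kinds of limits occur -/

section Occurrence

variable [∀ i, Finite (W i)]

/-- Base points of growing level on the ray are visited at times tending to infinity, so a
subsequence has strictly increasing times, and compactness applies to it. -/
theorem exists_isRLimit (hc : ∀ i, (Γ i).Connected)
    (hb : BoundedDegree (replaceEdges Γ p q k)) {v : ℕ → ℕ ⊕ Σ i, W i}
    (hv : IsGeodesicRay (replaceEdges Γ p q k) v) (w : ℕ → ℕ ⊕ Σ i, W i)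
    (hwv : ∀ i, ∃ n, v n = w i) (hw : Tendsto (fun i => level k (w i)) atTop atTop) :
    ∃ (G' : SimpleGraph ℕ) (χ : ℕ → ℕ), G'.Connected ∧ StrictMono χ ∧
      IsRLimit (adjacencyMatrix (replaceEdges Γ p q k)) (adjacencyMatrix G') ∧
      LocallyConverges (replaceEdges Γ p q k) (fun j => w (χ j)) G' 0 := by
  have hG := connected (p := p) (q := q) (k := k) hc
  choose t ht using hwv
  have htt : Tendsto t atTop atTop := by
    rw [tendsto_atTop]
    intro B
    filter_upwards [hw.eventually_gt_atTop (level k (v 0) + 2 * B)] with i hi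
    have h1 := level_le_add_dist (p := p) (q := q) (k := k) hc (v 0) (w i)
    rw [← ht i, hv.dist_eq] at h1
    rw [← ht i] at hi
    omega
  obtain ⟨ψ, hψ, htψ⟩ := strictMono_subseq_of_tendsto_atTop htt
  obtain ⟨G', hG', hb', φ, hφ, η, η', hlim⟩ := exists_local_limit hG hb fun j => v (t (ψ j))
  refine ⟨G', ψ ∘ φ, hG', hψ.comp hφ, ⟨hG', hb', v, hv.isPathToInfinity, 0, t ∘ ψ ∘ φ,
    htψ.comp hφ, η, η', hlim⟩, ?_⟩
  have h1 := (locallyConverges_of_tendsto η η' hlim).2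
  simp only [ht] at h1
  exact h1

theorem exists_isLine (hc : ∀ i, (Γ i).Connected) (hk : StrictMono k) {d : ℕ} (hd : 2 < d)
    (hreg : ∀ i, IsRegularGraph (Γ i) d) (hgirth : Tendsto (fun i => (Γ i).girth) atTop atTop)
    (hkk : Tendsto (fun i => k (i + 1) - k i) atTop atTop) {v : ℕ → ℕ ⊕ Σ i, W i}
    (hv : IsGeodesicRay (replaceEdges Γ p q k) v) (h0 : v 0 = Sum.inl 0) :
    ∃ (V' : Type) (G' : SimpleGraph V'), IsLine G' ∧
      IsRLimit (adjacencyMatrix (replaceEdges Γ p q k)) (adjacencyMatrix G') := by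
  -- About the midpoint between consecutive blocks, balls of fixed radius meet no block in the end.
  set w : ℕ → ℕ ⊕ Σ i, W i := fun i => Sum.inl ((k i + k (i + 1)) / 2) with hwdef
  have hw : Tendsto (fun i => level k (w i)) atTop atTop := by
    refine tendsto_atTop_mono (fun i => ?_) tendsto_id
    have h1 : i ≤ k i := hk.le_apply
    have h2 : k i < k (i + 1) := hk (Nat.lt_succ_self i)
    simp only [hwdef, level_inl, id]
    omega
  obtain ⟨G', χ, hG', hχ, hR, hloc⟩ := exists_isRLimit hc (boundedDegree hk hreg) hv w
    (fun i => exists_eq_inl hk hv h0 _) hw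
  have hwχ := hw.comp hχ.tendsto_atTop
  refine ⟨ℕ, G', (isTree_of_locallyConverges hc hk hgirth hG' hloc hwχ).isLine fun x => ?_, hR⟩
  obtain ⟨r, hr, hxr⟩ := exists_mem_graphBall G' 0 {x}
  replace hxr := hxr x (by simp)
  obtain ⟨j, ⟨f, hf, -, -, hL⟩, hj⟩ := ((eventually_bijOn hc hk hd hreg hG' hloc hwχ hr).and
    ((hkk.comp hχ.tendsto_atTop).eventually_gt_atTop (2 * r + 3))).exists
  rw [hL x hxr]
  have h1 := level_le_of_mem_graphBall hc (hf.mapsTo hxr)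
  simp only [Function.comp_apply] at hj
  rcases hfx : f x with n | ⟨l, y⟩
  · exact ⟨n, rfl⟩
  · exfalso
    rw [hfx] at h1
    simp only [hwdef, level_inl, level_inr] at h1
    rcases Nat.lt_or_ge (χ j) l with hl | hl
    · have h2 : k (χ j + 1) ≤ k l := hk.monotone hl
      omega
    · have h2 : k l ≤ k (χ j) := hk.monotone hl
      omega

theorem exists_isRegularTree (hc : ∀ i, (Γ i).Connected) (hk : StrictMono k) {d : ℕ} (hd : 2 < d)
    (hreg : ∀ i, IsRegularGraph (Γ i) d) (hgirth : Tendsto (fun i => (Γ i).girth) atTop atTop)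
    (hpq : Tendsto (fun i => (Γ i).dist (p i) (q i)) atTop atTop) {v : ℕ → ℕ ⊕ Σ i, W i}
    (hv : IsGeodesicRay (replaceEdges Γ p q k) v) (h0 : v 0 = Sum.inl 0) :
    ∃ (V' : Type) (G' : SimpleGraph V'), IsRegularTree G' d ∧
      IsRLimit (adjacencyMatrix (replaceEdges Γ p q k)) (adjacencyMatrix G') := by
  choose t x ht hxp hxq using exists_eq_inr_mid hc hk hv h0
  have hw : Tendsto (fun i => level k (Sum.inr ⟨i, x i⟩)) atTop atTop := by
    refine tendsto_atTop_mono (fun i => ?_) tendsto_id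
    have h1 : i ≤ k i := hk.le_apply
    simp only [level_inr, id]
    omega
  obtain ⟨G', χ, hG', hχ, hR, hloc⟩ := exists_isRLimit hc (boundedDegree hk hreg) hv
    (fun i => Sum.inr ⟨i, x i⟩) (fun i => ⟨t i, ht i⟩) hw
  have hwχ := hw.comp hχ.tendsto_atTop
  refine ⟨ℕ, G', (isTree_of_locallyConverges hc hk hgirth hG' hloc
    hwχ).isRegularTree_of_forall_notMem
    (encard_inter_of_locallyConverges hc hk hd hreg hG' hloc hwχ) fun y hy => ?_, hR⟩
  obtain ⟨r, hr, hyr⟩ := exists_mem_graphBall G' 0 {y}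
  replace hyr := hyr y (by simp)
  obtain ⟨j, ⟨f, hf, -, -, hL⟩, hj⟩ := ((eventually_bijOn hc hk hd hreg hG' hloc hwχ hr).and
    ((hpq.comp hχ.tendsto_atTop).eventually_gt_atTop (2 * r + 1))).exists
  obtain ⟨n, hn⟩ := (hL y hyr).1 hy
  have h1 : (replaceEdges Γ p q k).dist (f y) (Sum.inr ⟨χ j, x (χ j)⟩) ≤ r := hf.mapsTo hyr
  have h2 := dist_retract_le (p := p) (q := q) hc hk (χ j) (f y) (Sum.inr ⟨χ j, x (χ j)⟩)
  simp only [Function.comp_apply] at hj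
  rw [retract_inr_self, SimpleGraph.dist_comm] at h2
  -- A vertex of the half-line retracts to a marked vertex, and both are farther than `r` from `x (χ
  -- j)`.
  have h3 : retract p q k (χ j) (f y) = p (χ j) ∨ retract p q k (χ j) (f y) = q (χ j) := by
    rw [hn]
    simp only [retract]
    split_ifs <;> simp
  have h4 := hxp (χ j)
  have h5 := hxq (χ j)
  rcases h3 with h3 | h3 <;> rw [h3] at h2 <;> omega

/-- The ball of radius one about `q i` contains the edge to `k i + 1`, so a mixed edge survives in
the limit. -/
theorem exists_isRegularTreeWithHalfLine (hc : ∀ i, (Γ i).Connected) (hk : StrictMono k) {d : ℕ}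
    (hd : 2 < d) (hreg : ∀ i, IsRegularGraph (Γ i) d)
    (hgirth : Tendsto (fun i => (Γ i).girth) atTop atTop)
    (hpq : Tendsto (fun i => (Γ i).dist (p i) (q i)) atTop atTop)
    (hkk : Tendsto (fun i => k (i + 1) - k i) atTop atTop) {v : ℕ → ℕ ⊕ Σ i, W i}
    (hv : IsGeodesicRay (replaceEdges Γ p q k) v) (h0 : v 0 = Sum.inl 0) :
    ∃ (V' : Type) (G' : SimpleGraph V'), IsRegularTreeWithHalfLine G' d ∧
      IsRLimit (adjacencyMatrix (replaceEdges Γ p q k)) (adjacencyMatrix G') := by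
  have hw : Tendsto (fun i => level k (Sum.inr ⟨i, q i⟩)) atTop atTop := by
    refine tendsto_atTop_mono (fun i => ?_) tendsto_id
    have h1 : i ≤ k i := hk.le_apply
    simp only [level_inr, id]
    omega
  obtain ⟨G', χ, hG', hχ, hR, hloc⟩ := exists_isRLimit hc (boundedDegree hk hreg) hv
    (fun i => Sum.inr ⟨i, q i⟩) (exists_eq_inr_right hk hv h0) hw
  have hwχ := hw.comp hχ.tendsto_atTop
  obtain ⟨j, f, hf, hadj, -, hL⟩ :=
    (eventually_bijOn hc hk hd hreg hG' hloc hwχ (r := 1) le_rfl).exists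
  have hedge : (replaceEdges Γ p q k).Adj (Sum.inl (k (χ j) + 1)) (Sum.inr ⟨χ j, q (χ j)⟩) :=
    adj_inl_inr.2 (Or.inr ⟨rfl, rfl⟩)
  obtain ⟨a, ha, hfa⟩ := hf.surjOn (show Sum.inl (k (χ j) + 1) ∈
    graphBall (replaceEdges Γ p q k) (Sum.inr ⟨χ j, q (χ j)⟩) 1 from
      (SimpleGraph.dist_eq_one_iff_adj.2 hedge).le)
  obtain ⟨b, hb, hfb⟩ := hf.surjOn (show Sum.inr ⟨χ j, q (χ j)⟩ ∈
    graphBall (replaceEdges Γ p q k) (Sum.inr ⟨χ j, q (χ j)⟩) 1 by simp [graphBall])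
  refine ⟨ℕ, G', (isTree_of_locallyConverges hc hk hgirth hG' hloc
    hwχ).isRegularTreeWithHalfLine (fun _ h => h)
    (encard_inter_of_locallyConverges hc hk hd hreg hG' hloc hwχ)
    (mixed_unique_of_locallyConverges hc hk hd hreg hpq hkk hG' hloc hwχ)
    (a := a) (o := b) ((hL a ha).2 ⟨_, hfa⟩) (fun h => ?_) ?_, hR⟩
  · obtain ⟨n, hn⟩ := (hL b hb).1 h
    rw [hfb] at hn
    exact Sum.inr_ne_inl hn
  · rw [hadj a ha b hb, hfa, hfb]
    exact hedge

end Occurrence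

/-! #### Classification of the limits -/

section RLimits

theorem _root_.IsRLimit.locallyConverges [∀ i, Finite (W i)] (hk : StrictMono k)
    {V' : Type*} {G' : SimpleGraph V'}
    {H' : JacobiMatrix G'} (h : IsRLimit (adjacencyMatrix (replaceEdges Γ p q k)) H') :
    H'.IsAdjacency ∧ ∃ (w : ℕ → ℕ ⊕ Σ i, W i) (o : V'),
      LocallyConverges (replaceEdges Γ p q k) w G' o ∧
      Tendsto (fun j => level k (w j)) atTop atTop := by
  obtain ⟨-, -, v, hv, o, n, hn, η, η', hlim⟩ := h
  obtain ⟨h1, h2⟩ := locallyConverges_of_tendsto η η' hlim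
  exact ⟨h1, _, o, h2, (hv.tendsto_level hk).comp hn.tendsto_atTop⟩

/-- Either some edge joins a vertex of degree two to another kind of vertex, or connectedness makes
all vertices of one kind. -/
theorem isLine_or_isRegularTree (hc : ∀ i, (Γ i).Connected) (hk : StrictMono k) {d : ℕ}
    (hd : 2 < d) (hreg : ∀ i, IsRegularGraph (Γ i) d)
    (hgirth : Tendsto (fun i => (Γ i).girth) atTop atTop)
    (hpq : Tendsto (fun i => (Γ i).dist (p i) (q i)) atTop atTop)
    (hkk : Tendsto (fun i => k (i + 1) - k i) atTop atTop) {V' : Type} {G' : SimpleGraph V'}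
    {w : ℕ → ℕ ⊕ Σ i, W i} {o : V'} (hG' : G'.Connected)
    (h : LocallyConverges (replaceEdges Γ p q k) w G' o)
    (hw : Tendsto (fun j => level k (w j)) atTop atTop) :
    IsLine G' ∨ IsRegularTree G' d ∨ IsRegularTreeWithHalfLine G' d := by
  have hT := isTree_of_locallyConverges hc hk hgirth hG' h hw
  have hdeg := encard_inter_of_locallyConverges hc hk hd hreg hG' h hw
  set L : Set V' := {x | (G'.neighborSet x).encard = 2} with hL
  by_cases hmix : ∃ a ∈ L, ∃ b, b ∉ L ∧ G'.Adj a b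
  · obtain ⟨a, ha, b, hb, hab⟩ := hmix
    exact Or.inr (Or.inr (hT.isRegularTreeWithHalfLine (fun _ hx => hx) hdeg
      (mixed_unique_of_locallyConverges hc hk hd hreg hpq hkk hG' h hw) ha hb hab))
  · push Not at hmix
    have hiff : ∀ x y, x ∈ L ↔ y ∈ L := fun x y =>
      (hG' x y).mem_iff_of_no_boundary fun a b hab ha => by
        by_contra hb
        exact hmix a ha b hb hab
    by_cases ho : o ∈ L
    · exact Or.inl (hT.isLine fun x => (hiff o x).1 ho)
    · exact Or.inr (Or.inl (hT.isRegularTree_of_forall_notMem hdeg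
        fun x hx => ho ((hiff o x).2 hx)))

/-- A vertex of degree other than two has `d` neighbours of its own kind and, by uniqueness of the
mixed edge, at most one of degree two. -/
theorem encard_neighborSet_le_of_locallyConverges (hc : ∀ i, (Γ i).Connected) (hk : StrictMono k)
    {d : ℕ} (hd : 2 < d) (hreg : ∀ i, IsRegularGraph (Γ i) d)
    (hpq : Tendsto (fun i => (Γ i).dist (p i) (q i)) atTop atTop)
    (hkk : Tendsto (fun i => k (i + 1) - k i) atTop atTop) {V' : Type} {G' : SimpleGraph V'}
    {w : ℕ → ℕ ⊕ Σ i, W i} {o : V'} (hG' : G'.Connected)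
    (h : LocallyConverges (replaceEdges Γ p q k) w G' o)
    (hw : Tendsto (fun j => level k (w j)) atTop atTop) (x : V') :
    (G'.neighborSet x).encard ≤ (d + 1 : ℕ) := by
  have hdeg := encard_inter_of_locallyConverges hc hk hd hreg hG' h hw x
  have huniq := mixed_unique_of_locallyConverges hc hk hd hreg hpq hkk hG' h hw
  set L : Set V' := {x | (G'.neighborSet x).encard = 2} with hL
  by_cases hx : x ∈ L
  · rw [show (G'.neighborSet x).encard = 2 from hx]
    have : 2 ≤ d + 1 := by omega
    exact_mod_cast this
  · rw [← Set.inter_union_compl (G'.neighborSet x) L, Set.union_comm]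
    refine (Set.encard_union_le _ _).trans ?_
    rw [hdeg hx]
    push_cast
    gcongr
    rw [Set.encard_le_one_iff]
    rintro a b ⟨ha, haL⟩ ⟨hb, hbL⟩
    exact (huniq a haL b hbL x hx x hx (SimpleGraph.Adj.symm ha) (SimpleGraph.Adj.symm hb)).1

theorem norm_le_of_mem_rLimitSpectra [∀ i, Finite (W i)]
    (hc : ∀ i, (Γ i).Connected) (hk : StrictMono k)
    {d : ℕ} (hd : 2 < d) (hreg : ∀ i, IsRegularGraph (Γ i) d)
    (hgirth : Tendsto (fun i => (Γ i).girth) atTop atTop)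
    (hpq : Tendsto (fun i => (Γ i).dist (p i) (q i)) atTop atTop)
    (hkk : Tendsto (fun i => k (i + 1) - k i) atTop atTop) {z : ℂ}
    (hz : z ∈ rLimitSpectra (adjacencyMatrix (replaceEdges Γ p q k))) : ‖z‖ ≤ 2 * √(d + 1) := by
  obtain ⟨V', G', hb', H', hR, hz⟩ := hz
  obtain ⟨hA, w, o, hloc, hw⟩ := hR.locallyConverges hk
  refine (isTree_of_locallyConverges hc hk hgirth hR.1 hloc hw).norm_le_of_mem_spectrum hb'
    (by positivity) (fun v => ?_) hA hz
  have h1 := encard_neighborSet_le_of_locallyConverges hc hk hd hreg hpq hkk hR.1 hloc hw v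
  rw [← (hb'.finite v).coe_toFinset, Set.encard_coe_eq_coe_finsetCard] at h1
  have h2 : (hb'.nbrs v).card ≤ d + 1 := by exact_mod_cast h1
  rw [Real.sq_sqrt (by positivity)]
  exact_mod_cast h2

end RLimits

end ReplaceEdges

/-! ### The choice of the data -/

theorem SimpleGraph.Connected.dist_lt_natCard {V : Type*} {G : SimpleGraph V} [Finite V]
    (hG : G.Connected) (u v : V) : G.dist u v < Nat.card V := by
  have := Fintype.ofFinite V
  obtain ⟨p, hp, hl⟩ := hG.exists_path_of_dist u v
  rw [← hl, Nat.card_eq_fintype_card]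
  exact hp.length_lt

end

theorem theorem3 :
    ∃ (d : ℕ) (W : ℕ → Type) (Γ : ∀ i, SimpleGraph (W i)) (p q : ∀ i, W i) (k : ℕ → ℕ)
      (hG : BoundedDegree (replaceEdges Γ p q k)),
      -- the data of the construction
      2 < d ∧
      (∀ i, Finite (W i) ∧ (Γ i).Connected ∧ IsRegularGraph (Γ i) d) ∧
      Tendsto (fun i => Nat.card (W i)) atTop atTop ∧
      Tendsto (fun i => (Γ i).girth) atTop atTop ∧
      Tendsto (fun i => (Γ i).dist (p i) (q i)) atTop atTop ∧
      StrictMono k ∧ Tendsto (fun i => k (i + 1) - k i) atTop atTop ∧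
      -- the graph is connected
      (replaceEdges Γ p q k).Connected ∧
      -- the point `d` of the essential spectrum is not in the closure of the spectra of `R`-limits
      (d : ℂ) ∈ essentialSpectrum ((adjacencyMatrix (replaceEdges Γ p q k)).op hG) \
        closure (rLimitSpectra (adjacencyMatrix (replaceEdges Γ p q k))) ∧
      -- every `R`-limit is the adjacency operator of one of three graphs
      (∀ (V' : Type) (G' : SimpleGraph V') (H' : JacobiMatrix G'),
        IsRLimit (adjacencyMatrix (replaceEdges Γ p q k)) H' →
          H'.IsAdjacency ∧
            (IsLine G' ∨ IsRegularTree G' d ∨ IsRegularTreeWithHalfLine G' d)) ∧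
      -- and each of the three occurs
      (∃ (V' : Type) (G' : SimpleGraph V'), IsLine G' ∧
        IsRLimit (adjacencyMatrix (replaceEdges Γ p q k)) (adjacencyMatrix G')) ∧
      (∃ (V' : Type) (G' : SimpleGraph V'), IsRegularTree G' d ∧
        IsRLimit (adjacencyMatrix (replaceEdges Γ p q k)) (adjacencyMatrix G')) ∧
      (∃ (V' : Type) (G' : SimpleGraph V'), IsRegularTreeWithHalfLine G' d ∧
        IsRLimit (adjacencyMatrix (replaceEdges Γ p q k)) (adjacencyMatrix G')) := by
  -- With `d = 8` the bound `2 * √(d + 1)` is exactly `6`, which is less than `d`.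
  choose W Γ p q hfin hc hreg hgirth hpq using
    exists_regularGraph_girth_gt (d := 8) (by norm_num)
  have hk : StrictMono fun i : ℕ => i * i := fun i j hij => Nat.mul_self_lt_mul_self hij
  have hkk : Tendsto (fun i : ℕ => (i + 1) * (i + 1) - i * i) atTop atTop := by
    refine tendsto_atTop_mono (fun i => ?_) tendsto_id
    have : (i + 1) * (i + 1) = i * i + 2 * i + 1 := by ring
    rw [this, id]
    omega
  have hgirth' : Tendsto (fun i => (Γ i).girth) atTop atTop :=
    tendsto_atTop_mono (fun i => (hgirth i).le) tendsto_id
  have hpq' : Tendsto (fun i => (Γ i).dist (p i) (q i)) atTop atTop :=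
    tendsto_atTop_mono (fun i => (hpq i).le) tendsto_id
  have hcard : Tendsto (fun i => Nat.card (W i)) atTop atTop :=
    tendsto_atTop_mono (fun i => ((hc i).dist_lt_natCard (p i) (q i)).le) hpq'
  have hG : BoundedDegree (replaceEdges Γ p q fun i => i * i) :=
    ReplaceEdges.boundedDegree hk hreg
  have hconn := ReplaceEdges.connected (p := p) (q := q) (k := fun i => i * i) hc
  obtain ⟨v, h0, hv⟩ := hconn.exists_isGeodesicRay hG (Sum.inl 0)
  refine ⟨8, W, Γ, p, q, fun i => i * i, hG, by norm_num, fun i => ⟨hfin i, hc i, hreg i⟩, hcard,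
    hgirth', hpq', hk, hkk, hconn,
    ⟨ReplaceEdges.mem_essentialSpectrum hreg hG hcard, fun hmem => ?_⟩,
    fun V' G' H' hR => ?_,
    ReplaceEdges.exists_isLine hc hk (by norm_num) hreg hgirth' hkk hv h0,
    ReplaceEdges.exists_isRegularTree hc hk (by norm_num) hreg hgirth' hpq' hv h0,
    ReplaceEdges.exists_isRegularTreeWithHalfLine hc hk (by norm_num) hreg hgirth' hpq' hkk hv h0⟩
  · have hsub : closure (rLimitSpectra (adjacencyMatrix (replaceEdges Γ p q fun i => i * i))) ⊆
        Metric.closedBall 0 (2 * √((8 : ℕ) + 1)) := by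
      refine closure_minimal (fun z hz => ?_) Metric.isClosed_closedBall
      rw [mem_closedBall_zero_iff]
      exact ReplaceEdges.norm_le_of_mem_rLimitSpectra hc hk (by norm_num) hreg hgirth' hpq' hkk hz
    have h1 := hsub hmem
    have h2 : √(((8 : ℕ) : ℝ) + 1) = 3 := by
      rw [show (((8 : ℕ) : ℝ) + 1) = 3 ^ 2 by norm_num, Real.sqrt_sq (by norm_num)]
    rw [mem_closedBall_zero_iff, h2] at h1
    norm_num at h1
  · obtain ⟨hA, w, o, hloc, hw⟩ := hR.locallyConverges hk
    exact ⟨hA, ReplaceEdges.isLine_or_isRegularTree hc hk (by norm_num) hreg hgirth' hpq' hkk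
      hR.1 hloc hw⟩
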